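/- Let $d\ge 2$, $k\ge 0$, and let $\Omega\subset\mathbb R^d$ be a bounded polyhedral domain: open, connected, equal to the interior of its closure, with $\overline\Omega$ a finite union of $d$-dimensional convex polytopes (for instance a Lipschitz polyhedral domain). **Mesh.** Let $\mathcal K_h$ be a finite partition of $\overline\Omega$ into non-overlapping closed $d$-dimensional polytopes, and $\mathcal F_h^K$ its finite set of non-overlapping flat $(d-1)$-dimensional polytopal faces. The boundary of each $K$ is the union of its faces; every face is a face of an element, and each face not contained in $\partial\Omega$ is shared by two elements. (Polytopes need not be convex.) For each $K$ let $x_K\in K$ be a point (for instance the centre of a largest ball contained in $K$) such that the cells $T_{K,F}$, $F$ a face of $K$, cover $K$ without overlapping and have $x_K$ outside the hyperplane of $F$. Here $T_{K,F}$ is the union of all segments from $x_K$ to points of $F$. Let $\mathcal T_h(K)$ be the set of these cells and $\mathcal T_h=\bigcup_K\mathcal T_h(K)$. Let $\boldsymbol n$ denote the outward unit normal on $\partial K$ and $h_D=\operatorname{diam} D$. The mesh is shape regular with parameters $\gamma,\eta$ if every element $K$, every face $F$ and every cell $T$ is star-shaped with respect to one of its points and contains a ball (for $F$: a $(d-1)$-dimensional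 ball in its hyperplane) of some radius $\rho_D>0$ with $h_D\le\gamma\rho_D$, $D=K,F,T$, and if $h_K\le \eta\, h_F$ for each face $F$ of each $K$. **Spaces.** Let $\mathbb P_j(D)$ be the polynomials on $D$ of degree at most $j$. Put $$M_h=\{u_h=\{u_0,u_b\}: u_0|_K\in\mathbb P_{k+1}(K),\ u_b|_F\in\mathbb P_k(F),\ K\in\mathcal K_h,\ F\in\mathcal F_h^K\},$$ $$M_h^0=\{u_h\in M_h: u_b|_F=0 \text{ for all faces } F\subset\partial\Omega\},$$ $$\Sigma_h^{-1}(K)=\prod_{T\in\mathcal T_h(K)}\mathbb P_k(T;\mathbb R^d),\qquad \Sigma_h^{-1}=\prod_K\Sigma_h^{-1}(K).$$ The weak gradient $\nabla_w u_h\in\Sigma_h^{-1}$ of $u_h\in M_h$ is defined by $$(\nabla_w u_h,\tau)_K=(\nabla u_0,\tau)_K+\langle u_b-u_0,\tau\cdot\boldsymbol n\rangle_{\partial K}\qquad\forall\,\tau\in\Sigma_h^{-1}(K),\ K\in\mathcal K_h,$$ where $(\cdot,\cdot)_K$ and $\langle\cdot,\cdot\rangle_{\partial K}$ are $L^2$ inner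 products; $\|\cdot\|$ is the $L^2(\Omega)$ norm, and $$\|u_h\|_{1,h}^2=\sum_{K}\|\nabla u_0\|_K^2+\sum_{K}h_K^{-1}\|u_0-u_b\|_{\partial K}^2 .$$ **Lemma.** For all $\gamma,\eta$ there are constants $c,C>0$, depending only on $d,k,\Omega,\gamma,\eta$, such that for every mesh as above which is shape regular with parameters $\gamma,\eta$: 1. each $u_h\in M_h$ has exactly one weak gradient $\nabla_w u_h\in\Sigma_h^{-1}$; 2. $c\,\|u_h\|_{1,h}\le\|\nabla_w u_h\|\le C\,\|u_h\|_{1,h}$ for all $u_h\in M_h^0$; 3. the stabilization-free weak Galerkin method is well-posed: for each $f\in L^2(\Omega)$ there is exactly one $u_h\in M_h^0$ with $$(\nabla_w u_h,\nabla_w v)=(f,v_0)\qquad\forall\, v=\{v_0,v_b\}\in M_h^0,$$ and it satisfies $\|u_h\|_{1,h}\le C\|f\|$. -/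

import Mathlib

open MeasureTheory

/-- The Euclidean space `ℝ^d`. -/
abbrev Euc (d : ℕ) : Type := EuclideanSpace ℝ (Fin d)

/-! ### Polytopes and polyhedral domains -/

/-- An `n`-dimensional (closed, not necessarily convex) polytope in `ℝ^d`: a nonempty finite union
of `n`-dimensional convex polytopes which all lie in one `n`-dimensional affine subspace. -/
def IsPolytope {d : ℕ} (n : ℕ) (S : Set (Euc d)) : Prop :=
  S.Nonempty ∧ Module.finrank ℝ (vectorSpan ℝ S) = n ∧
    ∃ 𝒱 : Finset (Finset (Euc d)),
      (∀ V ∈ 𝒱, Module.finrank ℝ (vectorSpan ℝ (V : Set (Euc d))) = n) ∧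
      S = ⋃ V ∈ 𝒱, convexHull ℝ (V : Set (Euc d))

/-- A bounded polyhedral domain: open, connected, with polytopal closure, and lying (up to its
boundary) on one side of its boundary only, i.e. `Ω` is the interior of its closure. Every bounded
Lipschitz polyhedral domain is of this kind. -/
structure IsPolyhedralDomain {d : ℕ} (Ω : Set (Euc d)) : Prop where
  isOpen : IsOpen Ω
  isConnected : IsConnected Ω
  interior_closure : interior (closure Ω) = Ω
  isPolytope : IsPolytope d (closure Ω)

/-- `S` is star-shaped with chunkiness parameter at most `γ`: it is star-shaped with respect to
one of its points and contains a ball (of its affine span) of some radius `r > 0` such that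
`diam S ≤ γ r`. For a `(d-1)`-dimensional face the ball is `(d-1)`-dimensional. -/
def HasChunkinessLE {d : ℕ} (γ : ℝ) (S : Set (Euc d)) : Prop :=
  (∃ p ∈ S, StarConvex ℝ p S) ∧
    ∃ c ∈ S, ∃ r : ℝ, 0 < r ∧
      (affineSpan ℝ S : Set (Euc d)) ∩ Metric.closedBall c r ⊆ S ∧ Metric.diam S ≤ γ * r

/-! ### The primal mesh and its subdivision -/

/-- A polytopal partition of `Ω`, together with the centres `x_K` that define the subdivision of
each element `K` into the cones with apex `x_K` over the faces of `K`. -/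
structure PolytopalMesh {d : ℕ} (Ω : Set (Euc d)) where
  /-- number of elements -/
  nElem : ℕ
  /-- number of faces -/
  nFace : ℕ
  /-- the elements `K` -/
  elem : Fin nElem → Set (Euc d)
  /-- the faces `F` -/
  face : Fin nFace → Set (Euc d)
  /-- the faces of an element -/
  faces : Fin nElem → Finset (Fin nFace)
  /-- the point `x_K` -/
  center : Fin nElem → Euc d
  /-- `normal K F` is the outward unit normal vector of `K` on its face `F` -/
  normal : Fin nElem → Fin nFace → Euc d
  elem_polytope : ∀ K, IsPolytope d (elem K)
  face_polytope : ∀ F, IsPolytope (d - 1) (face F)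
  /-- the elements cover `Ω` -/
  iUnion_elem : ⋃ K, elem K = closure Ω
  /-- distinct elements do not overlap -/
  elem_overlap : ∀ K K', K ≠ K' → volume (elem K ∩ elem K') = 0
  /-- the boundary of an element is the union of its faces -/
  frontier_elem : ∀ K, frontier (elem K) = ⋃ F ∈ faces K, face F
  /-- distinct faces do not overlap -/
  face_overlap : ∀ F F', F ≠ F' → μHE[d - 1] (face F ∩ face F') = 0
  /-- every face is a face of an element -/
  face_mem : ∀ F, ∃ K, F ∈ faces K
  /-- a face which is not contained in `∂Ω` is shared by two elements -/
  face_shared : ∀ F, ¬ face F ⊆ frontier Ω → ∃ K K', K ≠ K' ∧ F ∈ faces K ∧ F ∈ faces K'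
  /-- the cones with apex `x_K` over the faces of `K` cover `K` -/
  iUnion_cone : ∀ K, ⋃ F ∈ faces K, convexJoin ℝ {center K} (face F) = elem K
  /-- distinct cones do not overlap -/
  cone_overlap : ∀ K, ∀ F ∈ faces K, ∀ F' ∈ faces K, F ≠ F' →
    volume (convexJoin ℝ {center K} (face F) ∩ convexJoin ℝ {center K} (face F')) = 0
  norm_normal : ∀ K, ∀ F ∈ faces K, ‖normal K F‖ = 1
  /-- the normal vector is orthogonal to the face -/
  normal_orthogonal : ∀ K, ∀ F ∈ faces K, ∀ y ∈ face F, ∀ z ∈ face F,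
    inner ℝ (normal K F) (y - z) = 0
  /-- the normal vector points out of `K`: as the cone over `F` lies in `K`, this means that it
  points away from `x_K` -/
  normal_outward : ∀ K, ∀ F ∈ faces K, ∀ y ∈ face F,
    0 < inner ℝ (normal K F) (y - center K)

namespace PolytopalMesh

variable {d : ℕ} {Ω : Set (Euc d)}

/-- The cell `T ∈ 𝒯_h(K)` belonging to the face `F` of `K`: the union of all segments that
connect `x_K` to a point of `F`. -/
def cell (m : PolytopalMesh Ω) (K : Fin m.nElem) (F : Fin m.nFace) : Set (Euc d) :=
  convexJoin ℝ {m.center K} (m.face F)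

/-- Shape regularity: elements, faces and the cells of the subdivision are star-shaped with
chunkiness parameter at most `γ`, and the diameters of elements are at most `η` times those of
their faces. -/
structure IsShapeRegular (m : PolytopalMesh Ω) (γ η : ℝ) : Prop where
  elem_chunkiness : ∀ K, HasChunkinessLE γ (m.elem K)
  face_chunkiness : ∀ F, HasChunkinessLE γ (m.face F)
  cell_chunkiness : ∀ K, ∀ F ∈ m.faces K, HasChunkinessLE γ (m.cell K F)
  diam_le : ∀ K, ∀ F ∈ m.faces K, Metric.diam (m.elem K) ≤ η * Metric.diam (m.face F)

end PolytopalMesh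

/-! ### Polynomial spaces -/

/-- `ℙ_k(D)`: real polynomial functions on `D` of degree at most `k`. A function on `D` is
represented by its extension by zero to `ℝ^d`. -/
def PolyOn {d : ℕ} (k : ℕ) (D : Set (Euc d)) : Submodule ℝ (Euc d → ℝ) where
  carrier := {f | ∃ p : MvPolynomial (Fin d) ℝ, p.totalDegree ≤ k ∧
    f = D.indicator (fun x => MvPolynomial.eval (fun i => x i) p)}
  zero_mem' := ⟨0, by simp, by ext x; simp⟩
  add_mem' := by
    rintro f g ⟨p, hp, rfl⟩ ⟨q, hq, rfl⟩
    refine ⟨p + q, (MvPolynomial.totalDegree_add p q).trans (max_le hp hq), ?_⟩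
    rw [← Set.indicator_add']
    congr 1
    ext x
    simp
  smul_mem' := by
    rintro a f ⟨p, hp, rfl⟩
    refine ⟨a • p, (MvPolynomial.totalDegree_smul_le a p).trans hp, ?_⟩
    ext x
    by_cases hx : x ∈ D <;> simp [hx, MvPolynomial.smul_eval]

/-- `ℙ_k(D; ℝ^d)`: vector fields on `D` all of whose components belong to `ℙ_k(D)`. -/
def VecPolyOn {d : ℕ} (k : ℕ) (D : Set (Euc d)) : Submodule ℝ (Euc d → Euc d) where
  carrier := {τ | ∀ i, (fun x => τ x i) ∈ PolyOn k D}
  zero_mem' := fun _ => (PolyOn k D).zero_mem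
  add_mem' := fun hσ hτ i => (PolyOn k D).add_mem (hσ i) (hτ i)
  smul_mem' := fun a _ hτ i => (PolyOn k D).smul_mem a (hτ i)

/-! ### Spaces, weak gradient, norms -/

namespace PolytopalMesh

variable {d : ℕ} {Ω : Set (Euc d)}

/-- The space `M_h` of pairs `u_h = {u_0, u_b}` with `u_0|_K ∈ ℙ_{k+1}(K)` for all elements `K` and
`u_b|_F ∈ ℙ_k(F)` for all faces `F`. Here `u.1 K` is `u_0|_K` and `u.2 F` is `u_b|_F`. -/
abbrev Mh (m : PolytopalMesh Ω) (k : ℕ) : Type :=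
  (∀ K : Fin m.nElem, PolyOn (k + 1) (m.elem K)) × (∀ F : Fin m.nFace, PolyOn k (m.face F))

/-- The subspace `M_h^0` of those `u_h ∈ M_h` with `u_b|_F = 0` for all faces `F ⊆ ∂Ω`. -/
def Mh0 (m : PolytopalMesh Ω) (k : ℕ) : Submodule ℝ (m.Mh k) where
  carrier := {u | ∀ F, m.face F ⊆ frontier Ω → u.2 F = 0}
  zero_mem' := fun _ _ => rfl
  add_mem' := fun {u v} hu hv F hF => by
    change u.2 F + v.2 F = 0
    rw [hu F hF, hv F hF, add_zero]
  smul_mem' := fun a u hu F hF => by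
    change a • u.2 F = 0
    rw [hu F hF, smul_zero]

/-- The space `Σ_h^{-1}(K)` of vector fields on `K` which are polynomial of degree at most `k` on
each cell of `K`. -/
abbrev SigmaLoc (m : PolytopalMesh Ω) (k : ℕ) (K : Fin m.nElem) : Type :=
  ∀ F : m.faces K, VecPolyOn k (m.cell K F)

/-- The space `Σ_h^{-1}` of discontinuous, piecewise polynomial vector fields on `𝒯_h`. -/
abbrev SigmaInv (m : PolytopalMesh Ω) (k : ℕ) : Type :=
  ∀ K : Fin m.nElem, m.SigmaLoc k K

/-- The `L²` inner product `(σ, τ)_K` on `Σ_h^{-1}(K)`. -/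
noncomputable def innerLoc (m : PolytopalMesh Ω) {k : ℕ} {K : Fin m.nElem}
    (σ τ : m.SigmaLoc k K) : ℝ :=
  ∑ F : m.faces K, ∫ x in m.cell K F, inner ℝ ((σ F : Euc d → Euc d) x) ((τ F : Euc d → Euc d) x)

/-- The `L²` inner product `(σ, τ)` on `Σ_h^{-1}`. -/
noncomputable def innerSigma (m : PolytopalMesh Ω) {k : ℕ} (σ τ : m.SigmaInv k) : ℝ :=
  ∑ K, m.innerLoc (σ K) (τ K)

/-- The `L²` norm `‖σ‖` on `Σ_h^{-1}`. -/
noncomputable def normSigma (m : PolytopalMesh Ω) {k : ℕ} (σ : m.SigmaInv k) : ℝ :=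
  Real.sqrt (m.innerSigma σ σ)

/-- `w` is the weak gradient of `u = {u_0, u_b}`: for each element `K` and all `τ ∈ Σ_h^{-1}(K)`,
`(w, τ)_K = (∇ u_0, τ)_K + ⟨u_b - u_0, τ ⬝ n⟩_{∂K}`. -/
def IsWeakGrad (m : PolytopalMesh Ω) {k : ℕ} (u : m.Mh k) (w : m.SigmaInv k) : Prop :=
  ∀ (K : Fin m.nElem) (τ : m.SigmaLoc k K),
    m.innerLoc (w K) τ =
      (∑ F : m.faces K, ∫ x in m.cell K F,
        inner ℝ (gradient (u.1 K : Euc d → ℝ) x) ((τ F : Euc d → Euc d) x)) +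
      ∑ F : m.faces K, ∫ y in m.face F,
        ((u.2 F : Euc d → ℝ) y - (u.1 K : Euc d → ℝ) y) *
          inner ℝ ((τ F : Euc d → Euc d) y) (m.normal K F) ∂μHE[d - 1]

/-- The weak gradient operator `∇_w : M_h → Σ_h^{-1}`. -/
noncomputable def weakGrad (m : PolytopalMesh Ω) {k : ℕ} (u : m.Mh k) : m.SigmaInv k :=
  Classical.epsilon (m.IsWeakGrad u)

/-- The discrete norm `‖u_h‖_{1,h}`, where
`‖u_h‖_{1,h}² = ∑_K ‖∇ u_0‖_K² + ∑_K h_K⁻¹ ‖u_0 - u_b‖_{∂K}²` and `h_K = diam K`. -/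
noncomputable def normOneH (m : PolytopalMesh Ω) {k : ℕ} (u : m.Mh k) : ℝ :=
  Real.sqrt
    ((∑ K, ∫ x in m.elem K, ‖gradient (u.1 K : Euc d → ℝ) x‖ ^ 2) +
      ∑ K, (Metric.diam (m.elem K))⁻¹ * ∑ F ∈ m.faces K, ∫ y in m.face F,
        ((u.1 K : Euc d → ℝ) y - (u.2 F : Euc d → ℝ) y) ^ 2 ∂μHE[d - 1])

/-- `u ∈ M_h^0` solves the weak Galerkin scheme with right-hand side `f`:
`(∇_w u, ∇_w v) = (f, v_0)` for all `v ∈ M_h^0`. -/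
def IsWGSolution (m : PolytopalMesh Ω) {k : ℕ} (f : Euc d → ℝ) (u : m.Mh k) : Prop :=
  u ∈ m.Mh0 k ∧ ∀ v ∈ m.Mh0 k,
    m.innerSigma (m.weakGrad u) (m.weakGrad v) =
      ∑ K, ∫ x in m.elem K, f x * (v.1 K : Euc d → ℝ) x

end PolytopalMesh

/-! Polynomials of bounded degree form a finite-dimensional space, so their maximum norm on a fixed
ball is bounded by their `L²` norm on the unit ball. Rescaling turns this into inverse and trace
inequalities. Their constants depend only on dimension, degree and a bound `M` for `γ * η`, because
every cell and every face of an element `K` contains a ball of radius at least `h_K / M`.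

The test fields may jump between the cells of `K`. Hence the weak gradient decouples into one
identity per cell (`weakGrad_test`), whose only boundary term sits on the face `F` over which the
cell is built.

Upper bound: test with the weak gradient itself and use the trace inequality
(`exists_cell_upper_bound`).

Lower bound, gradient: the part of `∇u_0` tangential to `F` has degree at most `k` and no normal
component on `F`. Testing with it removes the jump and bounds it by the weak gradient on the cell
(`setIntegral_tangential_le`), hence on all of `K`. The tangential parts for two faces that are not
nearly parallel control the full gradient. Such faces exist: a ray from `x_K` parallel to one face
leaves `K` through a face whose normal makes a definite angle with that face's normal
(`exists_face_inner_ge`).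

Lower bound, jump: `u_0 - u_b` has degree `k + 1`, one too many for a test field. Replacing `u_0` by
its value `a` at a point of `F` costs only the gradient of `u_0`. The difference `a - u_b`, extended
constantly along the normal and multiplied by it, is an admissible test field (`exists_jump_bound`).

Well-posedness needs a discrete Poincaré inequality on `M_h^0`. On almost every line parallel to the
first axis, `u_0²` is piecewise smooth, has the interface values `u_b²`, and these vanish on `∂Ω`.
It is therefore bounded by its total variation (`le_total_variation`). Integrating over all lines
and absorbing with Young's inequality and the trace inequality gives `exists_poincare`. The bilinear
form is then definite on a finite-dimensional space, and testing with the solution yields the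
stability bound (`exists_wellPosed`). -/

/-! ### Polynomial functions -/

section Polynomials

open MvPolynomial

variable {n m k : ℕ}

/-- Evaluation of a polynomial at a point of Euclidean space. -/
noncomputable def pev (p : MvPolynomial (Fin n) ℝ) (x : Euc n) : ℝ := eval (fun i => x i) p

/-- Evaluation of a vector of polynomials at a point of Euclidean space. -/
noncomputable def vev (P : Fin n → MvPolynomial (Fin n) ℝ) (x : Euc n) : Euc n :=
  WithLp.toLp 2 fun i => pev (P i) x

@[simp] lemma vev_apply (P : Fin n → MvPolynomial (Fin n) ℝ) (x : Euc n) (i : Fin n) :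
    vev P x i = pev (P i) x := rfl

@[simp] lemma pev_zero (x : Euc n) : pev 0 x = 0 := by simp [pev]
@[simp] lemma pev_add (p q : MvPolynomial (Fin n) ℝ) (x : Euc n) :
    pev (p + q) x = pev p x + pev q x := by simp [pev]
@[simp] lemma pev_sub (p q : MvPolynomial (Fin n) ℝ) (x : Euc n) :
    pev (p - q) x = pev p x - pev q x := by simp [pev]
@[simp] lemma pev_mul (p q : MvPolynomial (Fin n) ℝ) (x : Euc n) :
    pev (p * q) x = pev p x * pev q x := by simp [pev]
@[simp] lemma pev_C (a : ℝ) (x : Euc n) : pev (C a) x = a := by simp [pev]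
@[simp] lemma pev_X (i : Fin n) (x : Euc n) : pev (X i) x = x i := by simp [pev]
@[simp] lemma pev_smul (a : ℝ) (p : MvPolynomial (Fin n) ℝ) (x : Euc n) :
    pev (a • p) x = a * pev p x := by simp [pev, smul_eval]
@[simp] lemma pev_sum {ι : Type*} (s : Finset ι) (p : ι → MvPolynomial (Fin n) ℝ) (x : Euc n) :
    pev (∑ i ∈ s, p i) x = ∑ i ∈ s, pev (p i) x := by simp [pev]

@[fun_prop] lemma continuous_pev (p : MvPolynomial (Fin n) ℝ) : Continuous (pev p) := by
  unfold pev
  exact (MvPolynomial.continuous_eval p).comp (by fun_prop)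

@[fun_prop] lemma continuous_vev (P : Fin n → MvPolynomial (Fin n) ℝ) : Continuous (vev P) := by
  unfold vev
  fun_prop

/-- The vector of partial derivatives of a polynomial. -/
noncomputable def gradPoly (p : MvPolynomial (Fin n) ℝ) (i : Fin n) : MvPolynomial (Fin n) ℝ :=
  pderiv i p

lemma hasGradientAt_pev (p : MvPolynomial (Fin n) ℝ) (x : Euc n) :
    HasGradientAt (pev p) (vev (gradPoly p) x) x := by
  rw [hasGradientAt_iff_hasFDerivAt]
  induction p using MvPolynomial.induction_on with
  | C a =>
    have h : pev (C a : MvPolynomial (Fin n) ℝ) = fun _ => a := by ext; simp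
    rw [h]
    refine (hasFDerivAt_const a x).congr_fderiv ?_
    ext v
    simp [gradPoly, PiLp.inner_apply]
  | add p q hp hq =>
    have h : pev (p + q) = fun x => pev p x + pev q x := by ext; simp
    rw [h]
    refine (hp.add hq).congr_fderiv ?_
    rw [← map_add]
    congr 1
    ext i
    simp [gradPoly]
  | mul_X p i hp =>
    have h : pev (p * X i) = fun x => pev p x * x i := by ext; simp
    rw [h]
    have hx : HasFDerivAt (fun y : Euc n => y i) (EuclideanSpace.proj i : Euc n →L[ℝ] ℝ) x :=
      (EuclideanSpace.proj i : Euc n →L[ℝ] ℝ).hasFDerivAt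
    refine (hp.mul hx).congr_fderiv ?_
    have h2 : vev (gradPoly (p * X i)) x
        = pev p x • EuclideanSpace.single i 1 + x i • vev (gradPoly p) x := by
      ext j
      by_cases hj : i = j
      · subst hj
        simp [gradPoly, Derivation.leibniz]
      · simp [gradPoly, Derivation.leibniz, pderiv_X_of_ne hj, Ne.symm hj]
    rw [h2]
    ext v
    simp [EuclideanSpace.inner_single_left]

lemma totalDegree_gradPoly_le {p : MvPolynomial (Fin n) ℝ} (hp : p.totalDegree ≤ k + 1)
    (i : Fin n) : (gradPoly p i).totalDegree ≤ k := by
  unfold gradPoly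
  rw [p.as_sum, map_sum]
  refine totalDegree_finsetSum_le fun s hs => ?_
  rw [pderiv_monomial]
  by_cases h : s i = 0
  · simp [h]
  refine (totalDegree_monomial_le _ _).trans ?_
  have h1 := (le_totalDegree hs).trans hp
  have h2 : s - Finsupp.single i 1 + Finsupp.single i 1 = s :=
    tsub_add_cancel_of_le (by simpa [Nat.one_le_iff_ne_zero] using h)
  have h3 : ((s - Finsupp.single i 1 + Finsupp.single i 1).sum fun _ e => e) ≤ k + 1 := by
    rw [h2]; exact h1
  rw [Finsupp.sum_add_index' (fun _ => rfl) (fun _ _ _ => rfl)] at h3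
  simp only [Finsupp.sum_single_index] at h3
  exact Nat.le_of_succ_le_succ h3

/-- Substituting affine functions does not raise the degree. This justifies scaling to the unit
ball, parametrizing hyperplanes and projecting onto them. -/
lemma exists_pev_comp {p : MvPolynomial (Fin m) ℝ} (hp : p.totalDegree ≤ k)
    (a : Fin m → MvPolynomial (Fin n) ℝ) (ha : ∀ i, (a i).totalDegree ≤ 1) :
    ∃ q : MvPolynomial (Fin n) ℝ, q.totalDegree ≤ k ∧
      ∀ x, pev q x = pev p (WithLp.toLp 2 fun i => pev (a i) x) := by
  refine ⟨bind₁ a p, ?_, fun x => ?_⟩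
  · rw [bind₁, aeval_def, eval₂_eq]
    refine totalDegree_finsetSum_le fun s hs => ?_
    refine (totalDegree_mul _ _).trans ?_
    rw [algebraMap_eq, totalDegree_C, zero_add]
    refine (totalDegree_finsetProd _ _).trans ?_
    refine le_trans ?_ ((le_totalDegree hs).trans hp)
    refine Finset.sum_le_sum fun i _ => (totalDegree_pow _ _).trans ?_
    simpa using Nat.mul_le_mul_left (s i) (ha i)
  · simp only [pev]
    rw [bind₁, aeval_def, eval_eval₂, eval₂_eq, eval_eq]
    simp

lemma exists_pev_comp_affine {p : MvPolynomial (Fin m) ℝ} (hp : p.totalDegree ≤ k)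
    (A : Euc n →ₗ[ℝ] Euc m) (c : Euc m) :
    ∃ q : MvPolynomial (Fin n) ℝ, q.totalDegree ≤ k ∧ ∀ x, pev q x = pev p (c + A x) := by
  obtain ⟨q, hq, h⟩ := exists_pev_comp hp
    (fun i => C (c i) + ∑ j, C (A (EuclideanSpace.single j 1) i) * X j) (n := n) fun i => by
      refine (totalDegree_add _ _).trans (max_le (by simp) ?_)
      refine totalDegree_finsetSum_le fun j _ => (totalDegree_mul _ _).trans ?_
      simp
  refine ⟨q, hq, fun x => ?_⟩
  rw [h]
  congr 1
  ext i
  have hx : x = ∑ j, x j • EuclideanSpace.single j (1 : ℝ) := by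
    ext i; simp [Pi.single_apply]
  conv_rhs => rw [hx]
  simp [mul_comm]

lemma eq_zero_of_pev_eq_zero_on_ball {p : MvPolynomial (Fin n) ℝ} {c : Euc n} {r : ℝ} (hr : 0 < r)
    (h : ∀ x ∈ Metric.ball c r, pev p x = 0) : p = 0 := by
  have ho : IsOpen ((WithLp.toLp 2 : (Fin n → ℝ) → Euc n) ⁻¹' Metric.ball c r) :=
    Metric.isOpen_ball.preimage (PiLp.continuous_toLp 2 _)
  have hc : c.ofLp ∈ ((WithLp.toLp 2 : (Fin n → ℝ) → Euc n) ⁻¹' Metric.ball c r) := by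
    simpa using hr
  obtain ⟨ε, hε, hsub⟩ := Metric.isOpen_iff.1 ho _ hc
  refine MvPolynomial.funext_set (fun i => Metric.ball (c i) ε) (fun i => ?_) fun x hx => ?_
  · rw [Real.ball_eq_Ioo]
    exact Set.Ioo_infinite (by linarith)
  · rw [← ball_pi _ hε] at hx
    simpa [pev] using h _ (hsub hx)

lemma integrableOn_of_continuous {f : Euc n → ℝ} (hf : Continuous f) {S : Set (Euc n)}
    (hS : IsCompact S) : IntegrableOn f S := hf.continuousOn.integrableOn_compact hS

lemma eq_zero_of_setIntegral_sq_eq_zero {p : MvPolynomial (Fin n) ℝ} {S : Set (Euc n)}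
    (hS : IsCompact S) {c : Euc n} {r : ℝ} (hr : 0 < r) (hB : Metric.closedBall c r ⊆ S)
    (h : ∫ x in S, pev p x ^ 2 = 0) : p = 0 := by
  rw [setIntegral_eq_zero_iff_of_nonneg_ae (Filter.Eventually.of_forall fun x => sq_nonneg _)
    (integrableOn_of_continuous (by fun_prop) hS)] at h
  have h1 : (fun x => pev p x ^ 2) =ᵐ[volume.restrict (Metric.ball c r)] fun _ => 0 :=
    ae_restrict_of_ae_restrict_of_subset (Metric.ball_subset_closedBall.trans hB) h
  have h2 := Measure.eqOn_open_of_ae_eq h1 Metric.isOpen_ball (by fun_prop) (by fun_prop)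
  exact eq_zero_of_pev_eq_zero_on_ball hr fun x hx => by simpa using h2 hx

end Polynomials

/-! ### Inverse inequalities for polynomials of bounded degree. -/

section SupBound

open MvPolynomial

variable {n : ℕ}

/-- Linear maps on a finite-dimensional space are bounded. The inner product enters as a core, so
that it is turned into a norm only inside the proof. -/
lemma exists_norm_sq_le_core {V : Type*} [AddCommGroup V] [Module ℝ V] [FiniteDimensional ℝ V]
    (core : InnerProductSpace.Core ℝ V) {W : Type*} [NormedAddCommGroup W] [NormedSpace ℝ W]
    (T : V →ₗ[ℝ] W) : ∃ C : ℝ, 0 < C ∧ ∀ v, ‖T v‖ ^ 2 ≤ C * core.inner v v := by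
  let := core.toNormedAddCommGroup
  let : InnerProductSpace ℝ V := .ofCore core.toCore
  let T' : V →L[ℝ] W := ⟨T, T.continuous_of_finiteDimensional⟩
  refine ⟨‖T'‖ ^ 2 + 1, by positivity, fun v => ?_⟩
  have h2 : ‖v‖ ^ 2 = core.inner v v := (real_inner_self_eq_norm_sq v).symm
  rw [← h2]
  calc ‖T v‖ ^ 2 ≤ (‖T'‖ * ‖v‖) ^ 2 := by
        gcongr
        exact T'.le_opNorm v
    _ ≤ (‖T'‖ ^ 2 + 1) * ‖v‖ ^ 2 := by nlinarith [sq_nonneg ‖v‖]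

/-- On polynomials of bounded degree, the supremum over a ball is bounded by the `L²` norm over the
unit ball. -/
lemma exists_sup_bound_unit (n k : ℕ) (M : ℝ) : ∃ C : ℝ, 0 < C ∧
    ∀ p : MvPolynomial (Fin n) ℝ, p.totalDegree ≤ k → ∀ x : Euc n, ‖x‖ ≤ M →
      pev p x ^ 2 ≤ C * ∫ y in Metric.closedBall (0 : Euc n) 1, pev p y ^ 2 := by
  let V := restrictTotalDegree (Fin n) ℝ k
  have hB : IsCompact (Metric.closedBall (0 : Euc n) 1) := isCompact_closedBall _ _
  have hint : ∀ p q : MvPolynomial (Fin n) ℝ,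
      IntegrableOn (fun x => pev p x * pev q x) (Metric.closedBall (0 : Euc n) 1) := fun p q =>
    integrableOn_of_continuous (by fun_prop) hB
  let core : InnerProductSpace.Core ℝ V :=
    { inner := fun p q => ∫ x in Metric.closedBall (0 : Euc n) 1, pev p.1 x * pev q.1 x
      conj_inner_symm := fun p q => by simp [mul_comm]
      re_inner_nonneg := fun p => integral_nonneg fun x => mul_self_nonneg _
      add_left := fun p q r => by
        rw [← integral_add (hint _ _) (hint _ _)]
        simp [add_mul]
      smul_left := fun p q a => by
        rw [conj_trivial, ← integral_const_mul]
        simp [mul_assoc]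
      definite := fun p h => Subtype.ext <|
        eq_zero_of_setIntegral_sq_eq_zero hB one_pos subset_rfl (by simpa [sq] using h) }
  -- The target carries the maximum norm over the ball of radius `M`, so boundedness of `T` is the
  -- desired estimate.
  let T : V →ₗ[ℝ] C(Metric.closedBall (0 : Euc n) M, ℝ) :=
    { toFun := fun p => ⟨fun x => pev p.1 x.1, by fun_prop⟩
      map_add' := fun p q => by ext; simp
      map_smul' := fun a p => by ext; simp }
  obtain ⟨C, hC, H⟩ := exists_norm_sq_le_core core T
  refine ⟨C, hC, fun p hp x hx => ?_⟩
  let v : V := ⟨p, (mem_restrictTotalDegree _ _ _).2 hp⟩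
  have h1 : |pev p x| ≤ ‖T v‖ :=
    ContinuousMap.norm_coe_le_norm (T v) ⟨x, by simpa using hx⟩
  have h2 : core.inner v v = ∫ y in Metric.closedBall (0 : Euc n) 1, pev p y ^ 2 :=
    integral_congr_ae (Filter.Eventually.of_forall fun y => by simp [sq, v])
  rw [← h2, ← sq_abs]
  exact le_trans (by gcongr) (H v)

lemma setIntegral_closedBall_eq (f : Euc n → ℝ) (c : Euc n) {r : ℝ} (hr : 0 < r) :
    ∫ x in Metric.closedBall c r, f x
      = r ^ n * ∫ y in Metric.closedBall (0 : Euc n) 1, f (c + r • y) := by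
  have h1 := (measurePreserving_add_left (volume : Measure (Euc n)) c).setIntegral_preimage_emb
    (MeasurableEquiv.addLeft c).measurableEmbedding f (Metric.closedBall c r)
  have h2 : (fun x => c + x) ⁻¹' Metric.closedBall c r = Metric.closedBall 0 r := by
    ext x; simp
  rw [h2] at h1
  have h3 := Measure.setIntegral_comp_smul (volume : Measure (Euc n)) (fun x => f (c + x))
    (Metric.closedBall 0 1) hr.ne'
  rw [smul_unitClosedBall_of_nonneg hr.le, finrank_euclideanSpace_fin, abs_of_pos (by positivity)]
    at h3
  rw [h3, ← h1, smul_eq_mul, ← mul_assoc, mul_inv_cancel₀ (by positivity), one_mul]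

/-- The inverse inequality between the maximum and `L²` norms, scaled to sets of diameter `h`. -/
lemma exists_sup_bound (n k : ℕ) {M : ℝ} (hM : 1 ≤ M) : ∃ C : ℝ, 0 < C ∧
    ∀ p : MvPolynomial (Fin n) ℝ, p.totalDegree ≤ k → ∀ (S : Set (Euc n)) (c : Euc n) (r h : ℝ),
      IsCompact S → 0 < r → Metric.closedBall c r ⊆ S → 0 < h → h ≤ M * r → ∀ x, dist x c ≤ h →
        pev p x ^ 2 * h ^ n ≤ C * ∫ y in S, pev p y ^ 2 := by
  obtain ⟨C, hC, H⟩ := exists_sup_bound_unit n k M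
  refine ⟨C * M ^ n, by positivity, fun p hp S c r h hS hr hB hh hhM x hx => ?_⟩
  -- The map `y ↦ c + r • y` takes the unit ball onto the ball inside `S`. Since `h ≤ M * r`, the
  -- preimage of `x` has norm at most `M`.
  obtain ⟨q, hq, hqp⟩ := exists_pev_comp_affine hp (r • (LinearMap.id : Euc n →ₗ[ℝ] Euc n)) c
  have h1 := H q hq (r⁻¹ • (x - c)) (by
    rw [norm_smul, norm_inv, Real.norm_of_nonneg hr.le, ← dist_eq_norm, inv_mul_le_iff₀ hr]
    linarith)
  simp only [hqp, LinearMap.smul_apply, LinearMap.id_apply, smul_smul, mul_inv_cancel₀ hr.ne',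
    one_smul, add_sub_cancel] at h1
  have h2 := setIntegral_closedBall_eq (fun x => pev p x ^ 2) c hr
  have h3 : ∫ y in Metric.closedBall c r, pev p y ^ 2 ≤ ∫ y in S, pev p y ^ 2 :=
    setIntegral_mono_set (integrableOn_of_continuous (by fun_prop) hS)
      (Filter.Eventually.of_forall fun _ => sq_nonneg _) hB.eventuallyLE
  calc pev p x ^ 2 * h ^ n ≤ (C * ∫ y in Metric.closedBall (0 : Euc n) 1, pev p (c + r • y) ^ 2) *
        (M * r) ^ n := by gcongr
    _ = C * M ^ n * ∫ y in Metric.closedBall c r, pev p y ^ 2 := by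
      rw [h2, mul_pow]; ring
    _ ≤ _ := by gcongr

lemma exists_sup_bound_vec (n k : ℕ) {M : ℝ} (hM : 1 ≤ M) : ∃ C : ℝ, 0 < C ∧
    ∀ P : Fin n → MvPolynomial (Fin n) ℝ, (∀ i, (P i).totalDegree ≤ k) →
      ∀ (S : Set (Euc n)) (c : Euc n) (r h : ℝ),
      IsCompact S → 0 < r → Metric.closedBall c r ⊆ S → 0 < h → h ≤ M * r → ∀ x, dist x c ≤ h →
        ‖vev P x‖ ^ 2 * h ^ n ≤ C * ∫ y in S, ‖vev P y‖ ^ 2 := by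
  obtain ⟨C, hC, H⟩ := exists_sup_bound n k hM
  refine ⟨C, hC, fun P hP S c r h hS hr hB hh hhM x hx => ?_⟩
  simp only [EuclideanSpace.real_norm_sq_eq, vev_apply]
  rw [integral_finsetSum _ fun i _ => integrableOn_of_continuous (by fun_prop) hS,
    Finset.sum_mul, Finset.mul_sum]
  exact Finset.sum_le_sum fun i _ => H (P i) (hP i) S c r h hS hr hB hh hhM x hx

/-- A polynomial is determined up to its gradient: the mean value inequality on a ball. -/
lemma sq_pev_sub_le {p : MvPolynomial (Fin n) ℝ} {c : Euc n} {h G : ℝ}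
    (hG : ∀ x, dist x c ≤ h → ‖vev (gradPoly p) x‖ ^ 2 ≤ G) {x : Euc n} (hx : dist x c ≤ h) :
    (pev p x - pev p c) ^ 2 ≤ h ^ 2 * G := by
  have hh : 0 ≤ h := dist_nonneg.trans hx
  have h0 : 0 ≤ G := (sq_nonneg _).trans (hG x hx)
  have h1 := (convex_closedBall c h).norm_image_sub_le_of_norm_hasFDerivWithin_le (𝕜 := ℝ)
    (f := pev p) (C := Real.sqrt G)
    (fun y _ => (hasGradientAt_pev p y).hasFDerivAt.hasFDerivWithinAt)
    (fun y hy => by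
      rw [LinearIsometryEquiv.norm_map]
      exact Real.le_sqrt_of_sq_le (hG y hy)) (Metric.mem_closedBall_self hh) (y := x) hx
  calc (pev p x - pev p c) ^ 2 = ‖pev p x - pev p c‖ ^ 2 := by simp
    _ ≤ (Real.sqrt G * ‖x - c‖) ^ 2 := by gcongr
    _ = ‖x - c‖ ^ 2 * G := by rw [mul_pow, Real.sq_sqrt h0, mul_comm]
    _ ≤ h ^ 2 * G := by
      rw [← dist_eq_norm]
      gcongr

lemma volume_real_closedBall_le (c : Euc n) {h : ℝ} (hh : 0 ≤ h) :
    volume.real (Metric.closedBall c h) = h ^ n * volume.real (Metric.ball (0 : Euc n) 1) := by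
  rw [measureReal_def, Measure.addHaar_closedBall _ _ hh, ENNReal.toReal_mul,
    ENNReal.toReal_ofReal (by positivity), finrank_euclideanSpace_fin, measureReal_def]

end SupBound

/-! ### Hyperplanes and the surface measure on faces. -/

section Hyperplane

open MvPolynomial

variable {n : ℕ}

/-- An isometric parametrization of the linear hyperplane with normal `ν`. -/
lemma exists_hyperplane_isometry {ν : Euc (n + 1)} (hν : ‖ν‖ = 1) :
    ∃ L : Euc n →ₗᵢ[ℝ] Euc (n + 1), ∀ v, (∃ x, L x = v) ↔ inner ℝ ν v = 0 := by
  have : Fact (Module.finrank ℝ (Euc (n + 1)) = n + 1) := ⟨finrank_euclideanSpace_fin⟩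
  have hν0 : ν ≠ 0 := by rintro rfl; simp at hν
  let e := (OrthonormalBasis.fromOrthogonalSpanSingleton (𝕜 := ℝ) n hν0).repr.symm
  refine ⟨(Submodule.subtypeₗᵢ _).comp e.toLinearIsometry, fun v => ?_⟩
  rw [← Submodule.mem_orthogonal_singleton_iff_inner_right]
  constructor
  · rintro ⟨x, rfl⟩
    exact (e x).2
  · intro h
    exact ⟨e.symm ⟨v, h⟩, by simp⟩

lemma isometry_const_add (L : Euc n →ₗᵢ[ℝ] Euc (n + 1)) (c : Euc (n + 1)) :
    Isometry fun x => c + L x :=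
  (IsometryEquiv.addLeft c).isometry.comp L.isometry

lemma measurableEmbedding_const_add (L : Euc n →ₗᵢ[ℝ] Euc (n + 1)) (c : Euc (n + 1)) :
    MeasurableEmbedding fun x => c + L x :=
  (isometry_const_add L c).isClosedEmbedding.measurableEmbedding

/-- Isometries preserve the normalized Hausdorff measure, and in `ℝ^n` this is Lebesgue measure.
Integrals over a face thus become integrals in `ℝ^n`. -/
lemma restrict_hausdorff_eq_map (L : Euc n →ₗᵢ[ℝ] Euc (n + 1)) (c : Euc (n + 1))
    {F : Set (Euc (n + 1))} (hF : MeasurableSet F) (hr : F ⊆ Set.range fun x => c + L x) :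
    (μHE[n] : Measure (Euc (n + 1))).restrict F
      = (Measure.map (fun x => c + L x) (volume : Measure (Euc n))).restrict F := by
  rw [← EuclideanSpace.euclideanHausdorffMeasure_eq_volume,
    (isometry_const_add L c).map_euclideanHausdorffMeasure, Measure.restrict_restrict hF,
    Set.inter_eq_left.2 hr]

lemma setIntegral_face_eq (L : Euc n →ₗᵢ[ℝ] Euc (n + 1)) (c : Euc (n + 1))
    {F : Set (Euc (n + 1))} (hF : MeasurableSet F) (hr : F ⊆ Set.range fun x => c + L x)
    (g : Euc (n + 1) → ℝ) :
    ∫ y in F, g y ∂μHE[n] = ∫ x in (fun x => c + L x) ⁻¹' F, g (c + L x) := by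
  rw [restrict_hausdorff_eq_map L c hF hr, (measurableEmbedding_const_add L c).setIntegral_map]

lemma hausdorff_face_eq (L : Euc n →ₗᵢ[ℝ] Euc (n + 1)) (c : Euc (n + 1))
    {F : Set (Euc (n + 1))} (hr : F ⊆ Set.range fun x => c + L x) :
    μHE[n] F = volume ((fun x => c + L x) ⁻¹' F) := by
  rw [← EuclideanSpace.euclideanHausdorffMeasure_eq_volume,
    (isometry_const_add L c).euclideanHausdorffMeasure_preimage, Set.inter_eq_left.2 hr]

lemma subset_range_of_inner_eq_zero {ν c : Euc (n + 1)} {L : Euc n →ₗᵢ[ℝ] Euc (n + 1)}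
    (hL : ∀ v, (∃ x, L x = v) ↔ inner ℝ ν v = 0) {F : Set (Euc (n + 1))}
    (hF : ∀ y ∈ F, inner ℝ ν (y - c) = 0) : F ⊆ Set.range fun x => c + L x := by
  intro y hy
  obtain ⟨x, hx⟩ := (hL _).2 (hF y hy)
  exact ⟨x, by simp [hx]⟩

lemma hausdorff_face_le {ν c : Euc (n + 1)} (hν : ‖ν‖ = 1) {F : Set (Euc (n + 1))}
    (hF : ∀ y ∈ F, inner ℝ ν (y - c) = 0) {h : ℝ} (hh : 0 ≤ h) (hd : ∀ y ∈ F, dist y c ≤ h) :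
    μHE[n] F ≤ ENNReal.ofReal (h ^ n * volume.real (Metric.ball (0 : Euc n) 1)) := by
  obtain ⟨L, hL⟩ := exists_hyperplane_isometry hν
  rw [hausdorff_face_eq L c (subset_range_of_inner_eq_zero hL hF), ← volume_real_closedBall_le 0 hh,
    ofReal_measureReal measure_closedBall_lt_top.ne]
  refine measure_mono fun x hx => ?_
  have h1 := hd _ hx
  simpa [dist_eq_norm] using h1

/-- The inverse inequality between the maximum norm on the hyperplane of a face and the `L²` norm
on this face. -/
lemma exists_face_sup_bound (n k : ℕ) {M : ℝ} (hM : 1 ≤ M) : ∃ C : ℝ, 0 < C ∧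
    ∀ p : MvPolynomial (Fin (n + 1)) ℝ, p.totalDegree ≤ k →
      ∀ (F : Set (Euc (n + 1))) (ν c : Euc (n + 1)) (r h : ℝ),
      IsCompact F → ‖ν‖ = 1 → (∀ y ∈ F, inner ℝ ν (y - c) = 0) → 0 < r →
      (∀ y, inner ℝ ν (y - c) = 0 → dist y c ≤ r → y ∈ F) → 0 < h → h ≤ M * r →
      ∀ x, inner ℝ ν (x - c) = 0 → dist x c ≤ h →
        pev p x ^ 2 * h ^ n ≤ C * ∫ y in F, pev p y ^ 2 ∂μHE[n] := by
  obtain ⟨C, hC, H⟩ := exists_sup_bound n k hM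
  refine ⟨C, hC, fun p hp F ν c r h hF hν hFc hr hB hh hhM x hx hxc => ?_⟩
  -- In isometric coordinates of the hyperplane the claim is the inverse inequality in dimension
  -- `n`.
  obtain ⟨L, hL⟩ := exists_hyperplane_isometry hν
  obtain ⟨q, hq, hqp⟩ := exists_pev_comp_affine hp L.toLinearMap c
  have hqp' : ∀ x, pev q x = pev p (c + L x) := hqp
  obtain ⟨y, hy⟩ := (hL _).2 hx
  have hxy : x = c + L y := by rw [hy]; abel
  rw [setIntegral_face_eq L c hF.measurableSet (subset_range_of_inner_eq_zero hL hFc)]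
  simp only [← hqp', hxy]
  refine H q hq _ 0 r h ?_ hr ?_ hh hhM y ?_
  · exact (isometry_const_add L c).isClosedEmbedding.isCompact_preimage hF
  · intro z hz
    refine hB _ ?_ ?_
    · simpa using (hL _).1 ⟨z, rfl⟩
    · simpa [dist_eq_norm] using hz
  · rw [hxy] at hxc
    simpa [dist_eq_norm] using hxc

/-- The orthogonal projection onto an affine hyperplane preserves polynomial degrees. -/
lemma exists_pev_comp_hyperplane_proj {k : ℕ} {p : MvPolynomial (Fin n) ℝ} (hp : p.totalDegree ≤ k)
    (ν c : Euc n) : ∃ q : MvPolynomial (Fin n) ℝ, q.totalDegree ≤ k ∧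
      ∀ x, pev q x = pev p (x - inner ℝ ν (x - c) • ν) := by
  obtain ⟨q, hq, h⟩ := exists_pev_comp_affine hp
    ((LinearMap.id : Euc n →ₗ[ℝ] Euc n) - (innerₛₗ ℝ ν).smulRight ν) (inner ℝ ν c • ν)
  refine ⟨q, hq, fun x => ?_⟩
  rw [h]
  congr 1
  simp only [LinearMap.sub_apply, LinearMap.id_apply, LinearMap.smulRight_apply, innerₛₗ_apply_apply,
    inner_sub_right, sub_smul]
  abel

end Hyperplane

/-! ### Affine spans of faces and cones. -/

section ConvexGeometry

variable {n : ℕ}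

lemma IsPolytope.isCompact {d j : ℕ} {S : Set (Euc d)} (h : IsPolytope j S) : IsCompact S := by
  obtain ⟨-, -, 𝒱, -, rfl⟩ := h
  exact 𝒱.finite_toSet.isCompact_biUnion fun V _ => V.finite_toSet.isCompact_convexHull ℝ

lemma mem_convexJoin_singleton_iff {d : ℕ} {x z : Euc d} {F : Set (Euc d)} :
    z ∈ convexJoin ℝ {x} F ↔ ∃ f ∈ F, ∃ s ∈ Set.Icc (0 : ℝ) 1, z = x + s • (f - x) := by
  simp only [convexJoin_singleton_left, Set.mem_iUnion, segment_eq_image', Set.mem_image,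
    exists_prop, eq_comm]

lemma isCompact_convexJoin_singleton {d : ℕ} (x : Euc d) {F : Set (Euc d)} (hF : IsCompact F) :
    IsCompact (convexJoin ℝ {x} F) := by
  have h : convexJoin ℝ {x} F = (fun q : Euc d × ℝ => x + q.2 • (q.1 - x)) ''
      (F ×ˢ Set.Icc (0 : ℝ) 1) := by
    ext z
    simp only [mem_convexJoin_singleton_iff, Set.mem_image, Set.mem_prod, Prod.exists]
    constructor
    · rintro ⟨f, hf, s, hs, rfl⟩
      exact ⟨f, s, ⟨hf, hs⟩, rfl⟩
    · rintro ⟨f, s, ⟨hf, hs⟩, rfl⟩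
      exact ⟨f, hf, s, hs, rfl⟩
  rw [h]
  exact (hF.prod isCompact_Icc).image (by fun_prop)

lemma vectorSpan_eq_of_inner_eq_zero {F : Set (Euc (n + 1))}
    (hF : Module.finrank ℝ (vectorSpan ℝ F) = n) {ν : Euc (n + 1)} (hν : ν ≠ 0)
    (h : ∀ y ∈ F, ∀ z ∈ F, inner ℝ ν (y - z) = 0) :
    vectorSpan ℝ F = (ℝ ∙ ν)ᗮ := by
  have : Fact (Module.finrank ℝ (Euc (n + 1)) = n + 1) := ⟨finrank_euclideanSpace_fin⟩
  refine Submodule.eq_of_le_of_finrank_eq ?_ ?_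
  · rw [vectorSpan_def, Submodule.span_le]
    rintro _ ⟨y, hy, z, hz, rfl⟩
    exact Submodule.mem_orthogonal_singleton_iff_inner_right.2 (h y hy z hz)
  · rw [hF, Submodule.finrank_orthogonal_span_singleton (n := n) hν]

/-- By dimension, the hyperplane of a face is its affine span. The ball in `HasChunkinessLE` is
therefore a full ball of this hyperplane. -/
lemma mem_affineSpan_of_inner_eq_zero {F : Set (Euc (n + 1))}
    (hF : Module.finrank ℝ (vectorSpan ℝ F) = n) {ν : Euc (n + 1)} (hν : ν ≠ 0)
    (h : ∀ y ∈ F, ∀ z ∈ F, inner ℝ ν (y - z) = 0) {c y : Euc (n + 1)} (hc : c ∈ F)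
    (hy : inner ℝ ν (y - c) = 0) : y ∈ affineSpan ℝ F := by
  have h1 : y - c ∈ vectorSpan ℝ F := by
    rw [vectorSpan_eq_of_inner_eq_zero hF hν h]
    exact Submodule.mem_orthogonal_singleton_iff_inner_right.2 hy
  rw [← direction_affineSpan] at h1
  have h2 := AffineSubspace.vadd_mem_of_mem_direction h1 (subset_affineSpan ℝ F hc)
  simpa using h2

/-- The directions of the base fill the hyperplane orthogonal to `ν`, and the apex lies off the
base's hyperplane. Hence the ball in `HasChunkinessLE` for a cell is a genuine `d`-dimensional ball.
-/
lemma affineSpan_cone_eq_top {F : Set (Euc (n + 1))}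
    (hF : Module.finrank ℝ (vectorSpan ℝ F) = n) {ν x : Euc (n + 1)} (hν : ν ≠ 0)
    (h : ∀ y ∈ F, ∀ z ∈ F, inner ℝ ν (y - z) = 0) {c : Euc (n + 1)} (hc : c ∈ F)
    (hx : inner ℝ ν (c - x) ≠ 0) : affineSpan ℝ (convexJoin ℝ {x} F) = ⊤ := by
  have hFT : F ⊆ convexJoin ℝ {x} F := fun y hy =>
    mem_convexJoin_singleton_iff.2 ⟨y, hy, 1, by simp, by simp⟩
  have hxT : x ∈ convexJoin ℝ {x} F :=
    mem_convexJoin_singleton_iff.2 ⟨c, hc, 0, by simp, by simp⟩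
  rw [AffineSubspace.affineSpan_eq_top_iff_vectorSpan_eq_top_of_nonempty ℝ _ _ ⟨x, hxT⟩, eq_top_iff]
  intro v _
  have h1 : c - x ∈ vectorSpan ℝ (convexJoin ℝ {x} F) :=
    vsub_mem_vectorSpan ℝ (hFT hc) hxT
  have h2 : v - (inner ℝ ν v / inner ℝ ν (c - x)) • (c - x) ∈
      vectorSpan ℝ (convexJoin ℝ {x} F) := by
    refine vectorSpan_mono ℝ hFT ?_
    rw [vectorSpan_eq_of_inner_eq_zero hF hν h, Submodule.mem_orthogonal_singleton_iff_inner_right,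
      inner_sub_right, inner_smul_right, div_mul_cancel₀ _ hx, sub_self]
  simpa using add_mem h2 (Submodule.smul_mem _ (inner ℝ ν v / inner ℝ ν (c - x)) h1)

/-- Near a relatively interior point of its base, a cone is a half-space. -/
lemma exists_half_ball_subset_cone {F : Set (Euc (n + 1))} {ν x y : Euc (n + 1)} {ε : ℝ}
    (hε : 0 < ε) (hF : ∀ z, inner ℝ ν (z - y) = 0 → dist z y < ε → z ∈ F)
    (hx : 0 < inner ℝ ν (y - x)) :
    ∃ δ > 0, ∀ z, dist z y < δ → inner ℝ ν (z - y) ≤ 0 → z ∈ convexJoin ℝ {x} F := by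
  -- `s z` is the height of `z` over the apex relative to that of the base, and `x + (s z)⁻¹ • (z -
  -- x)` is the central projection of `z` onto the base's hyperplane. Near `y` this projection lands
  -- in `F`, and `s z ≤ 1` holds exactly on the apex side.
  let s : Euc (n + 1) → ℝ := fun z => inner ℝ ν (z - x) / inner ℝ ν (y - x)
  have hs : Continuous s := by fun_prop
  have hsy : s y = 1 := div_self hx.ne'
  have hc : ContinuousAt (fun z => x + (s z)⁻¹ • (z - x)) y := by
    refine continuousAt_const.add ((hs.continuousAt.inv₀ ?_).smul (by fun_prop))
    rw [hsy]; exact one_ne_zero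
  have h1 : ∀ᶠ z in nhds y, dist (x + (s z)⁻¹ • (z - x)) y < ε := by
    have := hc.eventually (Metric.ball_mem_nhds _ hε)
    simpa [hsy] using this
  have h2 : ∀ᶠ z in nhds y, 0 < s z :=
    hs.continuousAt.eventually (lt_mem_nhds (by rw [hsy]; exact one_pos))
  obtain ⟨δ, hδ, hball⟩ := Metric.eventually_nhds_iff.1 (h1.and h2)
  refine ⟨δ, hδ, fun z hz hzν => ?_⟩
  obtain ⟨hz1, hz2⟩ := hball hz
  refine mem_convexJoin_singleton_iff.2 ⟨x + (s z)⁻¹ • (z - x), hF _ ?_ hz1, s z, ⟨hz2.le, ?_⟩, ?_⟩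
  · have : inner ℝ ν (z - x) = s z * inner ℝ ν (y - x) := by
      simp only [s]; field_simp
    have e : x + (s z)⁻¹ • (z - x) - y = (s z)⁻¹ • (z - x) - (y - x) := by abel
    rw [e, inner_sub_right, inner_smul_right, this]
    field_simp
    ring
  · rw [div_le_one hx]
    have : z - x = (z - y) + (y - x) := by abel
    rw [this, inner_add_right]
    linarith
  · rw [add_sub_cancel_left, smul_smul, mul_inv_cancel₀ hz2.ne', one_smul]
    abel

end ConvexGeometry

/-! ### Geometry of shape-regular elements. -/

namespace PolytopalMesh

variable {d n : ℕ}

section General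

variable {Ω : Set (Euc d)} (m : PolytopalMesh Ω)

lemma isCompact_elem (K : Fin m.nElem) : IsCompact (m.elem K) := (m.elem_polytope K).isCompact
lemma isCompact_face (F : Fin m.nFace) : IsCompact (m.face F) := (m.face_polytope F).isCompact
lemma isCompact_cell (K : Fin m.nElem) (F : Fin m.nFace) : IsCompact (m.cell K F) :=
  isCompact_convexJoin_singleton _ (m.isCompact_face F)

variable {m} {K : Fin m.nElem} {F : Fin m.nFace}

lemma cell_subset_elem (hF : F ∈ m.faces K) : m.cell K F ⊆ m.elem K := by
  rw [← m.iUnion_cone K]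
  exact Set.subset_biUnion_of_mem (u := fun F => convexJoin ℝ {m.center K} (m.face F)) hF

lemma face_subset_cell : m.face F ⊆ m.cell K F := fun y hy =>
  mem_convexJoin_singleton_iff.2 ⟨y, hy, 1, by simp, by simp⟩

lemma face_subset_elem (hF : F ∈ m.faces K) : m.face F ⊆ m.elem K :=
  face_subset_cell.trans (cell_subset_elem hF)

lemma face_nonempty (F : Fin m.nFace) : (m.face F).Nonempty := (m.face_polytope F).1

lemma center_mem_cell : m.center K ∈ m.cell K F := by
  obtain ⟨c, hc⟩ := face_nonempty F
  exact mem_convexJoin_singleton_iff.2 ⟨c, hc, 0, by simp, by simp⟩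

variable (m K) in
lemma faces_nonempty : (m.faces K).Nonempty := by
  obtain ⟨x, hx⟩ := (m.elem_polytope K).1
  rw [← m.iUnion_cone K, Set.mem_iUnion₂] at hx
  obtain ⟨F, hF, -⟩ := hx
  exact ⟨F, hF⟩

variable (m K) in
lemma center_mem_elem : m.center K ∈ m.elem K := by
  obtain ⟨F, hF⟩ := m.faces_nonempty K
  exact cell_subset_elem hF center_mem_cell

lemma dist_le_diam {x y : Euc d} (hx : x ∈ m.elem K) (hy : y ∈ m.elem K) :
    dist x y ≤ Metric.diam (m.elem K) :=
  Metric.dist_le_diam_of_mem (m.isCompact_elem K).isBounded hx hy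

end General

section Regular

variable {Ω : Set (Euc (n + 1))} {m : PolytopalMesh Ω} {K : Fin m.nElem} {F : Fin m.nFace}
  {γ η M : ℝ}

lemma normal_ne_zero (hF : F ∈ m.faces K) : m.normal K F ≠ 0 := by
  intro h
  simpa [h] using m.norm_normal K F hF

lemma exists_ball_subset_cell (hm : m.IsShapeRegular γ η) (hF : F ∈ m.faces K) :
    ∃ c ∈ m.cell K F, ∃ r : ℝ, 0 < r ∧ Metric.closedBall c r ⊆ m.cell K F ∧
      Metric.diam (m.cell K F) ≤ γ * r := by
  obtain ⟨-, c, hc, r, hr, hB, hd⟩ := hm.cell_chunkiness K F hF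
  refine ⟨c, hc, r, hr, ?_, hd⟩
  obtain ⟨y, hy⟩ := face_nonempty F
  rw [cell, affineSpan_cone_eq_top (m.face_polytope F).2.1 (normal_ne_zero hF)
    (m.normal_orthogonal K F hF) hy (m.normal_outward K F hF y hy).ne'] at hB
  simpa [cell] using hB

lemma exists_ball_subset_face (hm : m.IsShapeRegular γ η) (hF : F ∈ m.faces K) :
    ∃ c ∈ m.face F, ∃ r : ℝ, 0 < r ∧
      (∀ y, inner ℝ (m.normal K F) (y - c) = 0 → dist y c ≤ r → y ∈ m.face F) ∧
      Metric.diam (m.face F) ≤ γ * r := by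
  obtain ⟨-, c, hc, r, hr, hB, hd⟩ := hm.face_chunkiness F
  exact ⟨c, hc, r, hr, fun y hy hyr => hB ⟨mem_affineSpan_of_inner_eq_zero (m.face_polytope F).2.1
    (normal_ne_zero hF) (m.normal_orthogonal K F hF) hc hy, hyr⟩, hd⟩

lemma diam_elem_pos (m : PolytopalMesh Ω) (K : Fin m.nElem) :
    0 < Metric.diam (m.elem K) := by
  obtain ⟨F, hF⟩ := m.faces_nonempty K
  obtain ⟨y, hy⟩ := face_nonempty F
  have h1 := m.dist_le_diam (face_subset_elem hF hy) (m.center_mem_elem K)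
  refine lt_of_lt_of_le (dist_pos.2 ?_) h1
  rintro rfl
  simpa using m.normal_outward K F hF _ hy

lemma eta_pos (hm : m.IsShapeRegular γ η) (K : Fin m.nElem) : 0 < η := by
  obtain ⟨F, hF⟩ := m.faces_nonempty K
  have h1 := (m.diam_elem_pos K).trans_le (hm.diam_le K F hF)
  exact pos_of_mul_pos_left h1 Metric.diam_nonneg

/-- The size of an element is comparable with the radius of a ball in each of its cells. -/
lemma exists_ball_subset_cell' (hm : m.IsShapeRegular γ η) (hM : γ * η ≤ M)
    (hF : F ∈ m.faces K) :
    ∃ c ∈ m.cell K F, ∃ r : ℝ, 0 < r ∧ Metric.closedBall c r ⊆ m.cell K F ∧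
      Metric.diam (m.elem K) ≤ M * r := by
  obtain ⟨c, hc, r, hr, hB, hd⟩ := exists_ball_subset_cell hm hF
  refine ⟨c, hc, r, hr, hB, (hm.diam_le K F hF).trans ?_⟩
  have h1 : Metric.diam (m.face F) ≤ Metric.diam (m.cell K F) :=
    Metric.diam_mono face_subset_cell (m.isCompact_cell K F).isBounded
  calc η * Metric.diam (m.face F) ≤ η * (γ * r) :=
        mul_le_mul_of_nonneg_left (h1.trans hd) (eta_pos hm K).le
    _ = γ * η * r := by ring
    _ ≤ M * r := by gcongr

lemma exists_ball_subset_face' (hm : m.IsShapeRegular γ η) (hM : γ * η ≤ M)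
    (hF : F ∈ m.faces K) :
    ∃ c ∈ m.face F, ∃ r : ℝ, 0 < r ∧
      (∀ y, inner ℝ (m.normal K F) (y - c) = 0 → dist y c ≤ r → y ∈ m.face F) ∧
      Metric.diam (m.elem K) ≤ M * r := by
  obtain ⟨c, hc, r, hr, hB, hd⟩ := exists_ball_subset_face hm hF
  refine ⟨c, hc, r, hr, hB, (hm.diam_le K F hF).trans ?_⟩
  calc η * Metric.diam (m.face F) ≤ η * (γ * r) :=
        mul_le_mul_of_nonneg_left hd (eta_pos hm K).le
    _ = γ * η * r := by ring
    _ ≤ M * r := by gcongr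

/-- The distance of the centre of an element to its faces is comparable with its size. -/
lemma diam_le_mul_inner (hm : m.IsShapeRegular γ η) (hM : γ * η ≤ M) (hM0 : 0 ≤ M)
    (hF : F ∈ m.faces K) {y : Euc (n + 1)} (hy : y ∈ m.face F) :
    Metric.diam (m.elem K) ≤ M * inner ℝ (m.normal K F) (y - m.center K) := by
  obtain ⟨c, hc, r, hr, hB, hd⟩ := exists_ball_subset_cell' hm hM hF
  refine hd.trans (mul_le_mul_of_nonneg_left ?_ hM0)
  have hH := m.normal_outward K F hF y hy
  -- Heights of points of the cell lie between those of the apex and of the base, so a ball of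
  -- radius `r` in the cell forces the height of the base to be at least `r`.
  have key : ∀ z ∈ m.cell K F, 0 ≤ inner ℝ (m.normal K F) (z - m.center K) ∧
      inner ℝ (m.normal K F) (z - m.center K) ≤ inner ℝ (m.normal K F) (y - m.center K) := by
    intro z hz
    obtain ⟨f, hf, s, hs, rfl⟩ := mem_convexJoin_singleton_iff.1 hz
    have h1 := m.normal_orthogonal K F hF f hf y hy
    have h2 : f - m.center K = (f - y) + (y - m.center K) := by abel
    rw [add_sub_cancel_left, inner_smul_right, h2, inner_add_right, h1, zero_add]
    exact ⟨mul_nonneg hs.1 hH.le, mul_le_of_le_one_left hH.le hs.2⟩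
  have hν := m.norm_normal K F hF
  have h1 := (key (c + r • m.normal K F) (hB (by
    simp [hν, norm_smul, abs_of_pos hr]))).2
  have h2 := (key c hc).1
  have e : c + r • m.normal K F - m.center K = (c - m.center K) + r • m.normal K F := by abel
  rw [e, inner_add_right, inner_smul_right, real_inner_self_eq_norm_sq, hν] at h1
  linarith

/-- In each direction, an element has a face whose normal vector is not almost orthogonal to this
direction. -/
lemma exists_face_inner_ge (hm : m.IsShapeRegular γ η) (hM : γ * η ≤ M) (hM0 : 0 < M)
    (K : Fin m.nElem) {e : Euc (n + 1)} (he : ‖e‖ = 1) :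
    ∃ F ∈ m.faces K, 1 ≤ M * inner ℝ (m.normal K F) e := by
  -- Parameters of the points of `K` on the ray from `x_K` in direction `e`. The last one is a
  -- boundary point and hence lies on a face.
  let S : Set ℝ := Set.Ici 0 ∩ (fun s => m.center K + s • e) ⁻¹' m.elem K
  have hcont : Continuous fun s : ℝ => m.center K + s • e := by fun_prop
  have hS : IsCompact S := by
    refine Metric.isCompact_of_isClosed_isBounded
      (isClosed_Ici.inter ((m.isCompact_elem K).isClosed.preimage hcont)) ?_
    refine (Metric.isBounded_Icc (0 : ℝ) (Metric.diam (m.elem K))).subset ?_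
    rintro s ⟨hs0, hs⟩
    have h1 := m.dist_le_diam hs (m.center_mem_elem K)
    simp only [dist_eq_norm, add_sub_cancel_left, norm_smul, he, mul_one, Real.norm_eq_abs] at h1
    exact ⟨hs0, (le_abs_self s).trans h1⟩
  have hne : S.Nonempty := ⟨0, by simp [S, m.center_mem_elem K]⟩
  obtain ⟨s, ⟨hs0, hsK⟩, hmax⟩ := hS.exists_isMaxOn hne continuousOn_id
  have hfr : m.center K + s • e ∈ frontier (m.elem K) := by
    rw [(m.isCompact_elem K).isClosed.frontier_eq]
    refine ⟨hsK, fun hint => ?_⟩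
    have h1 : ∀ᶠ t in nhds s, m.center K + t • e ∈ m.elem K :=
      hcont.continuousAt.eventually (mem_interior_iff_mem_nhds.1 hint)
    obtain ⟨t, ht, hts⟩ := ((h1.filter_mono nhdsWithin_le_nhds).and
      (self_mem_nhdsWithin : Set.Ioi s ∈ nhdsWithin s (Set.Ioi s))).exists
    have h2 : t ≤ s := hmax ⟨le_trans hs0 (le_of_lt hts), ht⟩
    exact absurd hts (not_lt.2 h2)
  rw [m.frontier_elem K, Set.mem_iUnion₂] at hfr
  obtain ⟨F, hF, hy⟩ := hfr
  refine ⟨F, hF, ?_⟩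
  have h1 := m.normal_outward K F hF _ hy
  have h2 := diam_le_mul_inner hm hM hM0.le hF hy
  have h3 := m.dist_le_diam hsK (m.center_mem_elem K)
  simp only [dist_eq_norm, add_sub_cancel_left, norm_smul, he, mul_one, Real.norm_eq_abs] at h1 h2 h3
  rw [inner_smul_right] at h1 h2
  have hs : 0 < s := lt_of_le_of_ne hs0 (by rintro rfl; simp at h1)
  rw [abs_of_pos hs] at h3
  -- The exit parameter satisfies `s ≤ h_K`, while `h_K` is at most `M` times the height `s * inner
  -- ν e` of the face. Cancelling `s` gives the claim.
  have h4 : s * 1 ≤ s * (M * inner ℝ (m.normal K F) e) := by linarith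
  exact le_of_mul_le_mul_left h4 hs

end Regular

end PolytopalMesh

/-! ### Linear algebra and finite-dimensional polynomial spaces. -/

section Auxiliary

/-- Definiteness makes `B` injective into the dual, hence bijective by dimension. This yields both
the weak gradient and the discrete solution. -/
lemma existsUnique_of_definite {V : Type*} [AddCommGroup V] [Module ℝ V] [FiniteDimensional ℝ V]
    (B : V →ₗ[ℝ] V →ₗ[ℝ] ℝ) (hB : ∀ v, B v v = 0 → v = 0) (l : V →ₗ[ℝ] ℝ) :
    ∃! u, ∀ v, B u v = l v := by
  have hinj : Function.Injective B := by
    rw [← LinearMap.ker_eq_bot, LinearMap.ker_eq_bot']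
    exact fun v hv => hB v (by rw [hv]; rfl)
  have hsurj : Function.Surjective B :=
    (LinearMap.injective_iff_surjective_of_finrank_eq_finrank
      (Subspace.dual_finrank_eq (K := ℝ) (V := V)).symm).1 hinj
  obtain ⟨u, hu⟩ := hsurj l
  exact ⟨u, fun v => by rw [hu], fun u' hu' => hinj (by rw [hu]; ext v; exact hu' v)⟩

lemma setIntegral_iUnion_eq_sum {X : Type*} [TopologicalSpace X] [T2Space X] [MeasurableSpace X]
    [OpensMeasurableSpace X] {μ : Measure X} {ι : Type*} [Fintype ι] {s : ι → Set X}
    (hs : ∀ i, IsCompact (s i)) (hd : ∀ i j, i ≠ j → μ (s i ∩ s j) = 0) {f : X → ℝ}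
    (hf : IntegrableOn f (⋃ i, s i) μ) : ∫ x in ⋃ i, s i, f x ∂μ = ∑ i, ∫ x in s i, f x ∂μ := by
  rw [integral_iUnion_ae (fun i => (hs i).measurableSet.nullMeasurableSet)
    (fun i j hij => hd i j hij) hf, tsum_fintype]

variable {d k : ℕ} {D : Set (Euc d)}

lemma exists_rep_of_mem_polyOn (f : PolyOn k D) :
    ∃ p : MvPolynomial (Fin d) ℝ, p.totalDegree ≤ k ∧ (f : Euc d → ℝ) = D.indicator (pev p) := f.2

lemma exists_rep_of_mem_vecPolyOn (τ : VecPolyOn k D) :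
    ∃ P : Fin d → MvPolynomial (Fin d) ℝ, (∀ i, (P i).totalDegree ≤ k) ∧
      (τ : Euc d → Euc d) = D.indicator (vev P) := by
  choose P hP h using τ.2
  refine ⟨P, hP, ?_⟩
  ext x i
  have h1 := congrFun (h i) x
  by_cases hx : x ∈ D
  · simpa [hx, pev] using h1
  · simpa [hx] using h1

lemma indicator_vev_mem {P : Fin d → MvPolynomial (Fin d) ℝ} (hP : ∀ i, (P i).totalDegree ≤ k) :
    D.indicator (vev P) ∈ VecPolyOn k D := by
  intro i
  refine ⟨P i, hP i, ?_⟩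
  ext x
  by_cases hx : x ∈ D
  · simp [hx, pev]
  · simp [hx]

instance (k : ℕ) (D : Set (Euc d)) : FiniteDimensional ℝ (PolyOn k D) := by
  let T : MvPolynomial.restrictTotalDegree (Fin d) ℝ k →ₗ[ℝ] PolyOn k D :=
    { toFun := fun p => ⟨D.indicator (pev p.1),
        ⟨p.1, (MvPolynomial.mem_restrictTotalDegree _ _ _).1 p.2, rfl⟩⟩
      map_add' := fun p q => by
        ext x
        by_cases hx : x ∈ D <;> simp [hx]
      map_smul' := fun a p => by
        ext x
        by_cases hx : x ∈ D <;> simp [hx] }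
  refine Module.Finite.of_surjective T fun f => ?_
  obtain ⟨p, hp, h⟩ := exists_rep_of_mem_polyOn f
  exact ⟨⟨p, (MvPolynomial.mem_restrictTotalDegree _ _ _).2 hp⟩, Subtype.ext h.symm⟩

instance (k : ℕ) (D : Set (Euc d)) : FiniteDimensional ℝ (VecPolyOn k D) := by
  let T : VecPolyOn k D →ₗ[ℝ] (Fin d → PolyOn k D) :=
    { toFun := fun τ i => ⟨fun x => (τ : Euc d → Euc d) x i, τ.2 i⟩
      map_add' := fun _ _ => rfl
      map_smul' := fun _ _ => rfl }
  refine Module.Finite.of_injective T fun σ τ h => ?_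
  ext x i
  exact congrFun (congrArg Subtype.val (congrFun h i)) x

lemma setIntegral_inner_indicator (P Q : Fin d → MvPolynomial (Fin d) ℝ) (hD : MeasurableSet D) :
    ∫ x in D, inner ℝ (D.indicator (vev P) x) (D.indicator (vev Q) x)
      = ∫ x in D, inner ℝ (vev P x) (vev Q x) :=
  setIntegral_congr_fun hD fun x hx => by simp [hx]

lemma integrableOn_inner_vecPolyOn (hD : IsCompact D) (σ τ : VecPolyOn k D) :
    IntegrableOn (fun x => inner ℝ ((σ : Euc d → Euc d) x) ((τ : Euc d → Euc d) x)) D := by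
  obtain ⟨P, -, hP⟩ := exists_rep_of_mem_vecPolyOn σ
  obtain ⟨Q, -, hQ⟩ := exists_rep_of_mem_vecPolyOn τ
  rw [hP, hQ]
  have h : Continuous fun x => inner ℝ (vev P x) (vev Q x) := by fun_prop
  exact (integrableOn_of_continuous h hD).congr_fun (fun x hx => by simp [hx]) hD.measurableSet

end Auxiliary

/-! ### Null sets, representing polynomials and the weak gradient operator. -/

namespace PolytopalMesh

variable {n k : ℕ} {Ω : Set (Euc (n + 1))} {m : PolytopalMesh Ω} {K : Fin m.nElem}
  {F : Fin m.nFace} {γ η M : ℝ}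

lemma volume_face (F : Fin m.nFace) : volume (m.face F) = 0 := by
  refine measure_mono_null (subset_affineSpan ℝ _) (Measure.addHaar_affineSubspace _ _ ?_)
  intro h
  have h1 := (m.face_polytope F).2.1
  rw [← direction_affineSpan, h, AffineSubspace.direction_top, finrank_top,
    finrank_euclideanSpace_fin] at h1
  omega

lemma volume_frontier_elem (K : Fin m.nElem) : volume (frontier (m.elem K)) = 0 := by
  rw [m.frontier_elem K]
  exact (measure_biUnion_null_iff (m.faces K).countable_toSet).2 fun F _ => volume_face F

lemma setIntegral_elem_eq_sum (K : Fin m.nElem) {f : Euc (n + 1) → ℝ}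
    (hf : IntegrableOn f (m.elem K)) :
    ∫ x in m.elem K, f x = ∑ F : m.faces K, ∫ x in m.cell K F, f x := by
  have h : ⋃ F : m.faces K, m.cell K F = m.elem K := by
    rw [← m.iUnion_cone K]
    ext x
    simp [cell]
  rw [← h] at hf ⊢
  exact setIntegral_iUnion_eq_sum (ι := m.faces K) (fun F => m.isCompact_cell K F) (fun F F' hne =>
    m.cone_overlap K F F.2 F' F'.2 fun he => hne (Subtype.ext he)) hf

lemma setIntegral_closure_eq_sum (m : PolytopalMesh Ω) {f : Euc (n + 1) → ℝ}
    (hf : IntegrableOn f (closure Ω)) :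
    ∫ x in closure Ω, f x = ∑ K, ∫ x in m.elem K, f x := by
  rw [← m.iUnion_elem] at hf ⊢
  exact setIntegral_iUnion_eq_sum (fun K => m.isCompact_elem K) m.elem_overlap hf

lemma frontier_closure_subset (m : PolytopalMesh Ω) :
    frontier (closure Ω) ⊆ ⋃ K, frontier (m.elem K) := by
  rw [← m.iUnion_elem]
  intro x hx
  rw [(isClosed_iUnion_of_finite fun K => (m.isCompact_elem K).isClosed).frontier_eq] at hx
  obtain ⟨h1, h2⟩ := hx
  obtain ⟨K, hK⟩ := Set.mem_iUnion.1 h1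
  refine Set.mem_iUnion.2 ⟨K, ?_⟩
  rw [(m.isCompact_elem K).isClosed.frontier_eq]
  exact ⟨hK, fun h => h2 (interior_mono (Set.subset_iUnion _ K) h)⟩

/-- The elements cover `closure Ω`, but `f` is given on `Ω`. The difference lies in the element
boundaries, which consist of finitely many flat faces. -/
lemma restrict_closure_eq (m : PolytopalMesh Ω) (hΩ : IsPolyhedralDomain Ω) :
    (volume : Measure (Euc (n + 1))).restrict (closure Ω) = volume.restrict Ω := by
  refine Measure.restrict_congr_set ?_
  have h : volume (frontier (closure Ω)) = 0 :=
    measure_mono_null m.frontier_closure_subset (measure_iUnion_null volume_frontier_elem)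
  refine (ae_le_set.2 ?_).antisymm subset_closure.eventuallyLE
  refine measure_mono_null (fun x hx => ?_) h
  rw [isClosed_closure.frontier_eq, hΩ.interior_closure]
  exact hx

lemma hausdorff_face_le_elem (hF : F ∈ m.faces K) :
    μHE[n] (m.face F) ≤ ENNReal.ofReal
      (Metric.diam (m.elem K) ^ n * volume.real (Metric.ball (0 : Euc n) 1)) := by
  obtain ⟨c, hc⟩ := face_nonempty F
  exact hausdorff_face_le (m.norm_normal K F hF)
    (fun y hy => m.normal_orthogonal K F hF y hy c hc) Metric.diam_nonneg
    fun y hy => dist_le_diam (face_subset_elem hF hy) (face_subset_elem hF hc)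

lemma hausdorff_face_lt_top (F : Fin m.nFace) : μHE[n] (m.face F) < ⊤ := by
  obtain ⟨K, hF⟩ := m.face_mem F
  exact (hausdorff_face_le_elem hF).trans_lt ENNReal.ofReal_lt_top

lemma integrableOn_face (F : Fin m.nFace) {f : Euc (n + 1) → ℝ} (hf : Continuous f) :
    IntegrableOn f (m.face F) μHE[n] := by
  obtain ⟨C, hC⟩ := (m.isCompact_face F).exists_bound_of_continuousOn hf.continuousOn
  exact Measure.integrableOn_of_bounded (hausdorff_face_lt_top F).ne hf.aestronglyMeasurable
    ((ae_restrict_iff' (m.isCompact_face F).measurableSet).2 (Filter.Eventually.of_forall hC))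

/-- The polynomials `p K` and `q F` represent `u = {u_0, u_b}`. -/
structure Represents (m : PolytopalMesh Ω) (u : m.Mh k)
    (p : Fin m.nElem → MvPolynomial (Fin (n + 1)) ℝ)
    (q : Fin m.nFace → MvPolynomial (Fin (n + 1)) ℝ) : Prop where
  degree_elem : ∀ K, (p K).totalDegree ≤ k + 1
  degree_face : ∀ F, (q F).totalDegree ≤ k
  eq_elem : ∀ K, (u.1 K : Euc (n + 1) → ℝ) = (m.elem K).indicator (pev (p K))
  eq_face : ∀ F, (u.2 F : Euc (n + 1) → ℝ) = (m.face F).indicator (pev (q F))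

lemma exists_represents (u : m.Mh k) : ∃ p q, m.Represents u p q := by
  choose p hp h using fun K => exists_rep_of_mem_polyOn (u.1 K)
  choose q hq h' using fun F => exists_rep_of_mem_polyOn (u.2 F)
  exact ⟨p, q, hp, hq, h, h'⟩

lemma Represents.add {u u' : m.Mh k} {p p' q q'} (h : m.Represents u p q)
    (h' : m.Represents u' p' q') : m.Represents (u + u') (p + p') (q + q') where
  degree_elem K := (MvPolynomial.totalDegree_add _ _).trans
    (max_le (h.degree_elem K) (h'.degree_elem K))
  degree_face F := (MvPolynomial.totalDegree_add _ _).trans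
    (max_le (h.degree_face F) (h'.degree_face F))
  eq_elem K := by
    ext x
    change (u.1 K : Euc (n + 1) → ℝ) x + (u'.1 K : Euc (n + 1) → ℝ) x = _
    rw [h.eq_elem, h'.eq_elem]
    by_cases hx : x ∈ m.elem K <;> simp [hx]
  eq_face F := by
    ext x
    change (u.2 F : Euc (n + 1) → ℝ) x + (u'.2 F : Euc (n + 1) → ℝ) x = _
    rw [h.eq_face, h'.eq_face]
    by_cases hx : x ∈ m.face F <;> simp [hx]

lemma Represents.smul {u : m.Mh k} {p q} (h : m.Represents u p q) (a : ℝ) :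
    m.Represents (a • u) (a • p) (a • q) where
  degree_elem K := (MvPolynomial.totalDegree_smul_le _ _).trans (h.degree_elem K)
  degree_face F := (MvPolynomial.totalDegree_smul_le _ _).trans (h.degree_face F)
  eq_elem K := by
    ext x
    change a * (u.1 K : Euc (n + 1) → ℝ) x = _
    rw [h.eq_elem]
    by_cases hx : x ∈ m.elem K <;> simp [hx]
  eq_face F := by
    ext x
    change a * (u.2 F : Euc (n + 1) → ℝ) x = _
    rw [h.eq_face]
    by_cases hx : x ∈ m.face F <;> simp [hx]

/-- The zero extension agrees with `p` near interior points of `K`. On `∂K` it may fail to be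
differentiable, but `∂K` is a null set. -/
lemma gradient_ae_eq {f : Euc (n + 1) → ℝ} {p : MvPolynomial (Fin (n + 1)) ℝ}
    (hf : f = (m.elem K).indicator (pev p)) :
    gradient f =ᵐ[volume.restrict (m.elem K)] vev (gradPoly p) := by
  have h1 : ∀ᵐ x ∂volume.restrict (m.elem K), x ∉ frontier (m.elem K) :=
    ae_restrict_of_ae (measure_eq_zero_iff_ae_notMem.1 (volume_frontier_elem K))
  filter_upwards [h1, ae_restrict_mem (m.isCompact_elem K).measurableSet] with x hx hxK
  have hint : x ∈ interior (m.elem K) := by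
    by_contra h
    exact hx (by rw [(m.isCompact_elem K).isClosed.frontier_eq]; exact ⟨hxK, h⟩)
  refine HasGradientAt.gradient ((hasGradientAt_pev p x).congr_of_eventuallyEq ?_)
  filter_upwards [mem_interior_iff_mem_nhds.1 hint] with y hy
  simp [hf, hy]

/-- The functional on the right-hand side of the definition of the weak gradient. -/
noncomputable def weakGradRhs (m : PolytopalMesh Ω) (K : Fin m.nElem)
    (p : MvPolynomial (Fin (n + 1)) ℝ) (q : Fin m.nFace → MvPolynomial (Fin (n + 1)) ℝ)
    (τ : m.SigmaLoc k K) : ℝ :=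
  (∑ F : m.faces K, ∫ x in m.cell K F,
    inner ℝ (vev (gradPoly p) x) ((τ F : Euc (n + 1) → Euc (n + 1)) x)) +
  ∑ F : m.faces K, ∫ y in m.face F, (pev (q F) y - pev p y) *
    inner ℝ ((τ F : Euc (n + 1) → Euc (n + 1)) y) (m.normal K F) ∂μHE[n]

lemma isWeakGrad_iff {u : m.Mh k} {p q} (h : m.Represents u p q) (w : m.SigmaInv k) :
    m.IsWeakGrad u w ↔ ∀ K (τ : m.SigmaLoc k K),
      m.innerLoc (w K) τ = m.weakGradRhs K (p K) q τ := by
  refine forall_congr' fun K => forall_congr' fun τ => ?_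
  rw [weakGradRhs]
  congr! 3 with F _ F _
  · refine integral_congr_ae ?_
    filter_upwards [ae_restrict_of_ae_restrict_of_subset (cell_subset_elem F.2)
      (gradient_ae_eq (h.eq_elem K))] with x hx
    rw [hx]
  · refine setIntegral_congr_fun (m.isCompact_face F).measurableSet fun y hy => ?_
    simp [h.eq_elem, h.eq_face, hy, face_subset_elem F.2 hy]

lemma integrableOn_cell_inner (τ : m.SigmaLoc k K) (F : m.faces K)
    (P : Fin (n + 1) → MvPolynomial (Fin (n + 1)) ℝ) :
    IntegrableOn (fun x => inner ℝ (vev P x) ((τ F : Euc (n + 1) → Euc (n + 1)) x))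
      (m.cell K F) := by
  obtain ⟨Q, -, hQ⟩ := exists_rep_of_mem_vecPolyOn (τ F)
  rw [hQ]
  have h : Continuous fun x => inner ℝ (vev P x) (vev Q x) := by fun_prop
  exact (integrableOn_of_continuous h (m.isCompact_cell K F)).congr_fun
    (fun x hx => by simp [hx]) (m.isCompact_cell K F).measurableSet

lemma integrableOn_face_inner (τ : m.SigmaLoc k K) (F : m.faces K)
    (p q : MvPolynomial (Fin (n + 1)) ℝ) :
    IntegrableOn (fun y => (pev q y - pev p y) *
      inner ℝ ((τ F : Euc (n + 1) → Euc (n + 1)) y) (m.normal K F)) (m.face F) μHE[n] := by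
  obtain ⟨Q, -, hQ⟩ := exists_rep_of_mem_vecPolyOn (τ F)
  rw [hQ]
  have h : Continuous fun y => (pev q y - pev p y) * inner ℝ (vev Q y) (m.normal K F) := by fun_prop
  exact (integrableOn_face _ h).congr_fun
    (fun x hx => by simp [face_subset_cell hx]) (m.isCompact_face F).measurableSet

/-- `weakGradRhs` as a linear functional. -/
noncomputable def weakGradRhsₗ (m : PolytopalMesh Ω) (k : ℕ) (K : Fin m.nElem)
    (p : MvPolynomial (Fin (n + 1)) ℝ) (q : Fin m.nFace → MvPolynomial (Fin (n + 1)) ℝ) :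
    m.SigmaLoc k K →ₗ[ℝ] ℝ where
  toFun τ := m.weakGradRhs K p q τ
  map_add' σ τ := by
    simp only [weakGradRhs, Pi.add_apply, Submodule.coe_add, inner_add_right, inner_add_left,
      mul_add]
    rw [Finset.sum_congr rfl fun F _ => integral_add (integrableOn_cell_inner σ F _)
        (integrableOn_cell_inner τ F _),
      Finset.sum_congr rfl fun F _ => integral_add (integrableOn_face_inner σ F p (q F))
        (integrableOn_face_inner τ F p (q F)), Finset.sum_add_distrib, Finset.sum_add_distrib]
    ring
  map_smul' a τ := by
    simp only [weakGradRhs, Pi.smul_apply, Submodule.coe_smul, inner_smul_right, inner_smul_left,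
      conj_trivial, mul_left_comm _ a, integral_const_mul, smul_eq_mul, RingHom.id_apply]
    rw [mul_add, Finset.mul_sum, Finset.mul_sum]

/-- `innerLoc` as a bilinear map. -/
noncomputable def innerLocₗ (m : PolytopalMesh Ω) (k : ℕ) (K : Fin m.nElem) :
    m.SigmaLoc k K →ₗ[ℝ] m.SigmaLoc k K →ₗ[ℝ] ℝ :=
  LinearMap.mk₂ ℝ m.innerLoc
    (fun σ σ' τ => by
      simp only [innerLoc, Pi.add_apply, Submodule.coe_add, inner_add_left]
      rw [← Finset.sum_add_distrib]
      exact Finset.sum_congr rfl fun F _ => integral_add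
        (integrableOn_inner_vecPolyOn (m.isCompact_cell K F) _ _)
        (integrableOn_inner_vecPolyOn (m.isCompact_cell K F) _ _))
    (fun a σ τ => by
      simp only [innerLoc, Pi.smul_apply, Submodule.coe_smul, inner_smul_left, conj_trivial,
        integral_const_mul, smul_eq_mul, Finset.mul_sum])
    (fun σ τ τ' => by
      simp only [innerLoc, Pi.add_apply, Submodule.coe_add, inner_add_right]
      rw [← Finset.sum_add_distrib]
      exact Finset.sum_congr rfl fun F _ => integral_add
        (integrableOn_inner_vecPolyOn (m.isCompact_cell K F) _ _)
        (integrableOn_inner_vecPolyOn (m.isCompact_cell K F) _ _))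
    (fun a σ τ => by
      simp only [innerLoc, Pi.smul_apply, Submodule.coe_smul, inner_smul_right,
        integral_const_mul, smul_eq_mul, Finset.mul_sum])

lemma eq_zero_of_innerLoc_self (hm : m.IsShapeRegular γ η) (τ : m.SigmaLoc k K)
    (h : m.innerLoc τ τ = 0) : τ = 0 := by
  rw [innerLoc, Finset.sum_eq_zero_iff_of_nonneg fun F _ => integral_nonneg fun x => by
    simp only [Pi.zero_apply, real_inner_self_eq_norm_sq]
    positivity] at h
  ext1 F
  have hF := h F (Finset.mem_univ _)
  obtain ⟨P, -, hP⟩ := exists_rep_of_mem_vecPolyOn (τ F)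
  obtain ⟨c, -, r, hr, hB, -⟩ := exists_ball_subset_cell hm F.2
  have hcomp := m.isCompact_cell K F
  rw [hP, setIntegral_inner_indicator _ _ hcomp.measurableSet] at hF
  simp only [real_inner_self_eq_norm_sq, EuclideanSpace.real_norm_sq_eq, vev_apply] at hF
  rw [integral_finsetSum _ fun i _ => integrableOn_of_continuous (by fun_prop) hcomp,
    Finset.sum_eq_zero_iff_of_nonneg fun i _ => integral_nonneg fun x => sq_nonneg _] at hF
  have hP0 : ∀ i, P i = 0 := fun i =>
    eq_zero_of_setIntegral_sq_eq_zero hcomp hr hB (hF i (Finset.mem_univ _))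
  ext x i
  rw [hP]
  by_cases hx : x ∈ m.cell K F <;> simp [hx, hP0]

lemma existsUnique_isWeakGrad (hm : m.IsShapeRegular γ η) (u : m.Mh k) :
    ∃! w : m.SigmaInv k, m.IsWeakGrad u w := by
  obtain ⟨p, q, h⟩ := exists_represents u
  have H := fun K => existsUnique_of_definite (m.innerLocₗ k K)
    (fun τ hτ => eq_zero_of_innerLoc_self hm τ hτ) (m.weakGradRhsₗ k K (p K) q)
  choose w hw huniq using H
  refine ⟨w, (isWeakGrad_iff h w).2 hw, fun w' hw' => funext fun K => ?_⟩
  exact huniq K (w' K) ((isWeakGrad_iff h w').1 hw' K)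

lemma isWeakGrad_weakGrad (hm : m.IsShapeRegular γ η) (u : m.Mh k) :
    m.IsWeakGrad u (m.weakGrad u) :=
  Classical.epsilon_spec (existsUnique_isWeakGrad hm u).exists

lemma isWeakGrad_iff_eq (hm : m.IsShapeRegular γ η) (u : m.Mh k) (w : m.SigmaInv k) :
    m.IsWeakGrad u w ↔ w = m.weakGrad u :=
  ⟨fun h => (existsUnique_isWeakGrad hm u).unique h (isWeakGrad_weakGrad hm u),
    fun h => h ▸ isWeakGrad_weakGrad hm u⟩

lemma gradPoly_add {d : ℕ} (p q : MvPolynomial (Fin d) ℝ) (x : Euc d) :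
    vev (gradPoly (p + q)) x = vev (gradPoly p) x + vev (gradPoly q) x := by
  ext i; simp [gradPoly]

lemma gradPoly_smul {d : ℕ} (a : ℝ) (p : MvPolynomial (Fin d) ℝ) (x : Euc d) :
    vev (gradPoly (a • p)) x = a • vev (gradPoly p) x := by
  ext i; simp [gradPoly]

/-- By uniqueness it suffices that the sum satisfies the defining identity, which is linear in `u`.
-/
lemma weakGrad_add (hm : m.IsShapeRegular γ η) (u v : m.Mh k) :
    m.weakGrad (u + v) = m.weakGrad u + m.weakGrad v := by
  symm
  rw [← isWeakGrad_iff_eq hm]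
  obtain ⟨p, q, h⟩ := exists_represents u
  obtain ⟨p', q', h'⟩ := exists_represents v
  rw [isWeakGrad_iff (h.add h')]
  intro K τ
  have h1 := (isWeakGrad_iff h _).1 (isWeakGrad_weakGrad hm u) K τ
  have h2 := (isWeakGrad_iff h' _).1 (isWeakGrad_weakGrad hm v) K τ
  have h3 := LinearMap.map_add₂ (m.innerLocₗ k K) (m.weakGrad u K) (m.weakGrad v K) τ
  change m.innerLoc (m.weakGrad u K + m.weakGrad v K) τ = _ + _ at h3
  change m.innerLoc (m.weakGrad u K + m.weakGrad v K) τ = _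
  rw [h3]
  change m.innerLoc _ τ + m.innerLoc _ τ = _
  rw [h1, h2]
  simp only [weakGradRhs, Pi.add_apply, gradPoly_add, inner_add_left, pev_add]
  rw [Finset.sum_congr rfl fun F _ => integral_add (integrableOn_cell_inner τ F _)
        (integrableOn_cell_inner τ F _), Finset.sum_add_distrib]
  have e : ∀ F : m.faces K, ∫ y in m.face F, (pev (q F) y + pev (q' F) y -
        (pev (p K) y + pev (p' K) y)) *
        inner ℝ ((τ F : Euc (n + 1) → Euc (n + 1)) y) (m.normal K F) ∂μHE[n]
      = (∫ y in m.face F, (pev (q F) y - pev (p K) y) *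
          inner ℝ ((τ F : Euc (n + 1) → Euc (n + 1)) y) (m.normal K F) ∂μHE[n]) +
        ∫ y in m.face F, (pev (q' F) y - pev (p' K) y) *
          inner ℝ ((τ F : Euc (n + 1) → Euc (n + 1)) y) (m.normal K F) ∂μHE[n] := fun F => by
    rw [← integral_add (integrableOn_face_inner τ F _ _) (integrableOn_face_inner τ F _ _)]
    congr 1
    ext y
    ring
  rw [Finset.sum_congr rfl fun F _ => e F, Finset.sum_add_distrib]
  ring

lemma weakGrad_smul (hm : m.IsShapeRegular γ η) (a : ℝ) (u : m.Mh k) :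
    m.weakGrad (a • u) = a • m.weakGrad u := by
  symm
  rw [← isWeakGrad_iff_eq hm]
  obtain ⟨p, q, h⟩ := exists_represents u
  rw [isWeakGrad_iff (h.smul a)]
  intro K τ
  have h1 := (isWeakGrad_iff h _).1 (isWeakGrad_weakGrad hm u) K τ
  have h3 := LinearMap.map_smul₂ (m.innerLocₗ k K) a (m.weakGrad u K) τ
  change m.innerLoc (a • m.weakGrad u K) τ = a * m.innerLoc _ τ at h3
  change m.innerLoc (a • m.weakGrad u K) τ = _
  rw [h3, h1]
  simp only [weakGradRhs, Pi.smul_apply, gradPoly_smul, inner_smul_left, pev_smul, conj_trivial,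
    ← mul_sub, mul_assoc, integral_const_mul, ← Finset.mul_sum]
  ring

/-- The weak gradient tested with a field that is supported in one cell. -/
lemma weakGrad_test (hm : m.IsShapeRegular γ η) {u : m.Mh k} {p q} (h : m.Represents u p q)
    (hF : F ∈ m.faces K) {W Q : Fin (n + 1) → MvPolynomial (Fin (n + 1)) ℝ}
    (hW : (m.weakGrad u K ⟨F, hF⟩ : Euc (n + 1) → Euc (n + 1)) = (m.cell K F).indicator (vev W))
    (hQ : ∀ i, (Q i).totalDegree ≤ k) :
    ∫ x in m.cell K F, inner ℝ (vev W x) (vev Q x) =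
      (∫ x in m.cell K F, inner ℝ (vev (gradPoly (p K)) x) (vev Q x)) +
      ∫ y in m.face F, (pev (q F) y - pev (p K) y) * inner ℝ (vev Q y) (m.normal K F) ∂μHE[n] := by
  classical
  -- No continuity is required between cells, so a field living in a single cell is admissible. All
  -- other summands vanish.
  let τ : m.SigmaLoc k K := Pi.single ⟨F, hF⟩ ⟨_, indicator_vev_mem hQ⟩
  have hτ : (τ ⟨F, hF⟩ : Euc (n + 1) → Euc (n + 1)) = (m.cell K F).indicator (vev Q) := by
    simp [τ]
  have hτ0 : ∀ F' : m.faces K, F' ≠ ⟨F, hF⟩ → τ F' = 0 := fun F' hF' => by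
    simp [τ, hF']
  have key := (isWeakGrad_iff h _).1 (isWeakGrad_weakGrad hm u) K τ
  rw [innerLoc, weakGradRhs, Finset.sum_eq_single ⟨F, hF⟩, Finset.sum_eq_single ⟨F, hF⟩,
    Finset.sum_eq_single ⟨F, hF⟩, hτ, hW, setIntegral_inner_indicator _ _
    (m.isCompact_cell K F).measurableSet] at key
  · rw [key]
    congr 1
    · exact setIntegral_congr_fun (m.isCompact_cell K F).measurableSet fun x hx => by simp [hx]
    · exact setIntegral_congr_fun (m.isCompact_face F).measurableSet fun x hx => by
        simp [face_subset_cell hx]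
  all_goals first
    | exact fun F' _ hF' => by simp [hτ0 F' hF']
    | exact fun h => absurd (Finset.mem_univ _) h

end PolytopalMesh

/-! ### Local estimates: trace inequalities, upper bound and tangential gradients. -/

/-- A vector is controlled by its projections onto two hyperplanes which are not almost
parallel. -/
lemma norm_sq_le_of_tangential {d : ℕ} {a b v ν ν' t : Euc d} {M : ℝ} (hM : 1 ≤ M)
    (hν' : ‖ν'‖ = 1) (ht : ‖t‖ = 1) (hνt : inner ℝ ν t = 0) (hν't : 1 ≤ M * inner ℝ ν' t)
    (ha : a = v - inner ℝ ν v • ν) (hb : b = v - inner ℝ ν' v • ν') :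
    ‖v‖ ^ 2 ≤ 8 * M ^ 2 * (‖a‖ ^ 2 + ‖b‖ ^ 2) := by
  -- Since `t` is orthogonal to `ν`, the vector `a` has the same component along `t` as `v`.
  -- Comparison with `b` isolates `inner ν' v * inner ν' t`, and the last factor is at least `1 /
  -- M`.
  have h1 : inner ℝ a t = inner ℝ v t := by
    rw [ha, inner_sub_left, inner_smul_left, hνt]; simp
  have h2 : inner ℝ b t = inner ℝ v t - inner ℝ ν' v * inner ℝ ν' t := by
    rw [hb, inner_sub_left, inner_smul_left]; simp
  have h3 : |inner ℝ ν' v| ≤ M * (‖a‖ + ‖b‖) := by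
    have h4 : inner ℝ ν' v * inner ℝ ν' t = inner ℝ a t - inner ℝ b t := by rw [h1, h2]; ring
    have h5 : |inner ℝ ν' v| * inner ℝ ν' t ≤ ‖a‖ + ‖b‖ := by
      have hpos : 0 ≤ inner ℝ ν' t := by
        by_contra! hneg
        nlinarith
      rw [← abs_of_nonneg hpos, ← abs_mul, h4]
      refine (abs_sub _ _).trans (add_le_add ?_ ?_)
      · simpa [ht] using abs_real_inner_le_norm a t
      · simpa [ht] using abs_real_inner_le_norm b t
    calc |inner ℝ ν' v| = |inner ℝ ν' v| * 1 := (mul_one _).symm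
      _ ≤ |inner ℝ ν' v| * (M * inner ℝ ν' t) := by gcongr
      _ = M * (|inner ℝ ν' v| * inner ℝ ν' t) := by ring
      _ ≤ _ := by gcongr
  have h6 : ‖v‖ ≤ ‖b‖ + M * (‖a‖ + ‖b‖) := by
    have : v = b + inner ℝ ν' v • ν' := by rw [hb]; abel
    calc ‖v‖ = ‖b + inner ℝ ν' v • ν'‖ := by rw [← this]
      _ ≤ ‖b‖ + ‖inner ℝ ν' v • ν'‖ := norm_add_le _ _
      _ ≤ _ := by rw [norm_smul, hν', mul_one, Real.norm_eq_abs]; gcongr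
  have h7 : ‖v‖ ≤ 2 * M * (‖a‖ + ‖b‖) := by
    nlinarith [norm_nonneg a, norm_nonneg b]
  calc ‖v‖ ^ 2 ≤ (2 * M * (‖a‖ + ‖b‖)) ^ 2 := by gcongr
    _ = 4 * M ^ 2 * (‖a‖ + ‖b‖) ^ 2 := by ring
    _ ≤ 4 * M ^ 2 * (2 * (‖a‖ ^ 2 + ‖b‖ ^ 2)) := by
      gcongr
      nlinarith [sq_nonneg (‖a‖ - ‖b‖)]
    _ = _ := by ring

namespace PolytopalMesh

variable {n k : ℕ} {Ω : Set (Euc (n + 1))} {m : PolytopalMesh Ω} {K : Fin m.nElem}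
  {F : Fin m.nFace} {γ η M : ℝ}

lemma setIntegral_face_le (hF : F ∈ m.faces K) {g : Euc (n + 1) → ℝ} (hg : Continuous g) {A : ℝ}
    (hA : 0 ≤ A) (h : ∀ y ∈ m.face F, g y ≤ A) :
    ∫ y in m.face F, g y ∂μHE[n]
      ≤ A * (Metric.diam (m.elem K) ^ n * volume.real (Metric.ball (0 : Euc n) 1)) := by
  have hfin := hausdorff_face_lt_top F
  calc ∫ y in m.face F, g y ∂μHE[n] ≤ ∫ _ in m.face F, A ∂μHE[n] :=
        setIntegral_mono_on (integrableOn_face F hg) (integrableOn_const hfin.ne)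
          (m.isCompact_face F).measurableSet h
    _ = A * (μHE[n] (m.face F)).toReal := by
      rw [setIntegral_const, smul_eq_mul, mul_comm, measureReal_def]
    _ ≤ _ := by
      gcongr
      exact ENNReal.toReal_le_of_le_ofReal (by positivity) (hausdorff_face_le_elem hF)

lemma setIntegral_le_of_subset_elem {S : Set (Euc (n + 1))} (hS : IsCompact S)
    (hSK : S ⊆ m.elem K) {g : Euc (n + 1) → ℝ} (hg : Continuous g) {A : ℝ}
    (hA : 0 ≤ A) (h : ∀ y ∈ S, g y ≤ A) :
    ∫ y in S, g y
      ≤ A * (Metric.diam (m.elem K) ^ (n + 1) * volume.real (Metric.ball (0 : Euc (n + 1)) 1)) := by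
  calc ∫ y in S, g y ≤ ∫ _ in S, A :=
        setIntegral_mono_on (integrableOn_of_continuous hg hS)
          (integrableOn_const hS.measure_lt_top.ne) hS.measurableSet h
    _ = A * volume.real S := by rw [setIntegral_const, smul_eq_mul, mul_comm]
    _ ≤ _ := by
      rw [← volume_real_closedBall_le (m.center K) Metric.diam_nonneg]
      gcongr
      · exact measure_closedBall_lt_top.ne
      · exact fun x hx => dist_le_diam (hSK hx) (m.center_mem_elem K)

/-- The inverse inequality between the maximum norm near an element and the `L²` norm on one of its
cells. -/
lemma exists_cell_sup_bound (n k : ℕ) {M : ℝ} (hM1 : 1 ≤ M) : ∃ C : ℝ, 0 < C ∧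
    ∀ {Ω : Set (Euc (n + 1))} {m : PolytopalMesh Ω} {γ η : ℝ}, m.IsShapeRegular γ η → γ * η ≤ M →
    ∀ {K F}, F ∈ m.faces K → ∀ {P : Fin (n + 1) → MvPolynomial (Fin (n + 1)) ℝ},
    (∀ i, (P i).totalDegree ≤ k) → ∀ x, (∃ y ∈ m.elem K, dist x y ≤ Metric.diam (m.elem K)) →
      ‖vev P x‖ ^ 2 ≤
        C * (∫ y in m.cell K F, ‖vev P y‖ ^ 2) / Metric.diam (m.elem K) ^ (n + 1) := by
  -- A point within `h_K` of `K` has distance at most `2 * h_K` from the centre of the ball, hence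
  -- the factor two.
  obtain ⟨C, hC, H⟩ := exists_sup_bound_vec (n + 1) k (by linarith : 1 ≤ 2 * M)
  refine ⟨C, hC, fun {Ω m γ η} hm hM {K F} hF {P} hP x ⟨y, hy, hxy⟩ => ?_⟩
  obtain ⟨c, hc, r, hr, hB, hd⟩ := exists_ball_subset_cell' hm hM hF
  have hh := m.diam_elem_pos K
  have h1 := H P hP _ c r (2 * Metric.diam (m.elem K)) (m.isCompact_cell K F) hr hB (by positivity)
    (by linarith) x (by
      have := dist_le_diam hy (cell_subset_elem hF hc)
      linarith [dist_triangle x y c])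
  rw [le_div_iff₀ (by positivity)]
  refine le_trans ?_ h1
  gcongr
  linarith

lemma exists_cell_sup_bound_scalar (n k : ℕ) {M : ℝ} (hM1 : 1 ≤ M) : ∃ C : ℝ, 0 < C ∧
    ∀ {Ω : Set (Euc (n + 1))} {m : PolytopalMesh Ω} {γ η : ℝ}, m.IsShapeRegular γ η → γ * η ≤ M →
    ∀ {K F}, F ∈ m.faces K → ∀ {p : MvPolynomial (Fin (n + 1)) ℝ}, p.totalDegree ≤ k →
    ∀ x ∈ m.elem K,
      pev p x ^ 2 ≤ C * (∫ y in m.cell K F, pev p y ^ 2) / Metric.diam (m.elem K) ^ (n + 1) := by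
  obtain ⟨C, hC, H⟩ := exists_sup_bound (n + 1) k hM1
  refine ⟨C, hC, fun {Ω m γ η} hm hM {K F} hF {p} hp x hx => ?_⟩
  obtain ⟨c, hc, r, hr, hB, hd⟩ := exists_ball_subset_cell' hm hM hF
  rw [le_div_iff₀ (by have := m.diam_elem_pos K; positivity)]
  exact H p hp _ c r _ (m.isCompact_cell K F) hr hB (m.diam_elem_pos K) hd x
    (dist_le_diam hx (cell_subset_elem hF hc))

/-- The discrete trace inequality for polynomials. -/
lemma exists_trace_bound_scalar (n k : ℕ) {M : ℝ} (hM1 : 1 ≤ M) : ∃ C : ℝ, 0 < C ∧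
    ∀ {Ω : Set (Euc (n + 1))} {m : PolytopalMesh Ω} {γ η : ℝ}, m.IsShapeRegular γ η → γ * η ≤ M →
    ∀ {K F}, F ∈ m.faces K → ∀ {p : MvPolynomial (Fin (n + 1)) ℝ}, p.totalDegree ≤ k →
      Metric.diam (m.elem K) * ∫ y in m.face F, pev p y ^ 2 ∂μHE[n]
        ≤ C * ∫ y in m.cell K F, pev p y ^ 2 := by
  obtain ⟨C, hC, H⟩ := exists_cell_sup_bound_scalar n k hM1
  refine ⟨C * (volume.real (Metric.ball (0 : Euc n) 1) + 1), by positivity,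
    fun {Ω m γ η} hm hM {K F} hF {p} hp => ?_⟩
  have hh := m.diam_elem_pos K
  have hI : 0 ≤ ∫ y in m.cell K F, pev p y ^ 2 := integral_nonneg fun _ => sq_nonneg _
  have h1 := setIntegral_face_le hF (g := fun y => pev p y ^ 2) (by fun_prop)
    (A := C * (∫ y in m.cell K F, pev p y ^ 2) / Metric.diam (m.elem K) ^ (n + 1)) (by positivity)
    fun y hy => H hm hM hF hp y (face_subset_elem hF hy)
  calc _ ≤ Metric.diam (m.elem K) * _ := mul_le_mul_of_nonneg_left h1 hh.le
    _ = C * volume.real (Metric.ball (0 : Euc n) 1) * ∫ y in m.cell K F, pev p y ^ 2 := by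
      field_simp
      ring
    _ ≤ _ := by gcongr; linarith

/-- The discrete trace inequality for polynomial vector fields. -/
lemma exists_trace_bound (n k : ℕ) {M : ℝ} (hM1 : 1 ≤ M) : ∃ C : ℝ, 0 < C ∧
    ∀ {Ω : Set (Euc (n + 1))} {m : PolytopalMesh Ω} {γ η : ℝ}, m.IsShapeRegular γ η → γ * η ≤ M →
    ∀ {K F}, F ∈ m.faces K → ∀ {P : Fin (n + 1) → MvPolynomial (Fin (n + 1)) ℝ},
    (∀ i, (P i).totalDegree ≤ k) →
      Metric.diam (m.elem K) * ∫ y in m.face F, ‖vev P y‖ ^ 2 ∂μHE[n]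
        ≤ C * ∫ y in m.cell K F, ‖vev P y‖ ^ 2 := by
  obtain ⟨C, hC, H⟩ := exists_trace_bound_scalar n k hM1
  refine ⟨C, hC, fun {Ω m γ η} hm hM {K F} hF {P} hP => ?_⟩
  simp only [EuclideanSpace.real_norm_sq_eq, vev_apply]
  rw [integral_finsetSum _ fun i _ => integrableOn_face F (by fun_prop),
    integral_finsetSum _ fun i _ => integrableOn_of_continuous (by fun_prop)
    (m.isCompact_cell K F), Finset.mul_sum, Finset.mul_sum]
  exact Finset.sum_le_sum fun i _ => H hm hM hF (hP i)

/-- `W` is, on the cell of `K` and `F`, the weak gradient of `{p, q}`. -/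
def TestIdentity (m : PolytopalMesh Ω) (k : ℕ) (K : Fin m.nElem) (F : Fin m.nFace)
    (p q : MvPolynomial (Fin (n + 1)) ℝ) (W : Fin (n + 1) → MvPolynomial (Fin (n + 1)) ℝ) : Prop :=
  ∀ Q : Fin (n + 1) → MvPolynomial (Fin (n + 1)) ℝ, (∀ i, (Q i).totalDegree ≤ k) →
    ∫ x in m.cell K F, inner ℝ (vev W x) (vev Q x) =
      (∫ x in m.cell K F, inner ℝ (vev (gradPoly p) x) (vev Q x)) +
      ∫ y in m.face F, (pev q y - pev p y) * inner ℝ (vev Q y) (m.normal K F) ∂μHE[n]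

/-- The test field is `W` itself. Young's inequality and the trace inequality leave half of its norm
to be absorbed. -/
lemma exists_cell_upper_bound (n k : ℕ) {M : ℝ} (hM1 : 1 ≤ M) : ∃ C : ℝ, 0 < C ∧
    ∀ {Ω : Set (Euc (n + 1))} {m : PolytopalMesh Ω} {γ η : ℝ}, m.IsShapeRegular γ η → γ * η ≤ M →
    ∀ {K F}, F ∈ m.faces K → ∀ {p q : MvPolynomial (Fin (n + 1)) ℝ}
    {W : Fin (n + 1) → MvPolynomial (Fin (n + 1)) ℝ}, (∀ i, (W i).totalDegree ≤ k) →
    m.TestIdentity k K F p q W →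
      ∫ x in m.cell K F, ‖vev W x‖ ^ 2 ≤ C * ((∫ x in m.cell K F, ‖vev (gradPoly p) x‖ ^ 2) +
        (Metric.diam (m.elem K))⁻¹ * ∫ y in m.face F, (pev p y - pev q y) ^ 2 ∂μHE[n]) := by
  obtain ⟨C, hC, H⟩ := exists_trace_bound n k hM1
  refine ⟨2 + 2 * C, by positivity, fun {Ω m γ η} hm hM {K F} hF {p q W} hW hT => ?_⟩
  have hh := m.diam_elem_pos K
  set h := Metric.diam (m.elem K)
  have hν := m.norm_normal K F hF
  have hc := m.isCompact_cell K F
  have h0 := hT W hW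
  simp only [real_inner_self_eq_norm_sq] at h0
  have h1 : ∫ x in m.cell K F, inner ℝ (vev (gradPoly p) x) (vev W x) ≤
      ∫ x in m.cell K F, (‖vev (gradPoly p) x‖ ^ 2 + 1 / 4 * ‖vev W x‖ ^ 2) :=
    setIntegral_mono (integrableOn_of_continuous (by fun_prop) hc)
      (integrableOn_of_continuous (by fun_prop) hc) fun x => by
        have := real_inner_le_norm (vev (gradPoly p) x) (vev W x)
        simp only
        nlinarith [sq_nonneg (‖vev (gradPoly p) x‖ - 1 / 2 * ‖vev W x‖)]
  rw [integral_add (integrableOn_of_continuous (by fun_prop) hc)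
    (integrableOn_of_continuous (by fun_prop) hc), integral_const_mul] at h1
  -- The weight `h * (4 * C)⁻¹` is the one that the trace inequality turns into a quarter of the
  -- norm of `W` on the cell. Another quarter comes from `h1`.
  have h2 : ∫ y in m.face F, (pev q y - pev p y) * inner ℝ (vev W y) (m.normal K F) ∂μHE[n] ≤
      ∫ y in m.face F, (C * h⁻¹ * (pev p y - pev q y) ^ 2 + h * (4 * C)⁻¹ * ‖vev W y‖ ^ 2)
        ∂μHE[n] :=
    setIntegral_mono (integrableOn_face F (by fun_prop)) (integrableOn_face F (by fun_prop))
      fun y => by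
        have h3 : |inner ℝ (vev W y) (m.normal K F)| ≤ ‖vev W y‖ := by
          simpa [hν] using abs_real_inner_le_norm (vev W y) (m.normal K F)
        have h4 : (pev q y - pev p y) * inner ℝ (vev W y) (m.normal K F) ≤
            |pev p y - pev q y| * ‖vev W y‖ := by
          refine (le_abs_self _).trans ?_
          rw [abs_mul, abs_sub_comm]
          gcongr
        have h5 : C * h⁻¹ * (pev p y - pev q y) ^ 2 + h * (4 * C)⁻¹ * ‖vev W y‖ ^ 2
            - |pev p y - pev q y| * ‖vev W y‖
            = (2 * C * |pev p y - pev q y| - h * ‖vev W y‖) ^ 2 / (4 * C * h) := by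
          rw [← sq_abs (pev p y - pev q y)]
          field_simp
          ring
        have h6 : 0 ≤ (2 * C * |pev p y - pev q y| - h * ‖vev W y‖) ^ 2 / (4 * C * h) := by
          positivity
        simp only
        linarith
  rw [integral_add (integrableOn_face F (by fun_prop)) (integrableOn_face F (by fun_prop)),
    integral_const_mul, integral_const_mul] at h2
  have h3 := H hm hM hF hW
  have h4 : h * (4 * C)⁻¹ * ∫ y in m.face F, ‖vev W y‖ ^ 2 ∂μHE[n] ≤
      1 / 4 * ∫ x in m.cell K F, ‖vev W x‖ ^ 2 := by
    calc _ = (4 * C)⁻¹ * (h * ∫ y in m.face F, ‖vev W y‖ ^ 2 ∂μHE[n]) := by ring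
      _ ≤ (4 * C)⁻¹ * (C * ∫ x in m.cell K F, ‖vev W x‖ ^ 2) := by gcongr
      _ = _ := by field_simp
  have hI : 0 ≤ ∫ x in m.cell K F, ‖vev (gradPoly p) x‖ ^ 2 := integral_nonneg fun _ => sq_nonneg _
  have hJ : 0 ≤ h⁻¹ * ∫ y in m.face F, (pev p y - pev q y) ^ 2 ∂μHE[n] :=
    mul_nonneg (by positivity) (integral_nonneg fun _ => sq_nonneg _)
  nlinarith [mul_nonneg hC.le hI]

/-- The test field is `Q`, the part of `∇p` tangential to `F`. Its normal component vanishes, so the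
face term disappears, and `inner ∇p Q = ‖Q‖ ^ 2` turns the cell term into the norm of `Q`. -/
lemma setIntegral_tangential_le (hF : F ∈ m.faces K)
    {p q : MvPolynomial (Fin (n + 1)) ℝ} (hp : p.totalDegree ≤ k + 1)
    {W : Fin (n + 1) → MvPolynomial (Fin (n + 1)) ℝ} (hT : m.TestIdentity k K F p q W) :
    ∃ Q : Fin (n + 1) → MvPolynomial (Fin (n + 1)) ℝ, (∀ i, (Q i).totalDegree ≤ k) ∧
      (∀ x, vev Q x = vev (gradPoly p) x -
        inner ℝ (m.normal K F) (vev (gradPoly p) x) • m.normal K F) ∧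
      ∫ x in m.cell K F, ‖vev Q x‖ ^ 2 ≤ ∫ x in m.cell K F, ‖vev W x‖ ^ 2 := by
  set ν := m.normal K F
  have hν : ‖ν‖ = 1 := m.norm_normal K F hF
  let Q : Fin (n + 1) → MvPolynomial (Fin (n + 1)) ℝ := fun i =>
    gradPoly p i - ν i • ∑ j, ν j • gradPoly p j
  have hQ : ∀ i, (Q i).totalDegree ≤ k := fun i => by
    refine (MvPolynomial.totalDegree_sub _ _).trans (max_le (totalDegree_gradPoly_le hp i) ?_)
    refine (MvPolynomial.totalDegree_smul_le _ _).trans ?_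
    exact MvPolynomial.totalDegree_finsetSum_le fun j _ =>
      (MvPolynomial.totalDegree_smul_le _ _).trans (totalDegree_gradPoly_le hp j)
  have hQx : ∀ x, vev Q x = vev (gradPoly p) x - inner ℝ ν (vev (gradPoly p) x) • ν := fun x => by
    ext i
    simp [Q, PiLp.inner_apply, mul_comm]
  have hQν : ∀ x, inner ℝ (vev Q x) ν = 0 := fun x => by
    rw [hQx, inner_sub_left, inner_smul_left, real_inner_self_eq_norm_sq, hν,
      real_inner_comm]
    simp
  have hQg : ∀ x, inner ℝ (vev (gradPoly p) x) (vev Q x) = ‖vev Q x‖ ^ 2 := fun x => by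
    have h1 : vev (gradPoly p) x = vev Q x + inner ℝ ν (vev (gradPoly p) x) • ν := by
      rw [hQx]; abel
    have h2 : inner ℝ ν (vev Q x) = 0 := by rw [real_inner_comm, hQν]
    rw [h1, inner_add_left, inner_smul_left, h2, real_inner_self_eq_norm_sq, mul_zero, add_zero]
  refine ⟨Q, hQ, hQx, ?_⟩
  have hc := m.isCompact_cell K F
  have h0 := hT Q hQ
  simp only [show m.normal K F = ν from rfl, hQν, hQg, mul_zero, integral_zero, add_zero] at h0
  have h1 : ∫ x in m.cell K F, inner ℝ (vev W x) (vev Q x) ≤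
      ∫ x in m.cell K F, (1 / 2 * ‖vev W x‖ ^ 2 + 1 / 2 * ‖vev Q x‖ ^ 2) :=
    setIntegral_mono (integrableOn_of_continuous (by fun_prop) hc)
      (integrableOn_of_continuous (by fun_prop) hc) fun x => by
        have := real_inner_le_norm (vev W x) (vev Q x)
        simp only
        nlinarith [sq_nonneg (‖vev W x‖ - ‖vev Q x‖)]
  rw [integral_add (integrableOn_of_continuous (by fun_prop) hc)
    (integrableOn_of_continuous (by fun_prop) hc), integral_const_mul, integral_const_mul] at h1
  linarith

end PolytopalMesh

/-! ### Local lower bounds: gradient and jump. -/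

namespace PolytopalMesh

variable {n k : ℕ} {Ω : Set (Euc (n + 1))} {m : PolytopalMesh Ω} {K : Fin m.nElem}
  {F : Fin m.nFace} {γ η M : ℝ}

/-- The gradient of `u_0` is bounded by the weak gradient. -/
lemma exists_gradient_bound (n k : ℕ) (hn : 1 ≤ n) {M : ℝ} (hM1 : 1 ≤ M) : ∃ C : ℝ, 0 < C ∧
    ∀ {Ω : Set (Euc (n + 1))} {m : PolytopalMesh Ω} {γ η : ℝ}, m.IsShapeRegular γ η → γ * η ≤ M →
    ∀ {K} {p : MvPolynomial (Fin (n + 1)) ℝ}, p.totalDegree ≤ k + 1 →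
    ∀ {q : Fin m.nFace → MvPolynomial (Fin (n + 1)) ℝ}
    {W : m.faces K → Fin (n + 1) → MvPolynomial (Fin (n + 1)) ℝ},
    (∀ F : m.faces K, m.TestIdentity k K F p (q F) (W F)) →
      ∫ x in m.elem K, ‖vev (gradPoly p) x‖ ^ 2 ≤
        C * ∑ F : m.faces K, ∫ x in m.cell K F, ‖vev (W F) x‖ ^ 2 := by
  obtain ⟨C, hC, H⟩ := exists_cell_sup_bound n k hM1
  obtain ⟨ω, hωe⟩ : ∃ ω, volume.real (Metric.ball (0 : Euc (n + 1)) 1) = ω := ⟨_, rfl⟩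
  have hω : 0 ≤ ω := hωe ▸ measureReal_nonneg
  refine ⟨8 * M ^ 2 * (2 * (C * ω)) + 1, by positivity,
    fun {Ω m γ η} hm hM {K p} hp {q W} hT => ?_⟩
  have hK := m.isCompact_elem K
  have hh := m.diam_elem_pos K
  have hnn : ∀ F : m.faces K, 0 ≤ ∫ x in m.cell K F, ‖vev (W F) x‖ ^ 2 := fun F =>
    integral_nonneg fun _ => sq_nonneg _
  have hsingle : ∀ F : m.faces K, ∫ x in m.cell K F, ‖vev (W F) x‖ ^ 2 ≤
      ∑ F : m.faces K, ∫ x in m.cell K F, ‖vev (W F) x‖ ^ 2 := fun F =>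
    Finset.single_le_sum (f := fun F : m.faces K => ∫ x in m.cell K F, ‖vev (W F) x‖ ^ 2)
      (fun F _ => hnn F) (Finset.mem_univ F)
  -- The tangential part is one polynomial on all of `K`, so the inverse inequality carries its
  -- bound from a single cell to the element.
  have key : ∀ F ∈ m.faces K, ∃ Q : Fin (n + 1) → MvPolynomial (Fin (n + 1)) ℝ,
      (∀ x, vev Q x = vev (gradPoly p) x -
        inner ℝ (m.normal K F) (vev (gradPoly p) x) • m.normal K F) ∧
      ∫ x in m.elem K, ‖vev Q x‖ ^ 2 ≤
        C * ω * ∑ F : m.faces K, ∫ x in m.cell K F, ‖vev (W F) x‖ ^ 2 := by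
    intro F hF
    obtain ⟨Q, hQ, hQx, hQW⟩ := setIntegral_tangential_le hF hp (hT ⟨F, hF⟩)
    have h0 : 0 ≤ ∫ y in m.cell K F, ‖vev Q y‖ ^ 2 := integral_nonneg fun _ => sq_nonneg _
    refine ⟨Q, hQx, ?_⟩
    have h1 := setIntegral_le_of_subset_elem hK subset_rfl (g := fun x => ‖vev Q x‖ ^ 2)
      (by fun_prop)
      (A := C * (∫ y in m.cell K F, ‖vev Q y‖ ^ 2) / Metric.diam (m.elem K) ^ (n + 1))
      (by positivity) fun x hx => H hm hM hF hQ x ⟨x, hx, by simpa using hh.le⟩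
    have h2 : ∫ x in m.elem K, ‖vev Q x‖ ^ 2 ≤ C * ω * ∫ y in m.cell K F, ‖vev Q y‖ ^ 2 := by
      refine h1.trans_eq ?_
      rw [hωe]
      field_simp
    calc _ ≤ C * ω * ∫ y in m.cell K F, ‖vev Q y‖ ^ 2 := h2
      _ ≤ C * ω * ∫ y in m.cell K F, ‖vev (W ⟨F, hF⟩) y‖ ^ 2 := by gcongr
      _ ≤ _ := mul_le_mul_of_nonneg_left (hsingle ⟨F, hF⟩) (by positivity)
  obtain ⟨F, hF⟩ := m.faces_nonempty K
  obtain ⟨L, hL⟩ := exists_hyperplane_isometry (m.norm_normal K F hF)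
  -- A unit vector tangential to `F`, which exists because `d ≥ 2`. The face `F'` met by the ray in
  -- this direction has a normal that is far from parallel to that of `F`.
  let t := L (EuclideanSpace.single ⟨0, hn⟩ 1)
  have ht : ‖t‖ = 1 := by simp [t]
  obtain ⟨F', hF', hF't⟩ := exists_face_inner_ge hm hM (by linarith) K ht
  obtain ⟨Q, hQx, hQ⟩ := key F hF
  obtain ⟨Q', hQx', hQ'⟩ := key F' hF'
  have h1 : ∫ x in m.elem K, ‖vev (gradPoly p) x‖ ^ 2 ≤
      ∫ x in m.elem K, 8 * M ^ 2 * (‖vev Q x‖ ^ 2 + ‖vev Q' x‖ ^ 2) :=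
    setIntegral_mono (integrableOn_of_continuous (by fun_prop) hK)
      (integrableOn_of_continuous (by fun_prop) hK) fun x =>
        norm_sq_le_of_tangential hM1 (m.norm_normal K F' hF') ht ((hL t).1 ⟨_, rfl⟩) hF't
          (hQx x) (hQx' x)
  rw [integral_const_mul, integral_add (integrableOn_of_continuous (by fun_prop) hK)
    (integrableOn_of_continuous (by fun_prop) hK)] at h1
  have h2 : 0 ≤ ∑ F : m.faces K, ∫ x in m.cell K F, ‖vev (W F) x‖ ^ 2 :=
    Finset.sum_nonneg fun F _ => hnn F
  calc _ ≤ _ := h1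
    _ ≤ 8 * M ^ 2 * (C * ω * (∑ F : m.faces K, ∫ x in m.cell K F, ‖vev (W F) x‖ ^ 2) +
        C * ω * ∑ F : m.faces K, ∫ x in m.cell K F, ‖vev (W F) x‖ ^ 2) := by gcongr
    _ = 8 * M ^ 2 * (2 * (C * ω)) * ∑ F : m.faces K, ∫ x in m.cell K F, ‖vev (W F) x‖ ^ 2 := by
      ring
    _ ≤ _ := mul_le_mul_of_nonneg_right (le_add_of_nonneg_right zero_le_one) h2

set_option maxHeartbeats 800000 in
/-- The jump of `{u_0, u_b}` on a face is bounded by the weak gradient and the gradient of `u_0` on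
the adjacent cell. -/
lemma exists_jump_bound (n k : ℕ) {M : ℝ} (hM1 : 1 ≤ M) : ∃ C : ℝ, 0 < C ∧
    ∀ {Ω : Set (Euc (n + 1))} {m : PolytopalMesh Ω} {γ η : ℝ}, m.IsShapeRegular γ η → γ * η ≤ M →
    ∀ {K F}, F ∈ m.faces K → ∀ {p : MvPolynomial (Fin (n + 1)) ℝ}, p.totalDegree ≤ k + 1 →
    ∀ {q : MvPolynomial (Fin (n + 1)) ℝ}, q.totalDegree ≤ k →
    ∀ {W : Fin (n + 1) → MvPolynomial (Fin (n + 1)) ℝ}, m.TestIdentity k K F p q W →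
      (Metric.diam (m.elem K))⁻¹ * ∫ y in m.face F, (pev p y - pev q y) ^ 2 ∂μHE[n] ≤
        C * ((∫ x in m.cell K F, ‖vev W x‖ ^ 2) +
          ∫ x in m.cell K F, ‖vev (gradPoly p) x‖ ^ 2) := by
  obtain ⟨C₂, hC₂, H₂⟩ := exists_cell_sup_bound n k hM1
  obtain ⟨Cf, hCf, Hf⟩ := exists_face_sup_bound n k hM1
  obtain ⟨ω, hωe⟩ : ∃ ω, volume.real (Metric.ball (0 : Euc n) 1) = ω := ⟨_, rfl⟩
  have hω : 0 ≤ ω := hωe ▸ measureReal_nonneg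
  obtain ⟨ω', hωe'⟩ : ∃ ω, volume.real (Metric.ball (0 : Euc (n + 1)) 1) = ω := ⟨_, rfl⟩
  have hω' : 0 ≤ ω' := hωe' ▸ measureReal_nonneg
  obtain ⟨C₁, hC₁e⟩ : ∃ C₁, Cf * ω' + 1 = C₁ := ⟨_, rfl⟩
  have hC₁ : 0 < C₁ := hC₁e ▸ by positivity
  refine ⟨6 * (C₂ * ω) + 8 * C₁, by positivity,
    fun {Ω m γ η} hm hM {K F} hF {p} hp {q} hq {W} hT => ?_⟩
  have hh := m.diam_elem_pos K
  obtain ⟨h, hdef⟩ : ∃ h, h = Metric.diam (m.elem K) := ⟨_, rfl⟩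
  set ν := m.normal K F
  have hν : ‖ν‖ = 1 := m.norm_normal K F hF
  have hc := m.isCompact_cell K F
  obtain ⟨c, hcF, r, hr, hB, hd⟩ := exists_ball_subset_face' hm hM hF
  have hFc : ∀ y ∈ m.face F, inner ℝ ν (y - c) = 0 := fun y hy =>
    m.normal_orthogonal K F hF y hy c hcF
  have hdist : ∀ x ∈ m.elem K, dist x c ≤ Metric.diam (m.elem K) := fun x hx =>
    dist_le_diam hx (face_subset_elem hF hcF)
  -- Neither the element nor the face need be convex, so the mean value inequality is used on a ball
  -- about `c`. The inverse inequality bounds the gradient of the polynomial there, even outside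
  -- `K`.
  have hdev := fun y (hy : y ∈ m.face F) => sq_pev_sub_le (p := p)
    (fun x hx => H₂ hm hM hF (fun i => totalDegree_gradPoly_le hp i) x
      ⟨c, face_subset_elem hF hcF, hx⟩) (hdist y (face_subset_elem hF hy))
  obtain ⟨a, ha⟩ : ∃ a, pev p c = a := ⟨_, rfl⟩
  rw [← hdef] at hh hd hdist hdev ⊢
  rw [ha] at hdev
  -- Replacing `p` by the constant `a` lowers the degree from `k + 1` to `k`, so that `g` can enter
  -- a test field.
  let g := MvPolynomial.C a - q
  have hg : g.totalDegree ≤ k :=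
    (MvPolynomial.totalDegree_sub _ _).trans (max_le (by simp) hq)
  obtain ⟨g', hg', hgx⟩ := exists_pev_comp_hyperplane_proj hg ν c
  have hgF : ∀ y ∈ m.face F, pev g' y = a - pev q y := fun y hy => by
    rw [hgx, hFc y hy]; simp [g]
  -- The field `g' ν`, where `g'` extends `g` constantly along the normal.
  let Q : Fin (n + 1) → MvPolynomial (Fin (n + 1)) ℝ := fun i => ν i • g'
  have hQ : ∀ i, (Q i).totalDegree ≤ k := fun i =>
    (MvPolynomial.totalDegree_smul_le _ _).trans hg'
  have hQx : ∀ x, vev Q x = pev g' x • ν := fun x => by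
    ext i; simp [Q, mul_comm]
  obtain ⟨IW, hIWe⟩ : ∃ I, ∫ x in m.cell K F, ‖vev W x‖ ^ 2 = I := ⟨_, rfl⟩
  obtain ⟨IG, hIGe⟩ : ∃ I, ∫ x in m.cell K F, ‖vev (gradPoly p) x‖ ^ 2 = I := ⟨_, rfl⟩
  have hIW : 0 ≤ IW := hIWe ▸ integral_nonneg fun _ => sq_nonneg _
  have hIG : 0 ≤ IG := hIGe ▸ integral_nonneg fun _ => sq_nonneg _
  obtain ⟨G, hGe⟩ : ∃ I, ∫ y in m.face F, (a - pev q y) ^ 2 ∂μHE[n] = I := ⟨_, rfl⟩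
  have hG : 0 ≤ G := hGe ▸ integral_nonneg fun _ => sq_nonneg _
  obtain ⟨A, hAe⟩ : ∃ I, ∫ y in m.face F, (pev p y - a) ^ 2 ∂μHE[n] = I := ⟨_, rfl⟩
  rw [hIGe] at hdev
  rw [hIGe, hIWe]
  -- deviation of `p` from its value at `c`
  have hA : A ≤ C₂ * ω * h * IG := by
    have h1 := setIntegral_face_le hF (g := fun y => (pev p y - a) ^ 2) (by fun_prop)
      (A := h ^ 2 * (C₂ * IG / h ^ (n + 1))) (by positivity) hdev
    rw [← hdef, hωe, hAe] at h1
    refine h1.trans_eq ?_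
    field_simp
    ring
  -- the extension of `g` is bounded
  have hE : ∫ x in m.cell K F, pev g' x ^ 2 ≤ C₁ * h * G := by
    have hGg : ∫ y in m.face F, pev g y ^ 2 ∂μHE[n] = G := by simp [← hGe, g]
    have h1 := setIntegral_le_of_subset_elem hc (cell_subset_elem hF)
      (g := fun y => pev g' y ^ 2) (by fun_prop) (A := Cf * G / h ^ n) (by positivity)
      fun x hx => by
        rw [le_div_iff₀ (by positivity), hgx, ← hGg]
        have hsub : x - inner ℝ ν (x - c) • ν - c = (x - c) - inner ℝ ν (x - c) • ν := by abel
        -- The projection of `x` onto the hyperplane may miss `F`, but it is no farther from `c`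
        -- than `x` is, which suffices for the face inverse inequality.
        refine Hf g hg (m.face F) ν c r h (m.isCompact_face F) hν hFc hr hB hh hd _ ?_ ?_
        · rw [hsub, inner_sub_right, inner_smul_right, real_inner_self_eq_norm_sq, hν]
          ring
        · refine le_trans ?_ (hdist x (cell_subset_elem hF hx))
          rw [dist_eq_norm, dist_eq_norm, hsub]
          refine (sq_le_sq₀ (norm_nonneg _) (norm_nonneg _)).1 ?_
          rw [norm_sub_sq_real, inner_smul_right, real_inner_comm, norm_smul, hν,
            mul_one, Real.norm_eq_abs, sq_abs]
          nlinarith [sq_nonneg (inner ℝ ν (x - c))]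
    rw [← hdef, hωe'] at h1
    have h2 : Cf * G / h ^ n * (h ^ (n + 1) * ω') = Cf * ω' * h * G := by
      field_simp
      ring
    rw [h2] at h1
    refine h1.trans ?_
    gcongr
    linarith
  -- test with `Q`
  have h0 := hT Q hQ
  -- With `e = p - a` and `g = a - q`, the integrand is `-(e + g) * g ≤ e ^ 2 - 3 / 4 * g ^ 2`.
  have hface : ∫ y in m.face F, (pev q y - pev p y) * inner ℝ (vev Q y) ν ∂μHE[n] ≤
      ∫ y in m.face F, ((pev p y - a) ^ 2 - 3 / 4 * (a - pev q y) ^ 2) ∂μHE[n] :=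
    setIntegral_mono_on (integrableOn_face F (by fun_prop)) (integrableOn_face F (by fun_prop))
      (m.isCompact_face F).measurableSet fun y hy => by
        rw [hQx, inner_smul_left, real_inner_self_eq_norm_sq, hν, hgF y hy]
        simp only [conj_trivial, one_pow, mul_one]
        nlinarith [sq_nonneg ((pev p y - a) + 1 / 2 * (a - pev q y))]
  rw [integral_sub (integrableOn_face F (by fun_prop)) (integrableOn_face F (by fun_prop)),
    integral_const_mul, hAe, hGe] at hface
  have hcell : (∫ x in m.cell K F, inner ℝ (vev (gradPoly p) x) (vev Q x)) -
      ∫ x in m.cell K F, inner ℝ (vev W x) (vev Q x) ≤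
      ∫ x in m.cell K F, (2 * (C₁ * h) * ‖vev (gradPoly p) x‖ ^ 2 + 2 * (C₁ * h) * ‖vev W x‖ ^ 2 +
        (4 * (C₁ * h))⁻¹ * pev g' x ^ 2) := by
    rw [← integral_sub (integrableOn_of_continuous (by fun_prop) hc)
      (integrableOn_of_continuous (by fun_prop) hc)]
    refine setIntegral_mono (integrableOn_of_continuous (by fun_prop) hc)
      (integrableOn_of_continuous (by fun_prop) hc) fun x => ?_
    have hC : 0 < C₁ * h := by positivity
    simp only [hQx, inner_smul_right]
    rw [← mul_sub, ← inner_sub_left]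
    have h1 : |inner ℝ (vev (gradPoly p) x - vev W x) ν| ≤ ‖vev (gradPoly p) x - vev W x‖ := by
      simpa [hν] using abs_real_inner_le_norm (vev (gradPoly p) x - vev W x) ν
    have h2 : ‖vev (gradPoly p) x - vev W x‖ ^ 2 ≤
        2 * ‖vev (gradPoly p) x‖ ^ 2 + 2 * ‖vev W x‖ ^ 2 := by
      have := norm_sub_le (vev (gradPoly p) x) (vev W x)
      nlinarith [norm_nonneg (vev (gradPoly p) x - vev W x),
        sq_nonneg (‖vev (gradPoly p) x‖ - ‖vev W x‖)]
    have h3 : pev g' x * inner ℝ (vev (gradPoly p) x - vev W x) ν ≤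
        |pev g' x| * ‖vev (gradPoly p) x - vev W x‖ := by
      refine (le_abs_self _).trans ?_
      rw [abs_mul]
      gcongr
    set N := ‖vev (gradPoly p) x - vev W x‖
    have h4 : C₁ * h * N ^ 2 + (4 * (C₁ * h))⁻¹ * pev g' x ^ 2 - |pev g' x| * N
        = (2 * (C₁ * h) * N - |pev g' x|) ^ 2 / (4 * (C₁ * h)) := by
      rw [← sq_abs (pev g' x)]
      field_simp
      ring
    have h5 : 0 ≤ (2 * (C₁ * h) * N - |pev g' x|) ^ 2 / (4 * (C₁ * h)) := by positivity
    have h6 := mul_le_mul_of_nonneg_left h2 hC.le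
    linarith only [h3, h4, h5, h6]
  have hcell' : ∫ x in m.cell K F, (2 * (C₁ * h) * ‖vev (gradPoly p) x‖ ^ 2 +
      2 * (C₁ * h) * ‖vev W x‖ ^ 2 + (4 * (C₁ * h))⁻¹ * pev g' x ^ 2) =
      2 * (C₁ * h) * IG + 2 * (C₁ * h) * IW +
        (4 * (C₁ * h))⁻¹ * ∫ x in m.cell K F, pev g' x ^ 2 := by
    rw [integral_add (integrableOn_of_continuous (by fun_prop) hc)
      (integrableOn_of_continuous (by fun_prop) hc), integral_add
      (integrableOn_of_continuous (by fun_prop) hc) (integrableOn_of_continuous (by fun_prop) hc),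
      integral_const_mul, integral_const_mul, integral_const_mul, hIGe, hIWe]
  have hE' : (4 * (C₁ * h))⁻¹ * ∫ x in m.cell K F, pev g' x ^ 2 ≤ 1 / 4 * G := by
    calc _ ≤ (4 * (C₁ * h))⁻¹ * (C₁ * h * G) := by gcongr
      _ = _ := by field_simp
  have hJ : ∫ y in m.face F, (pev p y - pev q y) ^ 2 ∂μHE[n] ≤
      ∫ y in m.face F, (2 * (pev p y - a) ^ 2 + 2 * (a - pev q y) ^ 2) ∂μHE[n] :=
    setIntegral_mono (integrableOn_face F (by fun_prop)) (integrableOn_face F (by fun_prop))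
      fun y => by
        simp only
        nlinarith [sq_nonneg ((pev p y - a) - (a - pev q y))]
  rw [integral_add (integrableOn_face F (by fun_prop)) (integrableOn_face F (by fun_prop)),
    integral_const_mul, integral_const_mul, hAe, hGe] at hJ
  -- Altogether `3 / 4 * G ≤ A + 2 * (C₁ * h) * (IG + IW) + 1 / 4 * G`. Inserted into `hJ`, this
  -- gives `6 * A + 8 * (C₁ * h) * (IG + IW)`, whence the final constant.
  have hG' : G ≤ 2 * A + 4 * (C₁ * h) * (IG + IW) := by
    linarith only [h0, hface, hcell, hcell', hE']
  have hJ' : ∫ y in m.face F, (pev p y - pev q y) ^ 2 ∂μHE[n] ≤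
      h * ((6 * (C₂ * ω) + 8 * C₁) * (IW + IG)) := by
    have h6 : 0 ≤ C₂ * ω * h * IW := by positivity
    linarith only [hJ, hG', hA, h6]
  rw [inv_mul_le_iff₀ hh]
  exact hJ'

end PolytopalMesh

/-! ### Norm equivalence on the whole mesh. -/

namespace PolytopalMesh

variable {n k : ℕ} {Ω : Set (Euc (n + 1))} {m : PolytopalMesh Ω} {K : Fin m.nElem}
  {F : Fin m.nFace} {γ η M : ℝ}

/-- The square of the discrete norm, in terms of representing polynomials. -/
noncomputable def energy (m : PolytopalMesh Ω) (p : Fin m.nElem → MvPolynomial (Fin (n + 1)) ℝ)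
    (q : Fin m.nFace → MvPolynomial (Fin (n + 1)) ℝ) : ℝ :=
  (∑ K, ∫ x in m.elem K, ‖vev (gradPoly (p K)) x‖ ^ 2) +
    ∑ K, ∑ F : m.faces K, (Metric.diam (m.elem K))⁻¹ *
      ∫ y in m.face F, (pev (p K) y - pev (q F) y) ^ 2 ∂μHE[n]

lemma jump_nonneg (K : Fin m.nElem) (F : Fin m.nFace) (p q : MvPolynomial (Fin (n + 1)) ℝ) :
    0 ≤ (Metric.diam (m.elem K))⁻¹ * ∫ y in m.face F, (pev p y - pev q y) ^ 2 ∂μHE[n] :=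
  mul_nonneg (inv_nonneg.2 Metric.diam_nonneg) (integral_nonneg fun _ => sq_nonneg _)

lemma normOneH_eq {u : m.Mh k} {p q} (h : m.Represents u p q) :
    m.normOneH u = Real.sqrt (m.energy p q) := by
  rw [normOneH, energy]
  congr 2
  · refine Finset.sum_congr rfl fun K _ => integral_congr_ae ?_
    filter_upwards [gradient_ae_eq (h.eq_elem K)] with x hx
    rw [hx]
  · refine Finset.sum_congr rfl fun K _ => ?_
    rw [← Finset.mul_sum, ← Finset.sum_coe_sort]
    refine congrArg _ (Finset.sum_congr rfl fun F _ => ?_)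
    exact setIntegral_congr_fun (m.isCompact_face F).measurableSet fun y hy => by
      simp [h.eq_elem, h.eq_face, hy, face_subset_elem F.2 hy]

lemma exists_sigma_rep (w : m.SigmaInv k) :
    ∃ W : ∀ K, m.faces K → Fin (n + 1) → MvPolynomial (Fin (n + 1)) ℝ,
      (∀ K F i, (W K F i).totalDegree ≤ k) ∧
      (∀ K F, (w K F : Euc (n + 1) → Euc (n + 1)) = (m.cell K F).indicator (vev (W K F))) ∧
      m.innerSigma w w = ∑ K, ∑ F : m.faces K, ∫ x in m.cell K F, ‖vev (W K F) x‖ ^ 2 := by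
  choose W hW h using fun K (F : m.faces K) => exists_rep_of_mem_vecPolyOn (w K F)
  refine ⟨W, hW, h, Finset.sum_congr rfl fun K _ => Finset.sum_congr rfl fun F _ => ?_⟩
  rw [h, setIntegral_inner_indicator _ _ (m.isCompact_cell K F).measurableSet]
  simp only [real_inner_self_eq_norm_sq]

/-- Equivalence of the norm of the weak gradient and the discrete norm. -/
lemma exists_energy_bounds (n k : ℕ) (hn : 1 ≤ n) {M : ℝ} (hM1 : 1 ≤ M) :
    ∃ c C : ℝ, 0 < c ∧ 0 < C ∧
    ∀ {Ω : Set (Euc (n + 1))} {m : PolytopalMesh Ω} {γ η : ℝ}, m.IsShapeRegular γ η → γ * η ≤ M →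
    ∀ {u : m.Mh k} {p q}, m.Represents u p q →
      c * m.energy p q ≤ m.innerSigma (m.weakGrad u) (m.weakGrad u) ∧
      m.innerSigma (m.weakGrad u) (m.weakGrad u) ≤ C * m.energy p q := by
  obtain ⟨C₁, hC₁, H₁⟩ := exists_gradient_bound n k hn hM1
  obtain ⟨C₂, hC₂, H₂⟩ := exists_jump_bound n k hM1
  obtain ⟨C₃, hC₃, H₃⟩ := exists_cell_upper_bound n k hM1
  have hpos : 0 < C₁ + C₂ * (1 + C₁) := by positivity
  -- The gradient part costs `C₁`. The jump part costs `C₂` times the weak gradient plus the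
  -- gradient part already bounded, that is `C₂ * (1 + C₁)`.
  refine ⟨(C₁ + C₂ * (1 + C₁))⁻¹, C₃, by positivity, hC₃,
    fun {Ω m γ η} hm hM {u p q} h => ?_⟩
  obtain ⟨W, hW, hWe, hsq⟩ := exists_sigma_rep (m.weakGrad u)
  have hT : ∀ K (F : m.faces K), m.TestIdentity k K F (p K) (q F) (W K F) := fun K F Q hQ =>
    weakGrad_test hm h F.2 (hWe K F) hQ
  have hsum : ∀ K, ∑ F : m.faces K, ∫ x in m.cell K F, ‖vev (gradPoly (p K)) x‖ ^ 2 =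
      ∫ x in m.elem K, ‖vev (gradPoly (p K)) x‖ ^ 2 := fun K =>
    (setIntegral_elem_eq_sum K (integrableOn_of_continuous (by fun_prop)
      (m.isCompact_elem K))).symm
  rw [hsq]
  constructor
  · rw [inv_mul_le_iff₀ hpos, energy, ← Finset.sum_add_distrib, Finset.mul_sum]
    refine Finset.sum_le_sum fun K _ => ?_
    have h1 := H₁ hm hM (h.degree_elem K) (hT K)
    have h2 := Finset.sum_le_sum fun (F : m.faces K) (_ : F ∈ Finset.univ) =>
      H₂ hm hM F.2 (h.degree_elem K) (h.degree_face F) (hT K F)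
    rw [← Finset.mul_sum _ _ C₂, Finset.sum_add_distrib, hsum K] at h2
    have h3 := mul_le_mul_of_nonneg_left h1 hC₂.le
    linarith only [h1, h2, h3]
  · rw [energy, ← Finset.sum_add_distrib, Finset.mul_sum]
    refine Finset.sum_le_sum fun K _ => ?_
    have h2 := Finset.sum_le_sum fun (F : m.faces K) (_ : F ∈ Finset.univ) =>
      H₃ hm hM F.2 (hW K F) (hT K F)
    rwa [← Finset.mul_sum, Finset.sum_add_distrib, hsum K] at h2

end PolytopalMesh

/-! ### Total variation on a line. -/

section Line

variable {κ ι : Type*}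

lemma IsPreconnected.exists_mem_frontier {X : Type*} [TopologicalSpace X] {S A : Set X}
    (hS : IsPreconnected S) (h1 : (S ∩ A).Nonempty) (h2 : (S ∩ Aᶜ).Nonempty) :
    (S ∩ frontier A).Nonempty := by
  by_contra hne
  have hfr : ∀ x ∈ S, x ∈ closure A → x ∈ interior A := fun x hx hc => by
    by_contra hi
    exact hne ⟨x, hx, hc, hi⟩
  obtain ⟨x, hx, hxA⟩ := h1
  obtain ⟨y, hy, hyA⟩ := h2
  obtain ⟨z, -, hz, hz'⟩ := hS (interior A) (closure A)ᶜ isOpen_interior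
    isClosed_closure.isOpen_compl
    (fun z hz => by
      by_cases hzc : z ∈ closure A
      · exact Or.inl (hfr z hz hzc)
      · exact Or.inr hzc)
    ⟨x, hx, hfr x hx (subset_closure hxA)⟩
    ⟨y, hy, fun hc => hyA (interior_subset (hfr y hy hc))⟩
  exact hz' (subset_closure (interior_subset hz))

/-- Just to the right of `s` there are no boundary points, so a connected interval there stays in
any of the sets that it meets. -/
lemma exists_Ioo_subset_of_mem_interior_iUnion {A : κ → Set ℝ} {T : Set ℝ} (hT : T.Finite)
    (hfr : ∀ K, frontier (A K) ⊆ T) {s : ℝ} (hs : s ∈ interior (⋃ K, A K)) :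
    ∃ K, ∃ ε > 0, Set.Ioo s (s + ε) ⊆ A K := by
  have h1 : ∀ᶠ x in nhds s, x ∈ (T \ {s})ᶜ :=
    (hT.sdiff).isClosed.isOpen_compl.mem_nhds (by simp)
  have h2 : ∀ᶠ x in nhds s, x ∈ ⋃ K, A K := mem_interior_iff_mem_nhds.1 hs
  obtain ⟨ε, hε, hball⟩ := Metric.eventually_nhds_iff.1 (h1.and h2)
  have hI : ∀ x ∈ Set.Ioo s (s + ε), x ∉ T ∧ x ∈ ⋃ K, A K := fun x hx => by
    have := hball (y := x) (by rw [Real.dist_eq, abs_lt]; constructor <;> linarith [hx.1, hx.2])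
    exact ⟨fun hxT => this.1 ⟨hxT, fun h => hx.1.ne' h⟩, this.2⟩
  obtain ⟨K, hK⟩ := Set.mem_iUnion.1 (hI (s + ε / 2) ⟨by linarith, by linarith⟩).2
  refine ⟨K, ε, hε, fun x hx => ?_⟩
  by_contra hxK
  obtain ⟨y, hy, hyf⟩ := isPreconnected_Ioo.exists_mem_frontier (A := A K)
    ⟨s + ε / 2, ⟨⟨by linarith, by linarith⟩, hK⟩⟩ ⟨x, hx, hxK⟩
  exact (hI y hy).1 (hfr K hyf)

/-- A bounded set must be left, and among finitely many boundary points to the right of `t` there is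
a nearest one. -/
lemma exists_first_frontier_point {A : Set ℝ} (hA : IsCompact A) (hfin : (frontier A).Finite)
    {t ε : ℝ} (hε : 0 < ε) (ht : Set.Ioo t (t + ε) ⊆ A) :
    ∃ s ∈ frontier A, t < s ∧ Set.Ioo t s ⊆ A := by
  have hmem : t + ε / 2 ∈ A := ht ⟨by linarith, by linarith⟩
  obtain ⟨B, hB⟩ := hA.isBounded.bddAbove
  have hne : (Set.Ioi t ∩ frontier A).Nonempty := by
    refine isPreconnected_Ioi.exists_mem_frontier ⟨t + ε / 2, by simpa using by linarith, hmem⟩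
      ⟨max t B + 1, ?_, fun h => ?_⟩
    · exact lt_of_le_of_lt (le_max_left t B) (by linarith)
    · linarith [hB h, le_max_right t B]
  obtain ⟨s, ⟨hts, hs⟩, hmin⟩ := Set.exists_min_image _ id (hfin.inter_of_right (Set.Ioi t)) hne
  refine ⟨s, hs, hts, fun x hx => ?_⟩
  by_contra hxA
  let y := min (t + ε / 2) ((t + s) / 2)
  have hts' : t < s := hts
  have hy : y ∈ Set.Ioo t s := ⟨lt_min (by linarith) (by linarith),
    (min_le_right _ _).trans_lt (by linarith)⟩
  have hyA : y ∈ A := ht ⟨hy.1, (min_le_left _ _).trans_lt (by linarith)⟩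
  obtain ⟨z, hz, hzf⟩ := isPreconnected_Ioo.exists_mem_frontier ⟨y, hy, hyA⟩ ⟨x, hx, hxA⟩
  have h1 : s ≤ z := hmin z ⟨hz.1, hzf⟩
  exact absurd hz.2 (not_lt.2 h1)

/-- A piecewise smooth function on a finite union of compact subsets of the line, with values `b` at
the interfaces and value zero at the boundary, is bounded by its total variation. -/
lemma le_total_variation [Fintype κ] {A : κ → Set ℝ} (hA : ∀ K, IsCompact (A K)) {faces : κ → Finset ι}
    {σ b : ι → ℝ} {g g' : κ → ℝ → ℝ} (hg : ∀ K t, HasDerivAt (g K) (g' K t) t)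
    (hg' : ∀ K, Continuous (g' K))
    (hfr : ∀ K, frontier (A K) ⊆ σ '' (faces K))
    (hinj : ∀ K K' F F', F ∈ faces K → F' ∈ faces K' → σ F = σ F' → F = F')
    (hdisj : ∀ K K', K ≠ K' → volume (A K ∩ A K') = 0)
    (hb : ∀ K, ∀ F ∈ faces K, σ F ∈ frontier (⋃ K, A K) → b F = 0)
    {K : κ} {t : ℝ} (ht : t ∈ interior (A K)) :
    g K t ≤ ∑ K, (∫ s in A K, |g' K s|) + 2 * ∑ K, ∑ F ∈ faces K, |g K (σ F) - b F| := by
  classical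
  let J : κ → ι → ℝ := fun K F => |g K (σ F) - b F|
  -- `w` and `v` are the jumps and the variation still ahead of `t`. `N` counts the interfaces ahead
  -- and drives the induction.
  let w : κ → ℝ → ℝ := fun K t => ∑ F ∈ (faces K).filter (fun F => t < σ F), J K F
  let v : κ → ℝ → ℝ := fun K t => ∫ s in A K ∩ Set.Ioi t, |g' K s|
  let N : ℝ → ℕ := fun t => ((Finset.univ.biUnion faces).filter fun F => t < σ F).card
  have hJ : ∀ K F, 0 ≤ J K F := fun K F => abs_nonneg _
  have hint : ∀ K, IntegrableOn (fun s => |g' K s|) (A K) := fun K =>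
    (hg' K).abs.continuousOn.integrableOn_compact (hA K)
  have hTfin : (⋃ K, σ '' (faces K : Set ι)).Finite :=
    Set.finite_iUnion fun K => (faces K).finite_toSet.image σ
  have hfrT : ∀ K, frontier (A K) ⊆ ⋃ K, σ '' (faces K : Set ι) := fun K =>
    (hfr K).trans (Set.subset_iUnion (fun K => σ '' (faces K : Set ι)) K)
  have hw_mono : ∀ K {t s : ℝ}, t ≤ s → w K s ≤ w K t := fun K t s hts =>
    Finset.sum_le_sum_of_subset_of_nonneg
      (Finset.monotone_filter_right _ fun F _ h => lt_of_le_of_lt hts h) fun F _ _ => hJ K F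
  have hw_step : ∀ K F {t : ℝ}, F ∈ faces K → t < σ F → w K (σ F) + J K F ≤ w K t := by
    intro K F t hF htF
    have h1 : F ∉ (faces K).filter (fun F' => σ F < σ F') := by simp
    change ∑ F' ∈ (faces K).filter (fun F' => σ F < σ F'), J K F' + J K F ≤ _
    rw [add_comm, ← Finset.sum_insert h1]
    refine Finset.sum_le_sum_of_subset_of_nonneg (fun F' hF' => ?_) fun F _ _ => hJ K F
    rcases Finset.mem_insert.1 hF' with rfl | h
    · exact Finset.mem_filter.2 ⟨hF, htF⟩
    · exact Finset.mem_filter.2 ⟨(Finset.mem_filter.1 h).1, htF.trans (Finset.mem_filter.1 h).2⟩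
  have hW_step : ∀ K F {t : ℝ}, F ∈ faces K → t < σ F →
      ∑ K, w K (σ F) + J K F ≤ ∑ K, w K t := by
    intro K F t hF htF
    rw [← Finset.add_sum_erase _ _ (Finset.mem_univ K),
      ← Finset.add_sum_erase (a := K) _ _ (Finset.mem_univ K)]
    have h1 := hw_step K F hF htF
    have h2 := Finset.sum_le_sum fun K' (_ : K' ∈ Finset.univ.erase K) => hw_mono K' htF.le
    linarith
  have hv_mono : ∀ K {t s : ℝ}, t ≤ s → v K s ≤ v K t := fun K t s hts =>
    setIntegral_mono_set ((hint K).mono_set Set.inter_subset_left)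
      (Filter.Eventually.of_forall fun _ => abs_nonneg _)
      (Set.inter_subset_inter_right _ (Set.Ioi_subset_Ioi hts)).eventuallyLE
  have hv_step : ∀ K {t s : ℝ}, t ≤ s → Set.Ioo t s ⊆ A K →
      v K s + (∫ x in Set.Ioo t s, |g' K x|) ≤ v K t := by
    intro K t s hts hsub
    change (∫ x in A K ∩ Set.Ioi s, |g' K x|) + _ ≤ _
    rw [← setIntegral_union _ measurableSet_Ioo ((hint K).mono_set Set.inter_subset_left)
      ((hint K).mono_set hsub)]
    · refine setIntegral_mono_set ((hint K).mono_set Set.inter_subset_left)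
        (Filter.Eventually.of_forall fun _ => abs_nonneg _) (LE.le.eventuallyLE ?_)
      rintro x (⟨hx, hx'⟩ | hx)
      · exact ⟨hx, lt_of_le_of_lt hts hx'⟩
      · exact ⟨hsub hx, hx.1⟩
    · rw [Set.disjoint_left]
      rintro x ⟨-, hx⟩ hx'
      exact lt_asymm hx hx'.2
  have hV_step : ∀ K {t s : ℝ}, t ≤ s → Set.Ioo t s ⊆ A K →
      ∑ K, v K s + (∫ x in Set.Ioo t s, |g' K x|) ≤ ∑ K, v K t := by
    intro K t s hts hsub
    rw [← Finset.add_sum_erase _ _ (Finset.mem_univ K),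
      ← Finset.add_sum_erase (a := K) _ _ (Finset.mem_univ K)]
    have h1 := hv_step K hts hsub
    have h2 := Finset.sum_le_sum fun K' (_ : K' ∈ Finset.univ.erase K) => hv_mono K' hts
    linarith
  have hFTC : ∀ K {t s : ℝ}, t ≤ s → g K t ≤ g K s + ∫ x in Set.Ioo t s, |g' K x| := by
    intro K t s hts
    have h1 := intervalIntegral.integral_eq_sub_of_hasDerivAt (a := t) (b := s)
      (fun x _ => hg K x) ((hg' K).intervalIntegrable _ _)
    have h2 := intervalIntegral.abs_integral_le_integral_abs (f := g' K) (μ := volume) hts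
    rw [h1, intervalIntegral.integral_of_le hts, integral_Ioc_eq_integral_Ioo] at h2
    linarith [neg_abs_le (g K s - g K t)]
  -- March to the right: cross the current set up to its first boundary point, then stop if the
  -- union ends there, or else continue in the set beyond it.
  have main : ∀ M : ℕ, ∀ K t, N t ≤ M → (∃ ε > 0, Set.Ioo t (t + ε) ⊆ A K) →
      g K t ≤ ∑ K, v K t + 2 * ∑ K, w K t := by
    intro M
    induction M with
    | zero =>
      rintro K t hN ⟨ε, hε, hsub⟩
      -- The bounded set `A K` always has a boundary point ahead, so the case `N t = 0` cannot
      -- occur.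
      obtain ⟨s, hs, hts, -⟩ := exists_first_frontier_point (hA K)
        (((faces K).finite_toSet.image σ).subset (hfr K)) hε hsub
      obtain ⟨F, hF, rfl⟩ := hfr K hs
      have : F ∈ (Finset.univ.biUnion faces).filter fun F => t < σ F := by
        simp only [Finset.mem_filter, Finset.mem_biUnion, Finset.mem_univ, true_and]
        exact ⟨⟨K, hF⟩, hts⟩
      exact absurd (Finset.card_pos.2 ⟨F, this⟩) (by simpa [N] using hN)
    | succ M ih =>
      rintro K t hN ⟨ε, hε, hsub⟩
      obtain ⟨s, hs, hts, hsub'⟩ := exists_first_frontier_point (hA K)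
        (((faces K).finite_toSet.image σ).subset (hfr K)) hε hsub
      obtain ⟨F, hF, rfl⟩ := hfr K hs
      have hF : F ∈ faces K := hF
      have h1 := hFTC K hts.le
      have h2 := hV_step K hts.le hsub'
      have h3 := hW_step K F hF hts
      have h4 : 0 ≤ ∑ K, v K (σ F) := Finset.sum_nonneg fun K _ =>
        integral_nonneg fun _ => abs_nonneg _
      have h5 : 0 ≤ ∑ K, w K (σ F) := Finset.sum_nonneg fun K _ =>
        Finset.sum_nonneg fun F _ => hJ K F
      have h6 : g K (σ F) ≤ b F + J K F := by linarith [le_abs_self (g K (σ F) - b F)]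
      by_cases hbd : σ F ∈ frontier (⋃ K, A K)
      · have h7 := hb K F hF hbd
        linarith [hJ K F]
      · have hcl : σ F ∈ A K := (hA K).isClosed.frontier_subset hs
        have hin : σ F ∈ interior (⋃ K, A K) := by
          by_contra h
          exact hbd ⟨subset_closure (Set.mem_iUnion.2 ⟨K, hcl⟩), h⟩
        obtain ⟨K', ε', hε', hsub''⟩ := exists_Ioo_subset_of_mem_interior_iUnion hTfin hfrT hin
        have hNs : N (σ F) ≤ M := by
          refine Nat.le_of_lt_succ (lt_of_lt_of_le ?_ hN)
          refine Finset.card_lt_card ⟨fun F' hF' => ?_, fun h => ?_⟩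
          · exact Finset.mem_filter.2 ⟨(Finset.mem_filter.1 hF').1,
              hts.trans (Finset.mem_filter.1 hF').2⟩
          · have : F ∈ (Finset.univ.biUnion faces).filter fun F => t < σ F := by
              simp only [Finset.mem_filter, Finset.mem_biUnion, Finset.mem_univ, true_and]
              exact ⟨⟨K, hF⟩, hts⟩
            exact lt_irrefl _ (Finset.mem_filter.1 (h this)).2
        have h7 := ih K' (σ F) hNs ⟨ε', hε', hsub''⟩
        -- The interface belongs to the next set too: were `σ F` interior to `A K'`, then `A K` and
        -- `A K'` would overlap in an interval to its left.
        have hF' : F ∈ faces K' := by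
          by_cases hKK : K' = K
          · rwa [hKK]
          · have hcl' : σ F ∈ closure (A K') :=
              closure_mono hsub'' (by
                rw [closure_Ioo (by linarith)]
                exact ⟨le_rfl, by linarith⟩)
            have hfr' : σ F ∈ frontier (A K') := by
              refine ⟨hcl', fun hint' => ?_⟩
              obtain ⟨δ, hδ, hball⟩ := Metric.isOpen_iff.1 isOpen_interior _ hint'
              have hpos : volume (Set.Ioo (max t (σ F - δ)) (σ F)) ≠ 0 := by
                rw [Real.volume_Ioo]
                simpa using ⟨hts, hδ⟩
              refine hpos (measure_mono_null (fun x hx => ?_) (hdisj K' K hKK))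
              have hx1 := (max_lt_iff.1 hx.1)
              refine ⟨interior_subset (hball ?_), hsub' ⟨hx1.1, hx.2⟩⟩
              rw [Metric.mem_ball, Real.dist_eq, abs_lt]
              constructor <;> linarith [hx.2, hx1.2]
            obtain ⟨F', hF', he⟩ := hfr K' hfr'
            rwa [hinj K K' F F' hF hF' he.symm]
        -- Leaving `K` and entering `K'` each cost one jump, and both are charged to the same
        -- decrease of `∑ K, w K`. This is the origin of the factor two, and it also covers `K' =
        -- K`.
        have h8 := hW_step K' F hF' hts
        have h9 : b F ≤ g K' (σ F) + J K' F := by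
          linarith [neg_abs_le (g K' (σ F) - b F)]
        linarith
  obtain ⟨ε, hε, hball⟩ := Metric.isOpen_iff.1 isOpen_interior _ ht
  have h1 := main _ K t le_rfl ⟨ε, hε, fun x hx => interior_subset (hball (by
    rw [Metric.mem_ball, Real.dist_eq, abs_lt]
    constructor <;> linarith [hx.1, hx.2]))⟩
  have h2 : ∑ K, v K t ≤ ∑ K, ∫ s in A K, |g' K s| := Finset.sum_le_sum fun K _ =>
    setIntegral_mono_set (hint K) (Filter.Eventually.of_forall fun _ => abs_nonneg _)
      Set.inter_subset_left.eventuallyLE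
  have h3 : ∑ K, w K t ≤ ∑ K, ∑ F ∈ faces K, |g K (σ F) - b F| :=
    Finset.sum_le_sum fun K _ => Finset.sum_le_sum_of_subset_of_nonneg
      (Finset.filter_subset _ _) fun F _ _ => hJ K F
  linarith

end Line

/-! ### Slicing by lines parallel to the first axis. -/

section Slices

variable {n : ℕ}

/-- The point with first coordinate `t` and remaining coordinates `x`. -/
noncomputable def slice (x : Euc n) (t : ℝ) : Euc (n + 1) :=
  WithLp.toLp 2 (Fin.cons t x.ofLp : Fin (n + 1) → ℝ)

/-- The projection which forgets the first coordinate. -/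
noncomputable def tailProj (y : Euc (n + 1)) : Euc n := WithLp.toLp 2 fun i => y i.succ

@[simp] lemma tailProj_slice (x : Euc n) (t : ℝ) : tailProj (slice x t) = x := rfl
@[simp] lemma slice_zero_apply (x : Euc n) (t : ℝ) : slice x t 0 = t := rfl
@[simp] lemma slice_succ_apply (x : Euc n) (t : ℝ) (i : Fin n) : slice x t i.succ = x i := rfl

lemma slice_tailProj (y : Euc (n + 1)) : slice (tailProj y) (y 0) = y := by
  ext i
  refine Fin.cases ?_ (fun i => ?_) i <;> simp [tailProj]

@[fun_prop] lemma continuous_slice_uncurry : Continuous fun q : Euc n × ℝ => slice q.1 q.2 := by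
  refine (PiLp.continuous_toLp 2 _).comp (continuous_pi fun i => ?_)
  refine Fin.cases ?_ (fun i => ?_) i
  · exact continuous_snd
  · simp only [Fin.cons_succ]
    fun_prop

@[fun_prop] lemma continuous_slice (x : Euc n) : Continuous (slice x) :=
  continuous_slice_uncurry.comp (by fun_prop : Continuous fun t : ℝ => (x, t))

lemma slice_eq_add (x : Euc n) (t : ℝ) :
    slice x t = slice x 0 + t • EuclideanSpace.single 0 (1 : ℝ) := by
  ext i
  refine Fin.cases ?_ (fun i => ?_) i <;> simp

lemma lipschitzWith_tailProj : LipschitzWith 1 (tailProj : Euc (n + 1) → Euc n) := by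
  refine LipschitzWith.of_dist_le_mul fun x y => ?_
  rw [NNReal.coe_one, one_mul, EuclideanSpace.dist_eq, EuclideanSpace.dist_eq]
  refine Real.sqrt_le_sqrt ?_
  rw [Fin.sum_univ_succ]
  exact le_add_of_nonneg_left (sq_nonneg _)

/-- Maps with Lipschitz constant one do not increase Hausdorff measure, and the normalizing factor
is the same on both sides. -/
lemma volume_tailProj_image_le (S : Set (Euc (n + 1))) : volume (tailProj '' S) ≤ μHE[n] S := by
  rw [← EuclideanSpace.euclideanHausdorffMeasure_eq_volume,
    Measure.euclideanHausdorffMeasure_def, Measure.euclideanHausdorffMeasure_def,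
    Measure.smul_apply, Measure.smul_apply]
  have h := lipschitzWith_tailProj.hausdorffMeasure_image_le (d := n) (by positivity) S
  rw [ENNReal.coe_one, ENNReal.one_rpow, one_mul] at h
  exact smul_le_smul_of_nonneg_left h bot_le

lemma ae_slice_notMem {N : Set (Euc (n + 1))} (hN : μHE[n] N = 0) :
    ∀ᵐ x : Euc n, ∀ t, slice x t ∉ N := by
  have h : volume (tailProj '' N) = 0 := le_antisymm ((volume_tailProj_image_le N).trans_eq hN) bot_le
  filter_upwards [measure_eq_zero_iff_ae_notMem.1 h] with x hx t ht
  exact hx ⟨_, ht, by simp⟩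

/-- Splitting off the first coordinate. -/
noncomputable def sliceEquiv (n : ℕ) : Euc n × ℝ ≃ᵐ Euc (n + 1) where
  toFun q := slice q.1 q.2
  invFun y := (tailProj y, y 0)
  left_inv q := by simp
  right_inv y := slice_tailProj y
  measurable_toFun := continuous_slice_uncurry.measurable
  measurable_invFun :=
    (lipschitzWith_tailProj.continuous.prodMk (by fun_prop : Continuous fun y : Euc (n + 1) => y 0)).measurable

lemma measurePreserving_sliceEquiv (n : ℕ) :
    MeasurePreserving (sliceEquiv n) (volume.prod volume) volume := by
  have h1 : MeasurePreserving (WithLp.ofLp : Euc n → Fin n → ℝ) volume volume :=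
    PiLp.volume_preserving_ofLp (Fin n)
  have h3 := (volume_preserving_piFinSuccAbove (fun _ : Fin (n + 1) => ℝ) 0).symm
  have h4 : MeasurePreserving (Prod.swap : Euc n × ℝ → ℝ × Euc n)
      (volume.prod volume) (volume.prod volume) := Measure.measurePreserving_swap
  have h5 := ((MeasurePreserving.id (volume : Measure ℝ)).prod h1).comp h4
  have h6 := h3.comp h5
  have h7 := (PiLp.volume_preserving_toLp (Fin (n + 1))).comp h6
  have e : ⇑(sliceEquiv n) = WithLp.toLp 2 ∘ ⇑(MeasurableEquiv.piFinSuccAbove (fun _ => ℝ) 0).symm ∘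
      Prod.map id WithLp.ofLp ∘ Prod.swap := by
    funext q
    ext i
    refine Fin.cases ?_ (fun i => ?_) i <;> simp [sliceEquiv, MeasurableEquiv.piFinSuccAbove]
  rw [e]
  exact h7

lemma ae_volume_slice_eq_zero {N : Set (Euc (n + 1))} (hN : volume N = 0) :
    ∀ᵐ x : Euc n, volume (slice x ⁻¹' N) = 0 := by
  have h1 := (measurePreserving_sliceEquiv n).quasiMeasurePreserving.ae
    (measure_eq_zero_iff_ae_notMem.1 hN)
  filter_upwards [Measure.ae_ae_of_ae_prod h1] with x hx
  exact measure_eq_zero_iff_ae_notMem.2 hx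

lemma integrable_slice_setIntegral {S : Set (Euc (n + 1))} (hS : IsCompact S)
    {f : Euc (n + 1) → ℝ} (hf : Continuous f) :
    Integrable fun x => ∫ t in slice x ⁻¹' S, f (slice x t) := by
  have h1 : Integrable (S.indicator f) :=
    (integrable_indicator_iff hS.measurableSet).2 (integrableOn_of_continuous hf hS)
  have h2 := ((measurePreserving_sliceEquiv n).integrable_comp_emb
    (sliceEquiv n).measurableEmbedding).2 h1
  refine h2.integral_prod_left.congr (Filter.Eventually.of_forall fun x => ?_)
  simp only
  rw [← integral_indicator (hS.measurableSet.preimage (continuous_slice x).measurable)]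
  rfl

lemma integral_slice_setIntegral {S : Set (Euc (n + 1))} (hS : IsCompact S)
    {f : Euc (n + 1) → ℝ} (hf : Continuous f) :
    ∫ x, ∫ t in slice x ⁻¹' S, f (slice x t) = ∫ y in S, f y := by
  have h1 : Integrable (S.indicator f) :=
    (integrable_indicator_iff hS.measurableSet).2 (integrableOn_of_continuous hf hS)
  have h2 := ((measurePreserving_sliceEquiv n).integrable_comp_emb
    (sliceEquiv n).measurableEmbedding).2 h1
  rw [← integral_indicator hS.measurableSet,
    ← (measurePreserving_sliceEquiv n).integral_comp (sliceEquiv n).measurableEmbedding]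
  refine Eq.trans ?_ (integral_prod _ h2).symm
  refine integral_congr_ae (Filter.Eventually.of_forall fun x => ?_)
  simp only
  rw [← integral_indicator (hS.measurableSet.preimage (continuous_slice x).measurable)]
  rfl

lemma inner_slice_sub (ν c : Euc (n + 1)) (x : Euc n) (t : ℝ) :
    inner ℝ ν (slice x t - c) = ν 0 * (t - c 0) + inner ℝ (tailProj ν) (x - tailProj c) := by
  simp [PiLp.inner_apply, Fin.sum_univ_succ, tailProj, mul_comm]

/-- The first coordinate of the point above `x` in the hyperplane with normal `ν` through `c`. -/
noncomputable def height (ν c : Euc (n + 1)) (x : Euc n) : ℝ :=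
  c 0 - inner ℝ (tailProj ν) (x - tailProj c) / ν 0

@[fun_prop] lemma continuous_height (ν c : Euc (n + 1)) : Continuous (height ν c) := by
  unfold height
  fun_prop

lemma inner_slice_sub_eq_zero_iff {ν : Euc (n + 1)} (hν : ν 0 ≠ 0) (c : Euc (n + 1)) (x : Euc n)
    (t : ℝ) : inner ℝ ν (slice x t - c) = 0 ↔ t = height ν c x := by
  rw [inner_slice_sub, height]
  constructor
  · intro h
    field_simp
    linarith
  · rintro rfl
    field_simp
    ring

/-- Projecting a hyperplane along the first axis shrinks area. Only this inequality is needed, not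
the exact cosine factor. -/
lemma map_lift_le (ν c : Euc (n + 1)) :
    Measure.map (fun x => slice x (height ν c x)) (volume : Measure (Euc n)) ≤ μHE[n] := by
  have hc : Continuous fun x => slice x (height ν c x) :=
    continuous_slice_uncurry.comp (by fun_prop : Continuous fun x => (x, height ν c x))
  refine Measure.le_iff.2 fun S hS => ?_
  rw [Measure.map_apply hc.measurable hS]
  refine le_trans (measure_mono fun x hx => ?_) (volume_tailProj_image_le S)
  exact ⟨_, hx, by simp⟩

lemma integrable_lift {F : Set (Euc (n + 1))} (hF : MeasurableSet F) {f : Euc (n + 1) → ℝ}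
    (hf : IntegrableOn f F μHE[n]) (ν c : Euc (n + 1)) :
    Integrable fun x => F.indicator f (slice x (height ν c x)) := by
  have hc : Continuous fun x => slice x (height ν c x) :=
    continuous_slice_uncurry.comp (by fun_prop : Continuous fun x => (x, height ν c x))
  exact (((integrable_indicator_iff hF).2 hf).mono_measure (map_lift_le ν c)).comp_measurable
    hc.measurable

lemma integral_lift_le {F : Set (Euc (n + 1))} (hF : MeasurableSet F) {f : Euc (n + 1) → ℝ}
    (hf : IntegrableOn f F μHE[n]) (hf0 : ∀ y, 0 ≤ f y) (ν c : Euc (n + 1)) :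
    ∫ x, F.indicator f (slice x (height ν c x)) ≤ ∫ y in F, f y ∂μHE[n] := by
  have hc : Continuous fun x => slice x (height ν c x) :=
    continuous_slice_uncurry.comp (by fun_prop : Continuous fun x => (x, height ν c x))
  have h1 := (integrable_indicator_iff hF).2 hf
  rw [← integral_map (f := F.indicator f) hc.measurable.aemeasurable
    (h1.mono_measure (map_lift_le ν c)).aestronglyMeasurable, ← integral_indicator hF]
  exact integral_mono_measure (map_lift_le ν c)
    (Filter.Eventually.of_forall fun y => Set.indicator_nonneg (fun y _ => hf0 y) y) h1

lemma hasDerivAt_pev_slice (p : MvPolynomial (Fin (n + 1)) ℝ) (x : Euc n) (t : ℝ) :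
    HasDerivAt (fun t => pev p (slice x t)) (pev (gradPoly p 0) (slice x t)) t := by
  have h1 : HasDerivAt (slice x) (EuclideanSpace.single 0 (1 : ℝ)) t := by
    have h2 : slice x = fun t => slice x 0 + t • EuclideanSpace.single 0 (1 : ℝ) :=
      funext fun t => slice_eq_add x t
    rw [h2]
    simpa using ((hasDerivAt_id t).smul_const (EuclideanSpace.single 0 (1 : ℝ) : Euc (n + 1))).const_add (slice x 0)
  have h3 := (hasGradientAt_pev p (slice x t)).hasFDerivAt.comp_hasDerivAt t h1
  refine h3.congr_deriv ?_
  simp [EuclideanSpace.inner_single_right]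

/-- A hyperplane containing the direction of the lines projects to a hyperplane of `ℝ^n`, which is a
null set. -/
lemma ae_slice_notMem_of_parallel {ν c : Euc (n + 1)} (hν : ν ≠ 0) (hν0 : ν 0 = 0)
    {F : Set (Euc (n + 1))} (hF : ∀ y ∈ F, inner ℝ ν (y - c) = 0) :
    ∀ᵐ x : Euc n, ∀ t, slice x t ∉ F := by
  have hν' : tailProj ν ≠ 0 := by
    intro h
    refine hν ?_
    rw [← slice_tailProj ν, h, hν0]
    ext i
    refine Fin.cases ?_ (fun i => ?_) i <;> simp
  let H : AffineSubspace ℝ (Euc n) := AffineSubspace.mk' (tailProj c) (ℝ ∙ tailProj ν)ᗮ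
  have hH : H ≠ ⊤ := by
    intro h
    have h1 : (ℝ ∙ tailProj ν)ᗮ = ⊤ := by
      rw [← AffineSubspace.direction_mk' (tailProj c) (ℝ ∙ tailProj ν)ᗮ]
      change H.direction = ⊤
      rw [h, AffineSubspace.direction_top]
    have h2 : tailProj ν ∈ (ℝ ∙ tailProj ν)ᗮ := h1 ▸ Submodule.mem_top
    rw [Submodule.mem_orthogonal_singleton_iff_inner_right] at h2
    exact hν' (inner_self_eq_zero.1 h2)
  filter_upwards [measure_eq_zero_iff_ae_notMem.1 (Measure.addHaar_affineSubspace volume H hH)]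
    with x hx t ht
  refine hx ?_
  have h1 := hF _ ht
  rw [inner_slice_sub, hν0, zero_mul, zero_add] at h1
  rw [SetLike.mem_coe, AffineSubspace.mem_mk']
  exact Submodule.mem_orthogonal_singleton_iff_inner_right.2 h1

end Slices

/-! ### Shared faces lie inside the domain. -/

namespace PolytopalMesh

variable {n k : ℕ} {Ω : Set (Euc (n + 1))} {m : PolytopalMesh Ω} {K K' : Fin m.nElem}
  {F : Fin m.nFace}

lemma normal_eq_or_eq_neg (hF : F ∈ m.faces K) (hF' : F ∈ m.faces K') :
    m.normal K' F = m.normal K F ∨ m.normal K' F = -m.normal K F := by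
  have h1 : m.normal K' F ∈ (ℝ ∙ m.normal K F) := by
    rw [← Submodule.orthogonal_orthogonal (ℝ ∙ m.normal K F),
      ← vectorSpan_eq_of_inner_eq_zero (m.face_polytope F).2.1 (normal_ne_zero hF)
      (m.normal_orthogonal K F hF), vectorSpan_eq_of_inner_eq_zero (m.face_polytope F).2.1
      (normal_ne_zero hF') (m.normal_orthogonal K' F hF')]
    exact Submodule.le_orthogonal_orthogonal _ (Submodule.mem_span_singleton_self _)
  obtain ⟨a, ha⟩ := Submodule.mem_span_singleton.1 h1
  have h2 := m.norm_normal K' F hF'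
  rw [← ha, norm_smul, m.norm_normal K F hF, mul_one, Real.norm_eq_abs] at h2
  rcases (abs_eq zero_le_one).1 h2 with rfl | rfl
  · left; rw [← ha, one_smul]
  · right; rw [← ha, neg_one_smul]

lemma elem_subset_closure (K : Fin m.nElem) : m.elem K ⊆ closure Ω :=
  m.iUnion_elem ▸ Set.subset_iUnion m.elem K

/-- Relatively interior points of a face which is shared by two elements are inner points of the
domain. -/
lemma mem_of_shared (hΩ : IsPolyhedralDomain Ω) (hne : K ≠ K') (hF : F ∈ m.faces K)
    (hF' : F ∈ m.faces K') {y : Euc (n + 1)} (hy : y ∈ m.face F) {ε : ℝ} (hε : 0 < ε)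
    (hball : ∀ z, inner ℝ (m.normal K F) (z - y) = 0 → dist z y < ε → z ∈ m.face F) : y ∈ Ω := by
  obtain ⟨δ, hδ, h⟩ := exists_half_ball_subset_cone hε hball (m.normal_outward K F hF y hy)
  have hball' : ∀ z, inner ℝ (m.normal K' F) (z - y) = 0 → dist z y < ε → z ∈ m.face F := by
    intro z hz
    refine hball z ?_
    rcases normal_eq_or_eq_neg hF hF' with he | he
    · rwa [← he]
    · rwa [he, inner_neg_left, neg_eq_zero] at hz
  obtain ⟨δ', hδ', h'⟩ := exists_half_ball_subset_cone hε hball' (m.normal_outward K' F hF' y hy)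
  -- Equal normals would put both half-balls on the same side, so that the elements overlap. With
  -- opposite normals the two half-balls fill a ball around `y`.
  rcases normal_eq_or_eq_neg hF hF' with he | he
  · exfalso
    let U : Set (Euc (n + 1)) :=
      Metric.ball y (min δ δ') ∩ {z | inner ℝ (m.normal K F) (z - y) < 0}
    have hU : IsOpen U := Metric.isOpen_ball.inter
      (isOpen_lt (by fun_prop) continuous_const)
    have hne' : U.Nonempty := by
      have hmin : 0 < min δ δ' := lt_min hδ hδ'
      refine ⟨y - (min δ δ' / 2) • m.normal K F, ?_, ?_⟩
      · rw [Metric.mem_ball, dist_eq_norm, sub_sub_cancel_left, norm_neg, norm_smul,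
          m.norm_normal K F hF, mul_one, Real.norm_of_nonneg (by positivity)]
        linarith
      · rw [Set.mem_ofPred_eq, sub_sub_cancel_left, inner_neg_right, inner_smul_right,
          real_inner_self_eq_norm_sq, m.norm_normal K F hF]
        linarith
    refine (hU.measure_pos volume hne').ne' (measure_mono_null ?_ (m.elem_overlap K K' hne))
    rintro z ⟨hz, hz'⟩
    have hz' : inner ℝ (m.normal K F) (z - y) < 0 := hz'
    rw [Metric.mem_ball, lt_min_iff] at hz
    exact ⟨cell_subset_elem hF (h z hz.1 hz'.le),
      cell_subset_elem hF' (h' z hz.2 (by rw [he]; exact hz'.le))⟩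
  · rw [← hΩ.interior_closure, mem_interior_iff_mem_nhds]
    refine Filter.mem_of_superset (Metric.ball_mem_nhds y (lt_min hδ hδ')) fun z hz => ?_
    rw [Metric.mem_ball, lt_min_iff] at hz
    rcases le_total (inner ℝ (m.normal K F) (z - y)) 0 with hs | hs
    · exact elem_subset_closure K (cell_subset_elem hF (h z hz.1 hs))
    · refine elem_subset_closure K' (cell_subset_elem hF' (h' z hz.2 ?_))
      rw [he, inner_neg_left]
      linarith

/-- In coordinates of its hyperplane the face is a finite union of convex sets, whose boundaries are
null. All other points of the face are relatively interior and `mem_of_shared` applies. -/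
lemma hausdorff_face_diff_eq_zero (hΩ : IsPolyhedralDomain Ω) (hF : ¬ m.face F ⊆ frontier Ω) :
    μHE[n] (m.face F \ Ω) = 0 := by
  obtain ⟨K, K', hne, hK, hK'⟩ := m.face_shared F hF
  obtain ⟨c, hc⟩ := face_nonempty F
  obtain ⟨L, hL⟩ := exists_hyperplane_isometry (m.norm_normal K F hK)
  have hr := subset_range_of_inner_eq_zero hL fun y hy => m.normal_orthogonal K F hK y hy c hc
  rw [hausdorff_face_eq L c (Set.sdiff_subset.trans hr)]
  obtain ⟨-, -, 𝒱, -, hV⟩ := m.face_polytope F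
  have hnull : volume (⋃ V ∈ 𝒱, frontier ((fun x => c + L x) ⁻¹'
      convexHull ℝ (V : Set (Euc (n + 1))))) = 0 := by
    refine (measure_biUnion_null_iff 𝒱.countable_toSet).2 fun V _ => ?_
    refine Convex.addHaar_frontier volume ?_
    exact ((convex_convexHull ℝ _).translate_preimage_right c).linear_preimage L.toLinearMap
  refine measure_mono_null (fun x hx => ?_) hnull
  obtain ⟨hxF, hxΩ⟩ := hx
  have hxF' := hxF
  rw [hV, Set.mem_iUnion₂] at hxF'
  obtain ⟨V, hV𝒱, hxV⟩ := hxF'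
  refine Set.mem_iUnion₂.2 ⟨V, hV𝒱, subset_closure hxV, fun hint => hxΩ ?_⟩
  obtain ⟨ε, hε, hball⟩ := Metric.isOpen_iff.1 isOpen_interior _ hint
  refine mem_of_shared hΩ hne hK hK' hxF hε fun z hz hd => ?_
  have hL0 : inner ℝ (m.normal K F) (L x) = 0 := (hL _).1 ⟨x, rfl⟩
  have hz' : inner ℝ (m.normal K F) (z - c) = 0 := by
    have : z - c = (z - (c + L x)) + L x := by abel
    rw [this, inner_add_right, hz, hL0, add_zero]
  obtain ⟨w, hw⟩ := (hL _).2 hz'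
  have hzw : z = c + L w := by rw [hw]; abel
  rw [hV, hzw]
  refine Set.mem_iUnion₂.2 ⟨V, hV𝒱, interior_subset (s := (fun x => c + L x) ⁻¹' _) (hball ?_)⟩
  rw [hzw] at hd
  simpa using hd

end PolytopalMesh

/-! ### Variation along lines, integrated over all lines. -/

namespace PolytopalMesh

variable {n k : ℕ} {Ω : Set (Euc (n + 1))} {m : PolytopalMesh Ω} {ρ : ℝ}

/-- The contribution of a face to the total variation along the line above `x`. -/
noncomputable def liftedJump (m : PolytopalMesh Ω) (ν c : Euc (n + 1)) (F : Fin m.nFace)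
    (p q : MvPolynomial (Fin (n + 1)) ℝ) (x : Euc n) : ℝ :=
  if ν 0 = 0 then 0 else
    (m.face F).indicator (fun y => |pev p y ^ 2 - pev q y ^ 2|) (slice x (height ν c x))

lemma liftedJump_nonneg (ν c : Euc (n + 1)) (F : Fin m.nFace)
    (p q : MvPolynomial (Fin (n + 1)) ℝ) (x : Euc n) : 0 ≤ m.liftedJump ν c F p q x := by
  rw [liftedJump]
  split_ifs
  · exact le_rfl
  · exact Set.indicator_nonneg (fun _ _ => abs_nonneg _) _

lemma integrable_liftedJump (ν c : Euc (n + 1)) (F : Fin m.nFace)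
    (p q : MvPolynomial (Fin (n + 1)) ℝ) : Integrable (m.liftedJump ν c F p q) := by
  unfold liftedJump
  split_ifs
  · exact integrable_zero _ _ _
  · exact integrable_lift (m.isCompact_face F).measurableSet
      (integrableOn_face F (by fun_prop)) ν c

lemma integral_liftedJump_le (ν c : Euc (n + 1)) (F : Fin m.nFace)
    (p q : MvPolynomial (Fin (n + 1)) ℝ) :
    ∫ x, m.liftedJump ν c F p q x ≤ ∫ y in m.face F, |pev p y ^ 2 - pev q y ^ 2| ∂μHE[n] := by
  unfold liftedJump
  split_ifs
  · simpa using integral_nonneg fun _ => abs_nonneg _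
  · exact integral_lift_le (m.isCompact_face F).measurableSet
      (integrableOn_face F (by fun_prop)) (fun _ => abs_nonneg _) ν c

/-- Almost every line is generic: it misses faces parallel to it and intersections of faces, and it
meets faces not contained in `∂Ω` only inside `Ω`. On such a line `le_total_variation` bounds `p ^
2`, and the line meets `Ω` in a set of length at most `2 * ρ`. -/
lemma sum_slice_integral_le (hΩ : IsPolyhedralDomain Ω)
    (hρ : closure Ω ⊆ Metric.closedBall 0 ρ) (hρ0 : 0 ≤ ρ)
    (p : Fin m.nElem → MvPolynomial (Fin (n + 1)) ℝ)
    (q : Fin m.nFace → MvPolynomial (Fin (n + 1)) ℝ)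
    (hq : ∀ F, m.face F ⊆ frontier Ω → ∀ y ∈ m.face F, pev (q F) y = 0)
    {ν c : Fin m.nFace → Euc (n + 1)} (hν : ∀ F, ν F ≠ 0)
    (hc : ∀ F, ∀ y ∈ m.face F, inner ℝ (ν F) (y - c F) = 0) :
    ∀ᵐ x : Euc n, ∑ K, ∫ t in slice x ⁻¹' m.elem K, pev (p K) (slice x t) ^ 2 ≤
      2 * ρ * (∑ K, (∫ t in slice x ⁻¹' m.elem K,
          |2 * pev (p K) (slice x t) * pev (gradPoly (p K) 0) (slice x t)|) +
        2 * ∑ K, ∑ F ∈ m.faces K, m.liftedJump (ν F) (c F) F (p K) (q F) x) := by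
  have H1 : ∀ᵐ x : Euc n, ∀ F, ν F 0 = 0 → ∀ t, slice x t ∉ m.face F := by
    refine ae_all_iff.2 fun F => ?_
    by_cases h : ν F 0 = 0
    · filter_upwards [ae_slice_notMem_of_parallel (hν F) h (hc F)] with x hx _ using hx
    · exact Filter.Eventually.of_forall fun x hx => absurd hx h
  have H2 : ∀ᵐ x : Euc n, ∀ F F', F ≠ F' → ∀ t, slice x t ∉ m.face F ∩ m.face F' := by
    refine ae_all_iff.2 fun F => ae_all_iff.2 fun F' => ?_
    by_cases h : F = F'
    · exact Filter.Eventually.of_forall fun x hx => absurd h hx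
    · filter_upwards [ae_slice_notMem (m.face_overlap F F' h)] with x hx _ using hx
  have H3 : ∀ᵐ x : Euc n, ∀ F, ¬ m.face F ⊆ frontier Ω → ∀ t, slice x t ∉ m.face F \ Ω := by
    refine ae_all_iff.2 fun F => ?_
    by_cases h : m.face F ⊆ frontier Ω
    · exact Filter.Eventually.of_forall fun x hx => absurd h hx
    · filter_upwards [ae_slice_notMem (hausdorff_face_diff_eq_zero hΩ h)] with x hx _ using hx
  have H4 : ∀ᵐ x : Euc n, ∀ K K', K ≠ K' →
      volume (slice x ⁻¹' m.elem K ∩ slice x ⁻¹' m.elem K') = 0 := by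
    refine ae_all_iff.2 fun K => ae_all_iff.2 fun K' => ?_
    by_cases h : K = K'
    · exact Filter.Eventually.of_forall fun x hx => absurd h hx
    · filter_upwards [ae_volume_slice_eq_zero (m.elem_overlap K K' h)] with x hx _ using hx
  filter_upwards [H1, H2, H3, H4] with x h1 h2 h3 h4
  have hI : slice x ⁻¹' closure Ω ⊆ Set.Icc (-ρ) ρ := by
    intro t ht
    have h5 := mem_closedBall_zero_iff.1 (hρ ht)
    have h6 : |slice x t 0| ≤ ‖slice x t‖ := PiLp.norm_apply_le (slice x t) 0
    exact abs_le.1 (h6.trans h5)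
  have hA : ∀ K, IsCompact (slice x ⁻¹' m.elem K) := fun K =>
    isCompact_Icc.of_isClosed_subset ((m.isCompact_elem K).isClosed.preimage (continuous_slice x))
      ((Set.preimage_mono (elem_subset_closure K)).trans hI)
  have hU : ⋃ K, slice x ⁻¹' m.elem K = slice x ⁻¹' closure Ω := by
    rw [← Set.preimage_iUnion, m.iUnion_elem]
  let σ : Fin m.nFace → ℝ := fun F => height (ν F) (c F) x
  classical
  -- Only faces that the line really hits: `σ F` is also defined where the line meets the hyperplane
  -- of `F` outside `F`.
  let fs : Fin m.nElem → Finset (Fin m.nFace) := fun K =>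
    (m.faces K).filter fun F => ν F 0 ≠ 0 ∧ slice x (σ F) ∈ m.face F
  have hfr : ∀ K, frontier (slice x ⁻¹' m.elem K) ⊆ σ '' (fs K) := by
    intro K t ht
    have h5 := (continuous_slice x).frontier_preimage_subset _ ht
    rw [Set.mem_preimage, m.frontier_elem, Set.mem_iUnion₂] at h5
    obtain ⟨F, hF, htF⟩ := h5
    have h6 : ν F 0 ≠ 0 := fun h => h1 F h t htF
    have h7 : t = σ F := (inner_slice_sub_eq_zero_iff h6 (c F) x t).1 (hc F _ htF)
    refine ⟨F, ?_, h7.symm⟩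
    rw [h7] at htF
    exact Finset.mem_filter.2 ⟨hF, h6, htF⟩
  have hd : ∀ K t, HasDerivAt (fun t => pev (p K) (slice x t) ^ 2)
      (2 * pev (p K) (slice x t) * pev (gradPoly (p K) 0) (slice x t)) t := by
    intro K t
    exact ((hasDerivAt_pev_slice (p K) x t).fun_pow 2).congr_deriv (by simp)
  have key : ∀ K, ∀ t ∈ interior (slice x ⁻¹' m.elem K), pev (p K) (slice x t) ^ 2 ≤
      ∑ K, (∫ t in slice x ⁻¹' m.elem K,
          |2 * pev (p K) (slice x t) * pev (gradPoly (p K) 0) (slice x t)|) +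
        2 * ∑ K, ∑ F ∈ m.faces K, m.liftedJump (ν F) (c F) F (p K) (q F) x := by
    intro K t ht
    refine (le_total_variation (faces := fs) (σ := σ)
      (b := fun F => pev (q F) (slice x (σ F)) ^ 2) hA hd (fun K => ?_) hfr ?_ h4 ?_ ht).trans ?_
    · have := continuous_slice x
      fun_prop
    · intro K K' F F' hF hF' he
      by_contra hne
      have hF := (Finset.mem_filter.1 hF).2.2
      have hF' := (Finset.mem_filter.1 hF').2.2
      rw [← he] at hF'
      exact h2 F F' hne _ ⟨hF, hF'⟩
    · intro K F hF hf
      have hF := (Finset.mem_filter.1 hF).2.2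
      rw [hU] at hf
      have h5 := (continuous_slice x).frontier_preimage_subset _ hf
      rw [Set.mem_preimage, isClosed_closure.frontier_eq, hΩ.interior_closure] at h5
      have h6 : m.face F ⊆ frontier Ω := by
        by_contra hn
        exact h3 F hn _ ⟨hF, h5.2⟩
      simp only [hq F h6 _ hF]
      norm_num
    · gcongr with K _
      rw [Finset.sum_filter]
      refine Finset.sum_le_sum fun F _ => ?_
      split_ifs with h
      · rw [liftedJump, if_neg h.1, Set.indicator_of_mem h.2]
      · exact liftedJump_nonneg _ _ _ _ _ _
  obtain ⟨R, hR⟩ : ∃ R, ∑ K, (∫ t in slice x ⁻¹' m.elem K,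
          |2 * pev (p K) (slice x t) * pev (gradPoly (p K) 0) (slice x t)|) +
        2 * ∑ K, ∑ F ∈ m.faces K, m.liftedJump (ν F) (c F) F (p K) (q F) x = R := ⟨_, rfl⟩
  have hR0 : 0 ≤ R := by
    rw [← hR]
    refine add_nonneg (Finset.sum_nonneg fun _ _ => integral_nonneg fun _ => abs_nonneg _) ?_
    exact mul_nonneg zero_le_two (Finset.sum_nonneg fun _ _ => Finset.sum_nonneg fun _ _ =>
      liftedJump_nonneg _ _ _ _ _ _)
  rw [hR] at key ⊢
  have hRI : ∀ S : Set ℝ, IsCompact S → IntegrableOn (fun _ : ℝ => R) S := fun S hS =>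
    continuous_const.continuousOn.integrableOn_compact hS
  have hUc : IsCompact (⋃ K, slice x ⁻¹' m.elem K) := isCompact_iUnion hA
  calc ∑ K, ∫ t in slice x ⁻¹' m.elem K, pev (p K) (slice x t) ^ 2
      ≤ ∑ K, ∫ t in slice x ⁻¹' m.elem K, R := by
        refine Finset.sum_le_sum fun K _ => ?_
        refine setIntegral_mono_ae_restrict ?_ (hRI _ (hA K)) ?_
        · have := continuous_slice x
          exact Continuous.continuousOn (by fun_prop) |>.integrableOn_compact (hA K)
        · have h5 : volume (frontier (slice x ⁻¹' m.elem K)) = 0 :=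
            (((fs K).finite_toSet.image σ).subset (hfr K)).measure_zero _
          have h6 : ∀ᵐ t, t ∉ frontier (slice x ⁻¹' m.elem K) := measure_eq_zero_iff_ae_notMem.1 h5
          refine (ae_restrict_iff' (hA K).measurableSet).2 ?_
          filter_upwards [h6] with t ht htA
          refine key K t ?_
          by_contra hn
          exact ht ⟨subset_closure htA, hn⟩
    _ = ∫ t in ⋃ K, slice x ⁻¹' m.elem K, R := (setIntegral_iUnion_eq_sum hA h4 (hRI _ hUc)).symm
    _ ≤ ∫ t in Set.Icc (-ρ) ρ, R :=
        setIntegral_mono_set (hRI _ isCompact_Icc) (Filter.Eventually.of_forall fun _ => hR0)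
          (hU ▸ hI).eventuallyLE
    _ = 2 * ρ * R := by
        rw [setIntegral_const, Real.volume_real_Icc_of_le (by linarith), smul_eq_mul]
        ring

/-- Fubini turns the line integrals into volume integrals, and the lifted jumps integrate to at most
surface integrals. -/
lemma sum_setIntegral_sq_le (hΩ : IsPolyhedralDomain Ω)
    (hρ : closure Ω ⊆ Metric.closedBall 0 ρ) (hρ0 : 0 ≤ ρ)
    (p : Fin m.nElem → MvPolynomial (Fin (n + 1)) ℝ)
    (q : Fin m.nFace → MvPolynomial (Fin (n + 1)) ℝ)
    (hq : ∀ F, m.face F ⊆ frontier Ω → ∀ y ∈ m.face F, pev (q F) y = 0) :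
    ∑ K, ∫ x in m.elem K, pev (p K) x ^ 2 ≤
      2 * ρ * (∑ K, (∫ x in m.elem K, |2 * pev (p K) x * pev (gradPoly (p K) 0) x|) +
        2 * ∑ K, ∑ F ∈ m.faces K, ∫ y in m.face F, |pev (p K) y ^ 2 - pev (q F) y ^ 2| ∂μHE[n]) := by
  choose K₀ hK₀ using m.face_mem
  choose c hc using fun F => face_nonempty (m := m) F
  have h1 := sum_slice_integral_le hΩ hρ hρ0 p q hq (fun F => normal_ne_zero (hK₀ F))
    fun F y hy => m.normal_orthogonal (K₀ F) F (hK₀ F) y hy (c F) (hc F)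
  have i1 : ∀ K, Integrable fun x : Euc n =>
      ∫ t in slice x ⁻¹' m.elem K, pev (p K) (slice x t) ^ 2 := fun K =>
    integrable_slice_setIntegral (m.isCompact_elem K) (f := fun y => pev (p K) y ^ 2) (by fun_prop)
  have i2 : ∀ K, Integrable fun x : Euc n => ∫ t in slice x ⁻¹' m.elem K,
      |2 * pev (p K) (slice x t) * pev (gradPoly (p K) 0) (slice x t)| := fun K =>
    integrable_slice_setIntegral (m.isCompact_elem K)
      (f := fun y => |2 * pev (p K) y * pev (gradPoly (p K) 0) y|) (by fun_prop)
  have i3 : ∀ K, Integrable fun x : Euc n =>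
      ∑ F ∈ m.faces K, m.liftedJump (m.normal (K₀ F) F) (c F) F (p K) (q F) x := fun K =>
    integrable_finsetSum _ fun F _ => integrable_liftedJump _ _ _ _ _
  have i2' := integrable_finsetSum Finset.univ fun K _ => i2 K
  have i3' := integrable_finsetSum Finset.univ fun K _ => i3 K
  have h2 := integral_mono_ae (integrable_finsetSum Finset.univ fun K _ => i1 K)
    ((i2'.add (i3'.const_mul 2)).const_mul (2 * ρ)) h1
  rw [integral_const_mul] at h2
  simp only [Pi.add_apply] at h2
  rw [integral_add i2' (i3'.const_mul 2), integral_const_mul,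
    integral_finsetSum _ fun K _ => i1 K, integral_finsetSum _ fun K _ => i2 K,
    integral_finsetSum _ fun K _ => i3 K] at h2
  rw [Finset.sum_congr rfl fun K _ => integral_slice_setIntegral (m.isCompact_elem K)
      (f := fun y => pev (p K) y ^ 2) (by fun_prop),
    Finset.sum_congr rfl fun K _ => integral_slice_setIntegral (m.isCompact_elem K)
      (f := fun y => |2 * pev (p K) y * pev (gradPoly (p K) 0) y|) (by fun_prop)] at h2
  refine h2.trans ?_
  gcongr with K _
  rw [integral_finsetSum _ fun F _ => integrable_liftedJump _ _ _ _ _]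
  exact Finset.sum_le_sum fun F _ => integral_liftedJump_le _ _ _ _ _

end PolytopalMesh

/-! ### The discrete Poincaré inequality. -/

namespace PolytopalMesh

variable {n k : ℕ} {Ω : Set (Euc (n + 1))} {m : PolytopalMesh Ω} {γ η ρ : ℝ}

lemma diam_elem_le (hρ : closure Ω ⊆ Metric.closedBall 0 ρ) (hρ0 : 0 ≤ ρ) (K : Fin m.nElem) :
    Metric.diam (m.elem K) ≤ 2 * ρ :=
  (Metric.diam_mono ((elem_subset_closure K).trans hρ) Metric.isBounded_closedBall).trans
    (Metric.diam_closedBall hρ0)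

lemma setIntegral_mul_grad_le (K : Fin m.nElem) (p : MvPolynomial (Fin (n + 1)) ℝ) :
    2 * ρ * ∫ x in m.elem K, |2 * pev p x * pev (gradPoly p 0) x| ≤
      (1 / 4) * (∫ x in m.elem K, pev p x ^ 2) +
        16 * ρ ^ 2 * ∫ x in m.elem K, ‖vev (gradPoly p) x‖ ^ 2 := by
  have hK := m.isCompact_elem K
  rw [← integral_const_mul, ← integral_const_mul, ← integral_const_mul,
    ← integral_add (integrableOn_of_continuous (by fun_prop) hK)
      (integrableOn_of_continuous (by fun_prop) hK)]
  refine integral_mono (integrableOn_of_continuous (by fun_prop) hK)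
    (integrableOn_of_continuous (by fun_prop) hK) fun x => ?_
  have h1 : |pev (gradPoly p 0) x| ≤ ‖vev (gradPoly p) x‖ := PiLp.norm_apply_le (vev (gradPoly p) x) 0
  have h2 := mul_self_le_mul_self (abs_nonneg _) h1
  simp only [abs_mul, abs_two]
  have h3 := sq_nonneg (1 / 2 * |pev p x| - 4 * ρ * |pev (gradPoly p 0) x|)
  have h4 := sq_abs (pev p x)
  nlinarith [mul_le_mul_of_nonneg_left h2 (sq_nonneg ρ)]

/-- With `e = p - q`, the difference of squares is `2 * p * e - e ^ 2`. The weight `h / (4 * T)` is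
chosen for a trace inequality with constant `T`, and `1 ≤ 2 * ρ * h⁻¹` brings the term `e ^ 2` to
the scaling of the jump. -/
lemma setIntegral_abs_sq_sub_sq_le {h T : ℝ} (hh : 0 < h) (hhρ : h ≤ 2 * ρ) (hT : 0 < T)
    (F : Fin m.nFace) (p q : MvPolynomial (Fin (n + 1)) ℝ) :
    4 * ρ * ∫ y in m.face F, |pev p y ^ 2 - pev q y ^ 2| ∂μHE[n] ≤
      h / (4 * T) * (∫ y in m.face F, pev p y ^ 2 ∂μHE[n]) +
        (64 * T + 8) * ρ ^ 2 * (h⁻¹ * ∫ y in m.face F, (pev p y - pev q y) ^ 2 ∂μHE[n]) := by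
  rw [← mul_assoc, ← integral_const_mul, ← integral_const_mul, ← integral_const_mul,
    ← integral_add (integrableOn_face F (by fun_prop)) (integrableOn_face F (by fun_prop))]
  refine integral_mono (integrableOn_face F (by fun_prop)) (integrableOn_face F (by fun_prop))
    fun y => ?_
  obtain ⟨a, ha⟩ : ∃ a, pev p y = a := ⟨_, rfl⟩
  obtain ⟨e, he⟩ : ∃ e, pev p y - pev q y = e := ⟨_, rfl⟩
  have hb : pev q y = a - e := by rw [← ha, ← he]; ring
  have hρ0 : 0 < ρ := by linarith
  simp only [ha, hb]
  have h1 : |a ^ 2 - (a - e) ^ 2| ≤ 2 * |a| * |e| + e ^ 2 := by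
    have : a ^ 2 - (a - e) ^ 2 = 2 * a * e - e ^ 2 := by ring
    rw [this]
    refine (abs_sub _ _).trans ?_
    rw [abs_mul, abs_mul, abs_two, abs_of_nonneg (sq_nonneg e)]
  have h2 : 8 * ρ * (|a| * |e|) ≤ h / (4 * T) * a ^ 2 + 64 * T * ρ ^ 2 * h⁻¹ * e ^ 2 := by
    have h3 : h / (4 * T) * a ^ 2 + 64 * T * ρ ^ 2 * h⁻¹ * e ^ 2 - 8 * ρ * (|a| * |e|) =
        (h * |a| - 16 * T * ρ * |e|) ^ 2 / (4 * T * h) := by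
      rw [← sq_abs a, ← sq_abs e]
      field_simp
      ring
    have h4 : 0 ≤ (h * |a| - 16 * T * ρ * |e|) ^ 2 / (4 * T * h) := by positivity
    linarith
  have h5 : 4 * ρ * e ^ 2 ≤ 8 * ρ ^ 2 * h⁻¹ * e ^ 2 := by
    have : 1 ≤ 2 * ρ * h⁻¹ := by
      rw [← div_eq_mul_inv, le_div_iff₀ hh]
      linarith
    have h6 : 0 ≤ 4 * ρ * e ^ 2 := by positivity
    nlinarith [mul_le_mul_of_nonneg_left this h6]
  have h7 := mul_le_mul_of_nonneg_left h1 (by positivity : 0 ≤ 4 * ρ)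
  linarith

/-- The discrete Poincaré inequality. -/
lemma exists_poincare (n k : ℕ) {M : ℝ} (hM1 : 1 ≤ M) (hρ0 : 0 ≤ ρ) : ∃ C : ℝ, 0 < C ∧
    ∀ {Ω : Set (Euc (n + 1))} {m : PolytopalMesh Ω} {γ η : ℝ}, IsPolyhedralDomain Ω →
    closure Ω ⊆ Metric.closedBall 0 ρ → m.IsShapeRegular γ η → γ * η ≤ M →
    ∀ {p : Fin m.nElem → MvPolynomial (Fin (n + 1)) ℝ}
      {q : Fin m.nFace → MvPolynomial (Fin (n + 1)) ℝ}, (∀ K, (p K).totalDegree ≤ k) →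
    (∀ F, m.face F ⊆ frontier Ω → ∀ y ∈ m.face F, pev (q F) y = 0) →
      ∑ K, ∫ x in m.elem K, pev (p K) x ^ 2 ≤ C * m.energy p q := by
  obtain ⟨T, hT, H⟩ := exists_trace_bound_scalar n k hM1
  -- The variation and the jumps each give back a quarter of the norm of `u_0`. Absorbing this half
  -- accounts for the factor two.
  refine ⟨2 * ((64 * T + 16) * ρ ^ 2) + 1, by positivity,
    fun {Ω m γ η} hΩ hρ hm hM {p q} hp hq => ?_⟩
  have h1 := sum_setIntegral_sq_le hΩ hρ hρ0 p q hq
  have h2 : ∀ K, 2 * ρ * (2 * ∑ F ∈ m.faces K,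
      ∫ y in m.face F, |pev (p K) y ^ 2 - pev (q F) y ^ 2| ∂μHE[n]) ≤
      (1 / 4) * (∫ x in m.elem K, pev (p K) x ^ 2) +
        (64 * T + 8) * ρ ^ 2 * ∑ F : m.faces K, (Metric.diam (m.elem K))⁻¹ *
          ∫ y in m.face F, (pev (p K) y - pev (q F) y) ^ 2 ∂μHE[n] := by
    intro K
    rw [← Finset.sum_coe_sort, setIntegral_elem_eq_sum K
      (integrableOn_of_continuous (by fun_prop) (m.isCompact_elem K)), Finset.mul_sum,
      Finset.mul_sum, Finset.mul_sum, Finset.mul_sum, ← Finset.sum_add_distrib]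
    refine Finset.sum_le_sum fun F _ => ?_
    have h3 := setIntegral_abs_sq_sub_sq_le (m.diam_elem_pos K) (diam_elem_le hρ hρ0 K) hT F.1
      (p K) (q F)
    have h4 := H hm hM F.2 (hp K)
    have h5 : Metric.diam (m.elem K) / (4 * T) * (∫ y in m.face F, pev (p K) y ^ 2 ∂μHE[n]) ≤
        1 / 4 * ∫ y in m.cell K F, pev (p K) y ^ 2 := by
      rw [div_mul_eq_mul_div, div_le_iff₀ (by positivity)]
      linarith only [h4]
    linarith only [h3, h5]
  have h6 := Finset.sum_le_sum fun K (_ : K ∈ Finset.univ) =>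
    setIntegral_mul_grad_le (ρ := ρ) K (p K)
  have h7 := Finset.sum_le_sum fun K (_ : K ∈ Finset.univ) => h2 K
  rw [← Finset.mul_sum, Finset.sum_add_distrib, ← Finset.mul_sum, ← Finset.mul_sum] at h6
  rw [← Finset.mul_sum, ← Finset.mul_sum, Finset.sum_add_distrib, ← Finset.mul_sum,
    ← Finset.mul_sum] at h7
  have hG : 0 ≤ ∑ K, ∫ x in m.elem K, ‖vev (gradPoly (p K)) x‖ ^ 2 :=
    Finset.sum_nonneg fun _ _ => integral_nonneg fun _ => sq_nonneg _
  have hJ : 0 ≤ ∑ K, ∑ F : m.faces K, (Metric.diam (m.elem K))⁻¹ *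
      ∫ y in m.face F, (pev (p K) y - pev (q F) y) ^ 2 ∂μHE[n] :=
    Finset.sum_nonneg fun _ _ => Finset.sum_nonneg fun _ _ => jump_nonneg _ _ _ _
  rw [energy]
  have hTG := mul_nonneg (mul_nonneg hT.le (sq_nonneg ρ)) hG
  have hρJ := mul_nonneg (sq_nonneg ρ) hJ
  linarith only [h1, h6, h7, hG, hJ, hTG, hρJ]

end PolytopalMesh

/-! ### Well-posedness of the scheme. -/

namespace PolytopalMesh

variable {n k : ℕ} {Ω : Set (Euc (n + 1))} {m : PolytopalMesh Ω} {γ η M : ℝ}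

/-- Once `u_0` vanishes, the jump part of the energy is the norm of `u_b`, and the face inverse
inequality gives pointwise vanishing. -/
lemma Represents.eq_zero {u : m.Mh k} {p q} (h : m.Represents u p q)
    (hm : m.IsShapeRegular γ η) (hM1 : 1 ≤ M) (hM : γ * η ≤ M)
    (hp : ∑ K, ∫ x in m.elem K, pev (p K) x ^ 2 ≤ 0) (hE : m.energy p q ≤ 0) : u = 0 := by
  have hp0 : ∀ K, p K = 0 := by
    intro K
    have h1 := (Finset.sum_eq_zero_iff_of_nonneg fun K _ => integral_nonneg fun _ =>
      sq_nonneg _).1 (hp.antisymm (Finset.sum_nonneg fun K _ => integral_nonneg fun _ =>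
      sq_nonneg _)) K (Finset.mem_univ _)
    obtain ⟨F, hF⟩ := m.faces_nonempty (K := K)
    obtain ⟨c, -, r, hr, hB, -⟩ := exists_ball_subset_cell hm hF
    exact eq_zero_of_setIntegral_sq_eq_zero (m.isCompact_elem K) hr
      (hB.trans (cell_subset_elem hF)) h1
  have hq0 : ∀ F, ∀ y ∈ m.face F, pev (q F) y = 0 := by
    intro F y hy
    obtain ⟨K, hF⟩ := m.face_mem F
    obtain ⟨C, hC, H⟩ := exists_face_sup_bound n k hM1
    obtain ⟨c, hc, r, hr, hB, hd⟩ := exists_ball_subset_face' hm hM hF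
    have h1 : (Metric.diam (m.elem K))⁻¹ *
        ∫ y in m.face F, (pev (p K) y - pev (q F) y) ^ 2 ∂μHE[n] ≤ 0 := by
      refine le_trans ?_ hE
      refine le_trans ?_ (le_add_of_nonneg_left (Finset.sum_nonneg fun _ _ => integral_nonneg
        fun _ => sq_nonneg _))
      refine le_trans ?_ (Finset.single_le_sum (f := fun K => ∑ F : m.faces K,
        (Metric.diam (m.elem K))⁻¹ *
          ∫ y in m.face F, (pev (p K) y - pev (q F) y) ^ 2 ∂μHE[n])
        (fun K _ => Finset.sum_nonneg fun F _ => jump_nonneg K F.1 (p K) (q F))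
        (Finset.mem_univ K))
      exact Finset.single_le_sum (f := fun F : m.faces K => (Metric.diam (m.elem K))⁻¹ *
        ∫ y in m.face F, (pev (p K) y - pev (q F) y) ^ 2 ∂μHE[n])
        (fun F _ => jump_nonneg K F.1 (p K) (q F)) (Finset.mem_univ ⟨F, hF⟩)
    have h2 : ∫ y in m.face F, pev (q F) y ^ 2 ∂μHE[n] ≤ 0 := by
      have h3 := nonpos_of_mul_nonpos_right h1 (inv_pos.2 (m.diam_elem_pos K))
      simpa [hp0] using h3
    have h4 := H (q F) (h.degree_face F) (m.face F) (m.normal K F) c r _ (m.isCompact_face F)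
      (m.norm_normal K F hF) (fun y hy => m.normal_orthogonal K F hF y hy c hc) hr hB
      (m.diam_elem_pos K) hd y (m.normal_orthogonal K F hF y hy c hc)
      (dist_le_diam (face_subset_elem hF hy) (face_subset_elem hF hc))
    have h5 : pev (q F) y ^ 2 ≤ 0 := nonpos_of_mul_nonpos_left
      (h4.trans (mul_nonpos_of_nonneg_of_nonpos hC.le h2)) (pow_pos (m.diam_elem_pos K) n)
    exact pow_eq_zero_iff two_ne_zero |>.1 (h5.antisymm (sq_nonneg _))
  refine Prod.ext (funext fun K => Subtype.ext ?_) (funext fun F => Subtype.ext ?_)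
  · rw [h.eq_elem, hp0]
    ext x
    simp
  · rw [h.eq_face]
    ext y
    by_cases hy : y ∈ m.face F <;> simp [hy, hq0]

lemma isCompact_closure_domain (hΩ : IsPolyhedralDomain Ω) : IsCompact (closure Ω) :=
  hΩ.isPolytope.isCompact

section Load

variable {f : Euc (n + 1) → ℝ}

lemma memLp_closure (m : PolytopalMesh Ω) (hΩ : IsPolyhedralDomain Ω)
    (hf : MemLp f 2 (volume.restrict Ω)) : MemLp f 2 (volume.restrict (closure Ω)) := by
  rwa [m.restrict_closure_eq hΩ]

lemma integrableOn_closure (m : PolytopalMesh Ω) (hΩ : IsPolyhedralDomain Ω)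
    (hf : MemLp f 2 (volume.restrict Ω)) : IntegrableOn f (closure Ω) := by
  have : IsFiniteMeasure (volume.restrict (closure Ω)) :=
    isFiniteMeasure_restrict.2 (isCompact_closure_domain hΩ).measure_lt_top.ne
  exact (memLp_closure m hΩ hf).integrable one_le_two

lemma integrableOn_mul_pev (hΩ : IsPolyhedralDomain Ω) (hf : MemLp f 2 (volume.restrict Ω))
    (K : Fin m.nElem) (p : MvPolynomial (Fin (n + 1)) ℝ) :
    IntegrableOn (fun x => f x * pev p x) (m.elem K) :=
  ((integrableOn_closure m hΩ hf).mono_set (elem_subset_closure K)).mul_continuousOn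
    (Continuous.continuousOn (by fun_prop)) (m.isCompact_elem K)

lemma setIntegral_mul_eq {u : m.Mh k} {p q} (h : m.Represents u p q) (K : Fin m.nElem) :
    ∫ x in m.elem K, f x * (u.1 K : Euc (n + 1) → ℝ) x = ∫ x in m.elem K, f x * pev (p K) x :=
  setIntegral_congr_fun (m.isCompact_elem K).measurableSet fun x hx => by simp [h.eq_elem, hx]

/-- The right-hand side of the weak Galerkin scheme. -/
noncomputable def loadₗ (m : PolytopalMesh Ω) (k : ℕ) (hΩ : IsPolyhedralDomain Ω)
    (hf : MemLp f 2 (volume.restrict Ω)) : m.Mh k →ₗ[ℝ] ℝ where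
  toFun v := ∑ K, ∫ x in m.elem K, f x * (v.1 K : Euc (n + 1) → ℝ) x
  map_add' u v := by
    obtain ⟨p, q, h⟩ := exists_represents u
    obtain ⟨p', q', h'⟩ := exists_represents v
    rw [← Finset.sum_add_distrib]
    refine Finset.sum_congr rfl fun K _ => ?_
    rw [setIntegral_mul_eq h, setIntegral_mul_eq h', setIntegral_mul_eq (h.add h'),
      ← integral_add (integrableOn_mul_pev hΩ hf K _) (integrableOn_mul_pev hΩ hf K _)]
    simp [mul_add]
  map_smul' a v := by
    obtain ⟨p, q, h⟩ := exists_represents v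
    rw [RingHom.id_apply, smul_eq_mul, Finset.mul_sum]
    refine Finset.sum_congr rfl fun K _ => ?_
    rw [setIntegral_mul_eq h, setIntegral_mul_eq (h.smul a), ← integral_const_mul]
    simp [mul_left_comm]

/-- Young's inequality with a free weight, used in place of Cauchy–Schwarz so that the `u_0` term
can be absorbed. -/
lemma two_mul_load_le (hΩ : IsPolyhedralDomain Ω) (hf : MemLp f 2 (volume.restrict Ω))
    (p : Fin m.nElem → MvPolynomial (Fin (n + 1)) ℝ) {a : ℝ} (ha : 0 < a) :
    2 * ∑ K, ∫ x in m.elem K, f x * pev (p K) x ≤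
      a * (∫ x in Ω, f x ^ 2) + a⁻¹ * ∑ K, ∫ x in m.elem K, pev (p K) x ^ 2 := by
  have hf2 : IntegrableOn (fun x => f x ^ 2) (closure Ω) := (memLp_closure m hΩ hf).integrable_sq
  rw [← m.restrict_closure_eq hΩ, setIntegral_closure_eq_sum m hf2, Finset.mul_sum,
    Finset.mul_sum, Finset.mul_sum, ← Finset.sum_add_distrib]
  refine Finset.sum_le_sum fun K _ => ?_
  have i1 := (hf2.mono_set (elem_subset_closure K)).const_mul a
  have i2 := (integrableOn_of_continuous (f := fun x => pev (p K) x ^ 2) (by fun_prop)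
    (m.isCompact_elem K)).const_mul a⁻¹
  rw [← integral_const_mul, ← integral_const_mul, ← integral_const_mul, ← integral_add i1 i2]
  refine integral_mono ((integrableOn_mul_pev hΩ hf K (p K)).const_mul 2) (i1.add i2) fun x => ?_
  have h1 : a * f x ^ 2 + a⁻¹ * pev (p K) x ^ 2 - 2 * (f x * pev (p K) x) =
      a⁻¹ * (a * f x - pev (p K) x) ^ 2 := by
    field_simp
    ring
  have h2 : 0 ≤ a⁻¹ * (a * f x - pev (p K) x) ^ 2 := by positivity
  linarith

end Load

/-- The bilinear form `(∇_w u, ∇_w v)`. -/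
noncomputable def stiffnessₗ (m : PolytopalMesh Ω) (k : ℕ) (hm : m.IsShapeRegular γ η) :
    m.Mh k →ₗ[ℝ] m.Mh k →ₗ[ℝ] ℝ :=
  LinearMap.mk₂ ℝ (fun u v => m.innerSigma (m.weakGrad u) (m.weakGrad v))
    (fun u u' v => by
      simp only [innerSigma, weakGrad_add hm, ← Finset.sum_add_distrib]
      exact Finset.sum_congr rfl fun K _ => (m.innerLocₗ k K).map_add₂ _ _ _)
    (fun a u v => by
      simp only [innerSigma, weakGrad_smul hm, smul_eq_mul, Finset.mul_sum]
      exact Finset.sum_congr rfl fun K _ => (m.innerLocₗ k K).map_smul₂ _ _ _)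
    (fun u v v' => by
      simp only [innerSigma, weakGrad_add hm, ← Finset.sum_add_distrib]
      exact Finset.sum_congr rfl fun K _ => (m.innerLocₗ k K _).map_add _ _)
    (fun a u v => by
      simp only [innerSigma, weakGrad_smul hm, smul_eq_mul, Finset.mul_sum]
      exact Finset.sum_congr rfl fun K _ => (m.innerLocₗ k K _).map_smul _ _)

lemma Represents.eq_zero_of_mem_Mh0 {u : m.Mh k} {p q} (h : m.Represents u p q)
    (hu : u ∈ m.Mh0 k) (F : Fin m.nFace) (hF : m.face F ⊆ frontier Ω) (y : Euc (n + 1))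
    (hy : y ∈ m.face F) : pev (q F) y = 0 := by
  have h1 := congrFun (h.eq_face F) y
  rw [hu F hF, Set.indicator_of_mem hy] at h1
  exact h1.symm

/-- Well-posedness of the weak Galerkin scheme. -/
lemma exists_wellPosed (k : ℕ) (hn : 1 ≤ n) (hΩ : IsPolyhedralDomain Ω) (γ η : ℝ) :
    ∃ C : ℝ, 0 < C ∧ ∀ m : PolytopalMesh Ω, m.IsShapeRegular γ η →
      ∀ f : Euc (n + 1) → ℝ, MemLp f 2 (volume.restrict Ω) →
        ∃ u : m.Mh k, m.IsWGSolution f u ∧ (∀ u' : m.Mh k, m.IsWGSolution f u' → u' = u) ∧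
          m.normOneH u ≤ C * Real.sqrt (∫ x in Ω, f x ^ 2) := by
  have hM1 : 1 ≤ max 1 (γ * η) := le_max_left _ _
  have hM : γ * η ≤ max 1 (γ * η) := le_max_right _ _
  -- The radius is fixed by `Ω` before any mesh is chosen, so the constant does not depend on the
  -- mesh.
  obtain ⟨ρ, hρ⟩ := (isCompact_closure_domain hΩ).isBounded.subset_closedBall 0
  have hρ0 : 0 ≤ ρ := Metric.nonempty_closedBall.1 (hΩ.isPolytope.1.mono hρ)
  obtain ⟨c, C, hc, -, H⟩ := exists_energy_bounds n k hn hM1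
  obtain ⟨P, hP, HP⟩ := exists_poincare n (k + 1) hM1 hρ0
  refine ⟨Real.sqrt P / c, by positivity, fun m hm f hf => ?_⟩
  have hB : ∀ v : m.Mh0 k, (m.stiffnessₗ k hm).domRestrict₁₂ (m.Mh0 k) (m.Mh0 k) v v = 0 →
      v = 0 := by
    intro v hv
    obtain ⟨p, q, h⟩ := exists_represents v.1
    have h1 : c * m.energy p q ≤ 0 := (H hm hM h).1.trans_eq hv
    have hE : m.energy p q ≤ 0 := nonpos_of_mul_nonpos_right h1 hc
    have h2 := HP hΩ hρ hm hM h.degree_elem (h.eq_zero_of_mem_Mh0 v.2)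
    exact Subtype.ext (h.eq_zero hm hM1 hM (h2.trans (mul_nonpos_of_nonneg_of_nonpos hP.le hE)) hE)
  obtain ⟨u, hu, huniq⟩ := existsUnique_of_definite (V := m.Mh0 k) _ hB
    ((m.loadₗ k hΩ hf).domRestrict (m.Mh0 k))
  refine ⟨u, ⟨u.2, fun v hv => hu ⟨v, hv⟩⟩, fun u' hu' => ?_, ?_⟩
  · exact congrArg Subtype.val (huniq ⟨u', hu'.1⟩ fun v => hu'.2 v v.2)
  · obtain ⟨p, q, h⟩ := exists_represents u.1
    have h1 : c * m.energy p q ≤ ∑ K, ∫ x in m.elem K, f x * pev (p K) x := by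
      refine ((H hm hM h).1.trans_eq (hu u)).trans_eq ?_
      change ∑ K, ∫ x in m.elem K, f x * (u.1.1 K : Euc (n + 1) → ℝ) x = _
      exact Finset.sum_congr rfl fun K _ => setIntegral_mul_eq h K
    have h2 := HP hΩ hρ hm hM h.degree_elem (h.eq_zero_of_mem_Mh0 u.2)
    -- With weight `P / c` the Poincaré inequality bounds the `u_0` term by `c * energy`, which is
    -- half of the left-hand side `2 * c * energy`.
    have h3 := two_mul_load_le hΩ hf p (div_pos hP hc)
    have h4 := mul_le_mul_of_nonneg_left h2 (inv_pos.2 (div_pos hP hc)).le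
    have h5 : (P / c)⁻¹ * (P * m.energy p q) = c * m.energy p q := by
      field_simp
    have h6 : m.energy p q ≤ P / c ^ 2 * ∫ x in Ω, f x ^ 2 := by
      have h7 : c * m.energy p q ≤ P / c * ∫ x in Ω, f x ^ 2 := by linarith
      calc m.energy p q = (c * m.energy p q) / c := by field_simp
        _ ≤ (P / c * ∫ x in Ω, f x ^ 2) / c := by gcongr
        _ = _ := by field_simp
    rw [normOneH_eq h]
    refine (Real.sqrt_le_sqrt h6).trans_eq ?_
    rw [Real.sqrt_mul (by positivity), Real.sqrt_div hP.le, Real.sqrt_sq hc.le]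

end PolytopalMesh

theorem lemma4p4 (d k : ℕ) (hd : 2 ≤ d) (Ω : Set (Euc d)) (hΩ : IsPolyhedralDomain Ω)
    (γ η : ℝ) :
    ∃ c C : ℝ, 0 < c ∧ 0 < C ∧
      ∀ m : PolytopalMesh Ω, m.IsShapeRegular γ η →
        (∀ (u : m.Mh k) (w : m.SigmaInv k), m.IsWeakGrad u w ↔ w = m.weakGrad u) ∧
        (∀ u ∈ m.Mh0 k,
          c * m.normOneH u ≤ m.normSigma (m.weakGrad u) ∧
          m.normSigma (m.weakGrad u) ≤ C * m.normOneH u) ∧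
        (∀ f : Euc d → ℝ, MemLp f 2 (volume.restrict Ω) →
          ∃ u : m.Mh k, m.IsWGSolution f u ∧
            (∀ u' : m.Mh k, m.IsWGSolution f u' → u' = u) ∧
            m.normOneH u ≤ C * Real.sqrt (∫ x in Ω, f x ^ 2)) := by
  obtain ⟨n, rfl⟩ : ∃ n, d = n + 1 := ⟨d - 1, by omega⟩
  have hn : 1 ≤ n := by omega
  obtain ⟨c, C, hc, hC, H⟩ :=
    PolytopalMesh.exists_energy_bounds n k hn (le_max_left 1 (γ * η))
  obtain ⟨C', hC', H'⟩ := PolytopalMesh.exists_wellPosed k hn hΩ γ η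
  refine ⟨Real.sqrt c, max (Real.sqrt C) C', by positivity, by positivity, fun m hm =>
    ⟨PolytopalMesh.isWeakGrad_iff_eq hm, fun u _ => ?_, fun f hf => ?_⟩⟩
  · obtain ⟨p, q, h⟩ := PolytopalMesh.exists_represents u
    obtain ⟨h1, h2⟩ := H hm (le_max_right _ _) h
    rw [PolytopalMesh.normOneH_eq h, PolytopalMesh.normSigma]
    refine ⟨?_, ?_⟩
    · rw [← Real.sqrt_mul hc.le]
      exact Real.sqrt_le_sqrt h1
    · refine (Real.sqrt_le_sqrt h2).trans ?_
      rw [Real.sqrt_mul hC.le]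
      gcongr
      exact le_max_left _ _
  · obtain ⟨u, hu, huniq, hle⟩ := H' m hm f hf
    refine ⟨u, hu, huniq, hle.trans ?_⟩
    gcongr
    exact le_max_right _ _
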